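/- Let $VA$ be a set of variables containing $\mathbb{N}=\{1,2,3,\dots\}$. A literal is a variable $v$ or its complement $\overline v$ (written $-v$ for $v\in\mathbb{N}$). A clause is a finite set of literals containing no complementary pair; a clause-set is a finite set of clauses. For a clause-set $F$ let $n(F)$ be the number of variables occurring in $F$, let $\mathrm{lit}(F)$ be the set of the $2n(F)$ literals over these variables, and let $\delta(F)=|F|-n(F)$ be its deficiency. $F$ is minimally unsatisfiable if it is unsatisfiable and removing any clause makes it satisfiable. $F\cong G$ means that there is a complement-preserving bijection $\mathrm{lit}(F)\to\mathrm{lit}(G)$ that maps $F$ onto $G$. Let $\mathcal{C}$ be the set of all minimally unsatisfiable $F\ne\{\bot\}$ with $\delta(F)=1$ all of whose clauses have at most two literals, where $\bot=\emptyset$ is the empty clause. For $F\in\mathcal{C}$ the implication digraph has vertex-set $\mathrm{lit}(F)$ and arcs $\overline x\to x$ for $\{x\}\in F$, and $\overline x\to y$, $\overline y\to x$ for $\{x,y\}\in F$ with $x\ne y$; the implication graph $\mathrm{ig}(F)$ is its underlying simple graph. With $M_n=\{\{-1,2\},\{-2,3\},\dots,\{-(n-1),n\}\}$ put - $U^2_n=M_n\cup\{\{1\},\{-n\}\}$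 for $n\ge1$; - $U^1_{n,i}=M_n\cup\{\{1\},\{-n,-i\}\}$ for $n\ge2$, $1\le i\le n-1$; - $U^0_{n,i}=M_n\cup\{\{1,i\},\{-n,-i\}\}$ for $n\ge3$, $2\le i\le\frac{n+1}{2}$; - $U^0_{n,x,y}=M_n\cup\{\{1,x\},\{-n,-y\}\}$ for $n\ge4$, $2\le x<y\le n-1$, $x+y\le n+1$. **Theorem.** All these clause-sets belong to $\mathcal{C}$, and every $F\in\mathcal{C}$ is isomorphic to exactly one of them, with uniquely determined indices. The first lower index is $n(F)$, and the upper index is the number $u(F)\in\{0,1,2\}$ of unit-clauses of $F$; for $u(F)=0$ the family $U^0_{n,i}$ applies if some variable occurs exactly twice positively and exactly twice negatively in $F$, and $U^0_{n,x,y}$ applies otherwise. Let $\mathrm{canon}(F)$ be the member of the four families isomorphic to $F$, and let $\mathrm{canon}'(F)=\mathrm{ig}(\mathrm{canon}(F))$. Then for all $F,F'\in\mathcal{C}$ $$F\cong F'\iff \mathrm{canon}(F)=\mathrm{canon}(F')\iff \mathrm{canon}'(F)=\mathrm{canon}'(F')\iff \mathrm{ig}(F)\cong\mathrm{ig}(F').$$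 Suppose moreover that variables are named by bit-strings (distinct variables by distinct strings, natural numbers by their binary representations). Given any listing of the clauses of some $F\in\mathcal{C}$, without repetitions, a Turing machine can compute in polynomial time the applicable family with its indices, the clause-set $\mathrm{canon}(F)$, and the graph $\mathrm{canon}'(F)$, where the listings that are output depend only on the isomorphism type of $F$. Finally, given any listing of the vertices and edges, without repetitions, of a graph $G$ isomorphic to $\mathrm{ig}(F)$ for some $F\in\mathcal{C}$ (with vertices named by distinct bit-strings; in particular $G=\mathrm{ig}(F)$ or $G=\mathrm{canon}'(F)$), a Turing machine can compute in polynomial time a clause-set isomorphic to $F$. -/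

import Mathlib

namespace TwoMU

/-! ### Literals, clauses, clause-sets -/

/-- Literals over the variables `V`: `(v, true)` is `v`, and `(v, false)` is its complement. -/
abbrev Literal (V : Type) := V × Bool

/-- The complement of a literal. -/
def compl {V : Type} (x : Literal V) : Literal V := (x.1, !x.2)

/-- A clause-set is a finite set of finite sets of literals (that its clauses are clash-free
is the predicate `IsClauseSet`). -/
abbrev ClauseSet (V : Type) := Finset (Finset (Literal V))

section ClauseSets

variable {V : Type} [DecidableEq V]

/-- All clauses are clash-free (non-tautological). -/
def IsClauseSet (F : ClauseSet V) : Prop := ∀ C ∈ F, ∀ x ∈ C, compl x ∉ C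

/-- The set of variables occurring in `F`. -/
def vars (F : ClauseSet V) : Finset V := F.biUnion fun C => C.image Prod.fst

/-- The set of literals whose variable occurs in `F`. -/
def lits (F : ClauseSet V) : Finset (Literal V) := vars F ×ˢ Finset.univ

/-- The deficiency, the number of clauses minus the number of variables. -/
def deficiency (F : ClauseSet V) : ℤ := (F.card : ℤ) - ((vars F).card : ℤ)

/-- The number of unit-clauses. -/
def unitCount (F : ClauseSet V) : ℕ := (F.filter fun C => C.card = 1).card

/-- The literal-degree, the number of clauses of `F` containing `x`. -/
def litDegree (F : ClauseSet V) (x : Literal V) : ℕ := (F.filter fun C => x ∈ C).card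

/-- Satisfiability: some total assignment makes a literal true in every clause. -/
def Satisfiable (F : ClauseSet V) : Prop := ∃ τ : V → Bool, ∀ C ∈ F, ∃ x ∈ C, τ x.1 = x.2

/-- Minimal unsatisfiability. -/
def IsMU (F : ClauseSet V) : Prop := ¬ Satisfiable F ∧ ∀ C ∈ F, Satisfiable (F.erase C)

/-- The minimally unsatisfiable 2-CNFs of deficiency one, except for the clause-set that
consists of the empty clause. -/
def IsTwoMUDefOne (F : ClauseSet V) : Prop :=
  IsClauseSet F ∧ (∀ C ∈ F, C.card ≤ 2) ∧ IsMU F ∧ deficiency F = 1 ∧ F ≠ {∅}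

/-- Isomorphism of clause-sets: a complement-preserving bijection between the literal-sets that
maps the one clause-set to the other. -/
def Iso (F G : ClauseSet V) : Prop :=
  ∃ f : Literal V → Literal V, Set.BijOn f (lits F : Set (Literal V)) (lits G : Set (Literal V)) ∧
    (∀ x ∈ lits F, f (compl x) = compl (f x)) ∧ F.image (fun C => C.image f) = G

end ClauseSets

/-! ### The four families -/

/-- The literal that belongs to a nonzero integer, as in the DIMACS format, where `ι` embeds the
positive natural numbers into the variables. -/
def intLit {V : Type} (ι : ℕ+ ↪ V) (z : ℤ) : Literal V := (ι z.natAbs.toPNat', decide (0 < z))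

/-- Names for the members of the four families. -/
inductive Pattern
  | U2 (n : ℕ)
  | U1 (n i : ℕ)
  | U0i (n i : ℕ)
  | U0xy (n x y : ℕ)

namespace Pattern

/-- The ranges of the parameters. -/
def Valid : Pattern → Prop
  | U2 n => 1 ≤ n
  | U1 n i => 2 ≤ n ∧ 1 ≤ i ∧ i ≤ n - 1
  | U0i n i => 3 ≤ n ∧ 2 ≤ i ∧ 2 * i ≤ n + 1
  | U0xy n x y => 4 ≤ n ∧ 2 ≤ x ∧ x < y ∧ y ≤ n - 1 ∧ x + y ≤ n + 1

/-- The upper index, `2`, `1` or `0`. -/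
def upper : Pattern → ℕ
  | U2 _ => 2
  | U1 _ _ => 1
  | U0i _ _ => 0
  | U0xy _ _ _ => 0

/-- The first lower index `n`. -/
def size : Pattern → ℕ
  | U2 n => n
  | U1 n _ => n
  | U0i n _ => n
  | U0xy n _ _ => n

/-- The parameter-list, consisting of the remaining lower indices. -/
def params : Pattern → List ℕ
  | U2 _ => []
  | U1 _ i => [i]
  | U0i _ i => [i]
  | U0xy _ x y => [x, y]

variable {V : Type} [DecidableEq V]

/-- The chain `{-1,2}, {-2,3}, …, {-(n-1),n}`. -/
def chain (ι : ℕ+ ↪ V) (n : ℕ) : ClauseSet V :=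
  (Finset.Icc 1 (n - 1)).image fun k : ℕ => {intLit ι (-(k : ℤ)), intLit ι ((k : ℤ) + 1)}

/-- The clause-sets of the four families. -/
def clauseSet (ι : ℕ+ ↪ V) : Pattern → ClauseSet V
  | U2 n => chain ι n ∪ {{intLit ι 1}, {intLit ι (-(n : ℤ))}}
  | U1 n i => chain ι n ∪ {{intLit ι 1}, {intLit ι (-(n : ℤ)), intLit ι (-(i : ℤ))}}
  | U0i n i =>
      chain ι n ∪ {{intLit ι 1, intLit ι (i : ℤ)}, {intLit ι (-(n : ℤ)), intLit ι (-(i : ℤ))}}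
  | U0xy n x y =>
      chain ι n ∪ {{intLit ι 1, intLit ι (x : ℤ)}, {intLit ι (-(n : ℤ)), intLit ι (-(y : ℤ))}}

/-- The case distinction on `F`: two unit-clauses; one unit-clause; no unit-clause and some
variable occurring twice positively and twice negatively; neither unit-clause nor such a
variable. -/
def Applies (F : ClauseSet V) : Pattern → Prop
  | U2 _ => unitCount F = 2
  | U1 _ _ => unitCount F = 1
  | U0i _ _ => unitCount F = 0 ∧ ∃ v : V, litDegree F (v, true) = 2 ∧ litDegree F (v, false) = 2
  | U0xy _ _ _ =>
      unitCount F = 0 ∧ ¬ ∃ v : V, litDegree F (v, true) = 2 ∧ litDegree F (v, false) = 2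

end Pattern

/-! ### Implication graphs -/

/-- Graphs `(V, E)` whose vertices are taken from `W`. -/
abbrev Graph (W : Type) := (⊤ : SimpleGraph W).Subgraph

/-- Isomorphism of graphs. -/
def GraphIso {W W' : Type} (G : Graph W) (H : Graph W') : Prop := Nonempty (G.coe ≃g H.coe)

section Graphs

variable {V : Type} [DecidableEq V]

/-- The arcs of the implication digraph; its vertices are the elements of `lits F`. -/
def idg (F : ClauseSet V) : Digraph (Literal V) where
  Adj a b := (a = compl b ∧ {b} ∈ F) ∨ ∃ x y, x ≠ y ∧ {x, y} ∈ F ∧ a = compl x ∧ b = y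

theorem mem_lits_iff (F : ClauseSet V) (x : Literal V) :
    x ∈ lits F ↔ ∃ C ∈ F, ∃ y ∈ C, y.1 = x.1 := by
  simp [lits, vars]

theorem idg_mem {F : ClauseSet V} {a b : Literal V} (h : (idg F).Adj a b) :
    a ∈ lits F ∧ b ∈ lits F := by
  rcases h with ⟨rfl, h⟩ | ⟨x, y, -, h, rfl, rfl⟩
  · exact ⟨(mem_lits_iff _ _).2 ⟨_, h, b, by simp, rfl⟩, (mem_lits_iff _ _).2 ⟨_, h, b, by simp, rfl⟩⟩
  · exact ⟨(mem_lits_iff _ _).2 ⟨_, h, x, by simp, rfl⟩, (mem_lits_iff _ _).2 ⟨_, h, b, by simp, rfl⟩⟩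

/-- The implication graph, the underlying graph of the implication digraph. -/
def ig (F : ClauseSet V) : Graph (Literal V) where
  verts := {x | x ∈ lits F}
  Adj a b := a ≠ b ∧ ((idg F).Adj a b ∨ (idg F).Adj b a)
  adj_sub h := h.1
  edge_vert h := h.2.elim (fun e => (idg_mem e).1) (fun e => (idg_mem e).2)
  symm := ⟨fun _ _ h => ⟨h.1.symm, h.2.symm⟩⟩

end Graphs

/-! ### Inputs and outputs as strings, polynomial time -/

/-- `P` lists the clauses of `F` and their literals, in any order and without repetitions. -/
def IsListing {V : Type} [DecidableEq V] (P : List (List (Literal V))) (F : ClauseSet V) : Prop :=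
  (P.map List.toFinset).Nodup ∧ (∀ C ∈ P, C.Nodup) ∧ (P.map List.toFinset).toFinset = F

/-- A list of vertices together with a list of pairs of vertices. -/
abbrev GraphData (W : Type) := List W × List (W × W)

/-- `Q` lists the vertices and the edges of `G`, in any order and without repetitions. -/
def IsGraphListing {W : Type} (Q : GraphData W) (G : Graph W) : Prop :=
  Q.1.Nodup ∧ (∀ w, w ∈ Q.1 ↔ w ∈ G.verts) ∧
    (Q.2.map fun e => s(e.1, e.2)).Nodup ∧
    ∀ e : Sym2 W, (e ∈ Q.2.map fun e => s(e.1, e.2)) ↔ e ∈ G.edgeSet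

open Computability (Γ')

/-- A bit-string as a string over the standard alphabet. -/
def encBits (l : List Bool) : List Γ' := l.map Γ'.bit

/-- The name of a literal is its sign followed by the name of its variable. -/
def litName {V : Type} (name : V → List Bool) (x : Literal V) : List Bool := x.2 :: name x.1

/-- A clause-listing as a string: every clause is put into brackets, and its literals are preceded
by commas. -/
def encClauses {V : Type} (name : V → List Bool) (P : List (List (Literal V))) : List Γ' :=
  P.flatMap fun C => Γ'.bra :: (C.flatMap fun x => Γ'.comma :: encBits (litName name x)) ++ [Γ'.ket]

/-- A graph-listing as a string: first the bracketed vertices, then the bracketed edges. -/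
def encGraph {W : Type} (name : W → List Bool) (Q : GraphData W) : List Γ' :=
  (Q.1.flatMap fun w => Γ'.bra :: encBits (name w) ++ [Γ'.ket]) ++
    Q.2.flatMap fun e => Γ'.bra :: encBits (name e.1) ++ Γ'.comma :: encBits (name e.2) ++ [Γ'.ket]

/-- Upper index, size and parameter-list, in binary and preceded by commas. -/
def encPattern (T : Pattern) : List Γ' :=
  (T.upper :: T.size :: T.params).flatMap fun k => Γ'.comma :: encBits (Computability.encodeNat k)

/-- `f` is computed by a Turing machine in polynomial time, where inputs and outputs are encoded as
strings by `ea` and `eb`. -/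
def PolyTime {α β : Type} (ea : α → List Γ') (eb : β → List Γ') (f : α → β) : Prop :=
  Nonempty (Turing.TM2ComputableInPolyTime ea eb f)

/-- The inputs of the canonisation: listings of 2-MUs of deficiency one with nonempty clauses. -/
def CnfInput (V : Type) [DecidableEq V] : Type :=
  {P : List (List (Literal V)) // ∃ F : ClauseSet V, IsTwoMUDefOne F ∧ IsListing P F}

/-- The clause-set listed by an input. -/
def CnfInput.toClauseSet {V : Type} [DecidableEq V] (P : CnfInput V) : ClauseSet V :=
  (P.1.map List.toFinset).toFinset

/-- The inputs of the reconstruction: listings of graphs, with vertices in `W`, that are isomorphic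
to the implication graph of a 2-MU over `V` of deficiency one with nonempty clauses. -/
def GraphInput (V W : Type) [DecidableEq V] : Type :=
  {Q : GraphData W // ∃ F : ClauseSet V, IsTwoMUDefOne F ∧
    ∃ G : Graph W, IsGraphListing Q G ∧ GraphIso G (ig F)}

end TwoMU

/-! A clause `{¬a, b}` is an implication `a → b`. The theorem rests on one normal form: every `F ∈
𝒞` with `n` variables consists of the implications along a single contradictory walk `¬φ x → φ 1 → ⋯
→ φ n → ¬φ y`, where `φ 1, …, φ n` have different variables and `1 ≤ x ≤ y ≤ n` (`ChainForm`). Every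
such walk yields a member of `𝒞`. Reading the walk contrapositively replaces `(x, y)` by `(n + 1 -
y, n + 1 - x)`, so one may assume `x + y ≤ n + 1`. The normalised triples `(n, x, y)` are the index
ranges of the four families: `x = 1, y = n`; `x = 1, y < n`; `1 < x = y`; `1 < x < y`.

Existence of the walk (`IsTwoMUDefOne.exists_chainForm`) is by induction on `n`. Counting literal
occurrences shows that some variable occurs once positively and once negatively. Resolving on it
stays inside `𝒞` unless the resolvent is empty, and undoing the resolution subdivides a step of the
walk or prolongs the walk at an end.

Uniqueness comes from the implication graph, which consists of the walk and its contrapositive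
(`GraphForm`). The graph has `2n` vertices. If `x ≥ 2`, then `φ x` and `¬φ x` are joined by two
paths of length `x` without inner branching vertices; if `y < n`, the same holds for `φ y` and `¬φ
y` with length `n + 1 - y`. These lengths, together with the number and degrees of the branching
vertices, determine the normalised triple (`GraphForm.params_unique`). Hence the graph determines
the isomorphism type.

For polynomial time, the same description of `(n, x, y)` is written as a formula about the positions
of the input string, with counting quantifiers and a recursion that follows a walk
(`Arith.hasParams`). For a fixed formula all numbers involved are polynomially bounded in the input
length, so they are kept in unary on stacks, and the evaluation is compiled into a Turing machine.
An output program tries all triples, and prints the result for the only triple satisfying the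
formula (`polyTime_clauses`, `polyTime_graph`). -/

namespace TwoMU
open Computability (Γ')
open Turing

/-! ### Structured stack programs -/

/-- Structured programs working on stacks of symbols, with one symbol-register. The command
`loop k c` runs `c` after every successful removal of a symbol from the stack `k`. -/
inductive Cmd
  | skip
  | push (k : ℕ) (f : Option Γ' → Γ')
  | pop (k : ℕ)
  | peek (k : ℕ)
  | seq (c d : Cmd)
  | ite (b : Option Γ' → Bool) (c d : Cmd)
  | loop (k : ℕ) (c : Cmd)

/-- The contents of the stacks. -/
abbrev Stacks := ℕ → List Γ'

namespace Cmd

open Function (update)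

/-- `Runs c v S t v' S'`: started with register `v` and stacks `S`, the program `c` stops after `t`
jumps with register `v'` and stacks `S'`. -/
inductive Runs : Cmd → Option Γ' → Stacks → ℕ → Option Γ' → Stacks → Prop
  | skip (v S) : Runs skip v S 0 v S
  | push (k f v S) : Runs (push k f) v S 0 v (update S k (f v :: S k))
  | pop (k v S) : Runs (pop k) v S 0 (S k).head? (update S k (S k).tail)
  | peek (k v S) : Runs (peek k) v S 0 (S k).head? S
  | seq {c d v S t v' S' t' v'' S''} : Runs c v S t v' S' → Runs d v' S' t' v'' S'' →
      Runs (seq c d) v S (t + t') v'' S''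
  | ite_true {b c d v S t v' S'} : b v = true → Runs c v S t v' S' → Runs (ite b c d) v S t v' S'
  | ite_false {b c d v S t v' S'} : b v = false → Runs d v S t v' S' →
      Runs (ite b c d) v S t v' S'
  -- Only the test at the head of a loop costs a jump. Everything else is straight-line code, which
  -- a machine performs within one step.
  | loop_nil {k c v S} : S k = [] → Runs (loop k c) v S 1 none S
  | loop_cons {k c v S a l t v' S' t' v'' S''} : S k = a :: l →
      Runs c (some a) (update S k l) t v' S' → Runs (loop k c) v' S' t' v'' S'' →
      Runs (loop k c) v S (t + t' + 1) v'' S''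

/-- All stacks used by a program have numbers at most `m`. -/
def Below (m : ℕ) : Cmd → Prop
  | skip => True
  | push k _ => k ≤ m
  | pop k => k ≤ m
  | peek k => k ≤ m
  | seq c d => c.Below m ∧ d.Below m
  | ite _ c d => c.Below m ∧ d.Below m
  | loop k c => k ≤ m ∧ c.Below m

theorem Below.mono {m m' : ℕ} (h : m ≤ m') : ∀ {c : Cmd}, c.Below m → c.Below m'
  | skip, _ => trivial
  | push _ _, hc => le_trans hc h
  | pop _, hc => le_trans hc h
  | peek _, hc => le_trans hc h
  | seq _ _, hc => ⟨hc.1.mono h, hc.2.mono h⟩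
  | ite _ _ _, hc => ⟨hc.1.mono h, hc.2.mono h⟩
  | loop _ _, hc => ⟨le_trans hc.1 h, hc.2.mono h⟩

theorem exists_below : ∀ c : Cmd, ∃ m, c.Below m
  | skip => ⟨0, trivial⟩
  | push k _ => ⟨k, le_refl k⟩
  | pop k => ⟨k, le_refl k⟩
  | peek k => ⟨k, le_refl k⟩
  | seq c d => by
      obtain ⟨m, hm⟩ := exists_below c
      obtain ⟨m', hm'⟩ := exists_below d
      exact ⟨max m m', hm.mono (le_max_left _ _), hm'.mono (le_max_right _ _)⟩
  | ite _ c d => by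
      obtain ⟨m, hm⟩ := exists_below c
      obtain ⟨m', hm'⟩ := exists_below d
      exact ⟨max m m', hm.mono (le_max_left _ _), hm'.mono (le_max_right _ _)⟩
  | loop k c => by
      obtain ⟨m, hm⟩ := exists_below c
      exact ⟨max k m, le_max_left _ _, hm.mono (le_max_right _ _)⟩

/-- The jump targets of a program, one for every loop. -/
def Lab : Cmd → Type
  | seq c d => c.Lab ⊕ d.Lab
  | ite _ c d => c.Lab ⊕ d.Lab
  | loop _ c => Option c.Lab
  | _ => Empty

noncomputable instance labFintype : ∀ c : Cmd, Fintype c.Lab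
  | seq c d => by have := labFintype c; have := labFintype d; unfold Lab; infer_instance
  | ite _ c d => by have := labFintype c; have := labFintype d; unfold Lab; infer_instance
  | loop _ c => by have := labFintype c; unfold Lab; infer_instance
  | skip | push _ _ | pop _ | peek _ => by unfold Lab; infer_instance

/-! ### Compilation of stack programs into Turing machines -/

section Compile

variable {Λ : Type} (m : ℕ)

/-- Statements of machines with the stacks `0, …, m`. -/
abbrev St (Λ : Type) := TM2.Stmt (fun _ : Fin (m + 1) => Γ') Λ (Option Γ')

/-- The statement that runs a program and continues with `q`. -/
def stmt : (c : Cmd) → (c.Lab → Λ) → St m Λ → St m Λ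
  | skip, _, q => q
  | push k f, _, q => .push (Fin.ofNat (m + 1) k) f q
  | pop k, _, q => .pop (Fin.ofNat (m + 1) k) (fun _ o => o) q
  | peek k, _, q => .peek (Fin.ofNat (m + 1) k) (fun _ o => o) q
  | seq c d, g, q => stmt c (fun l => g (.inl l)) (stmt d (fun l => g (.inr l)) q)
  | ite b c d, g, q => .branch b (stmt c (fun l => g (.inl l)) q) (stmt d (fun l => g (.inr l)) q)
  | loop _ _, g, _ => .goto fun _ => g none

/-- The statements at the jump targets of a program that is followed by `q`. -/
def code : (c : Cmd) → (c.Lab → Λ) → St m Λ → c.Lab → St m Λ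
  | seq c d, g, q, .inl l =>
      code c (fun l => g (.inl l)) (stmt m d (fun l => g (.inr l)) q) l
  | seq _ d, g, q, .inr l => code d (fun l => g (.inr l)) q l
  | ite _ c _, g, q, .inl l => code c (fun l => g (.inl l)) q l
  | ite _ _ d, g, q, .inr l => code d (fun l => g (.inr l)) q l
  | loop k c, g, q, none => .pop (Fin.ofNat (m + 1) k) (fun _ o => o)
      (.branch Option.isSome (stmt m c (fun l => g (some l)) (.goto fun _ => g none)) q)
  | loop _ c, g, _, some l => code c (fun l => g (some l)) (.goto fun _ => g none) l

variable {m}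

/-- The restriction of the stacks to the ones of a machine. -/
def restr (m : ℕ) (S : Stacks) : Fin (m + 1) → List Γ' := fun k => S k

/-- `Fin.ofNat` reduces modulo `m + 1`, so that stacks could be identified; the bound `k ≤ m`
excludes this. -/
theorem restr_ofNat {k : ℕ} (hk : k ≤ m) (S : Stacks) :
    restr m S (Fin.ofNat (m + 1) k) = S k := by
  simp [restr, Nat.mod_eq_of_lt (Nat.lt_succ_of_le hk)]

theorem update_restr {k : ℕ} (hk : k ≤ m) (S : Stacks) (l : List Γ') :
    update (restr m S) (Fin.ofNat (m + 1) k) l = restr m (update S k l) := by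
  funext j
  have h : (j = Fin.ofNat (m + 1) k) ↔ (j : ℕ) = k := by
    rw [Fin.ext_iff]; simp [Nat.mod_eq_of_lt (Nat.lt_succ_of_le hk)]
  by_cases hj : (j : ℕ) = k
  · rw [h.2 hj]; simp [restr, Nat.mod_eq_of_lt (Nat.lt_succ_of_le hk)]
  · rw [Function.update_of_ne (fun e => hj (h.1 e))]
    simp [restr, Function.update_of_ne hj]

/-- A number of steps of a machine. -/
def steps (M : Λ → St m Λ) (t : ℕ) :
    Option (TM2.Cfg (fun _ : Fin (m + 1) => Γ') Λ (Option Γ')) →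
      Option (TM2.Cfg (fun _ : Fin (m + 1) => Γ') Λ (Option Γ')) :=
  (flip bind (TM2.step M))^[t]

theorem steps_add (M : Λ → St m Λ) (t t' : ℕ)
    (a : Option (TM2.Cfg (fun _ : Fin (m + 1) => Γ') Λ (Option Γ'))) :
    steps M (t + t') a = steps M t' (steps M t a) :=
  (congrArg (fun j => steps M j a) (Nat.add_comm t t')).trans
    (Function.iterate_add_apply _ t' t a)

theorem steps_succ (M : Λ → St m Λ) (t : ℕ)
    (a : TM2.Cfg (fun _ : Fin (m + 1) => Γ') Λ (Option Γ')) :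
    steps M (t + 1) (some a) = steps M t (TM2.step M a) := rfl

/-- Induction on the run, for all continuations `q` at once. A machine step is needed exactly where
control passes through the label of a loop, and the hypothesis on `M` places the code of `c` at its
labels. -/
theorem steps_stmt (M : Λ → St m Λ) {c : Cmd} {v S t v' S'} (h : Runs c v S t v' S') :
    ∀ (g : c.Lab → Λ) (q : St m Λ), c.Below m → (∀ l, M (g l) = code m c g q l) →
      steps M t (some (TM2.stepAux (stmt m c g q) v (restr m S))) =
        some (TM2.stepAux q v' (restr m S')) := by
  induction h with
  | skip => intro g q _ _; rfl
  | push k f v S =>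
    intro g q hk _
    simp only [stmt, TM2.stepAux, steps, Function.iterate_zero, id]
    rw [restr_ofNat hk, update_restr hk]
  | pop k v S =>
    intro g q hk _
    simp only [stmt, TM2.stepAux, steps, Function.iterate_zero, id]
    rw [restr_ofNat hk, update_restr hk]
  | peek k v S =>
    intro g q hk _
    simp only [stmt, TM2.stepAux, steps, Function.iterate_zero, id]
    rw [restr_ofNat hk]
  | @seq c d v S t v' S' t' v'' S'' _ _ ih₁ ih₂ =>
    intro g q hk hM
    have h₁ := ih₁ (fun l => g (.inl l)) (stmt m d (fun l => g (.inr l)) q) hk.1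
      (fun l => hM (.inl l))
    have h₂ := ih₂ (fun l => g (.inr l)) q hk.2 (fun l => hM (.inr l))
    rw [steps_add]
    exact (congrArg _ h₁).trans h₂
  | ite_true hb _ ih =>
    intro g q hk hM
    have h := ih (fun l => g (.inl l)) q hk.1 (fun l => hM (.inl l))
    simpa only [stmt, TM2.stepAux, hb, cond_true] using h
  | ite_false hb _ ih =>
    intro g q hk hM
    have h := ih (fun l => g (.inr l)) q hk.2 (fun l => hM (.inr l))
    simpa only [stmt, TM2.stepAux, hb, cond_false] using h
  | @loop_nil k c v S hS =>
    intro g q hk hM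
    have h0 := hM none
    simp only [code] at h0
    simp only [stmt, TM2.stepAux, steps, Function.iterate_one, flip, Option.bind_eq_bind,
      Option.bind_some, TM2.step, h0, restr_ofNat hk.1, hS, List.head?_nil, Option.isSome_none,
      cond_false, List.tail_nil]
    rw [update_restr hk.1, ← hS, Function.update_eq_self]
  | @loop_cons k c v S a l t v' S' t' v'' S'' hS _ _ ih₁ ih₂ =>
    intro g q hk hM
    have h0 := hM none
    simp only [code] at h0
    have h₁ := ih₁ (fun l => g (some l)) (.goto fun _ => g none) hk.2 (fun l => hM (some l))
    have h₂ := ih₂ g q hk hM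
    have h₃ : TM2.step M (TM2.stepAux (stmt m (loop k c) g q) v (restr m S)) =
        some (TM2.stepAux (stmt m c (fun l => g (some l)) (.goto fun _ => g none)) (some a)
          (restr m (update S k l))) := by
      simp only [stmt, TM2.stepAux, TM2.step, h0, restr_ofNat hk.1, hS, List.head?_cons,
        Option.isSome_some,
        cond_true, List.tail_cons]
      rw [update_restr hk.1]
    rw [steps_succ, steps_add, h₃]
    exact (congrArg _ h₁).trans h₂

end Compile

/-- The stacks with contents `l` on stack `k` that are empty otherwise. -/
def single (k : ℕ) (l : List Γ') : Stacks := update (fun _ => []) k l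

/-- The machine of a program, with input stack `0` and output stack `1`. -/
noncomputable def machine (m : ℕ) (c : Cmd) : FinTM2 where
  K := Fin (m + 1)
  k₀ := 0
  k₁ := Fin.ofNat (m + 1) 1
  Γ := fun _ => Γ'
  Λ := Option c.Lab
  main := none
  σ := Option Γ'
  initialState := none
  Γk₀Fin := inferInstanceAs (Fintype Γ')
  m := fun l => l.elim (stmt m c some .halt) (code m c some .halt)

/-- A halting configuration has the initial register and empty stacks apart from the output; this is
why the run has to end with register `none`. -/
theorem polyTime_of_runs {α β : Type} {ea : α → List Γ'} {eb : β → List Γ'} {f : α → β}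
    (c : Cmd) (p : Polynomial ℕ)
    (h : ∀ a, ∃ t, t ≤ p.eval (ea a).length ∧
      Runs c none (single 0 (ea a)) t none (single 1 (eb (f a)))) : PolyTime ea eb f := by
  -- The bound is raised by one below, so that the output stack `1` exists even if the program does
  -- not use it.
  obtain ⟨m₀, hm₀⟩ := exists_below c
  have hm : c.Below (m₀ + 1) := hm₀.mono (Nat.le_succ _)
  generalize hmm : m₀ + 1 = m at hm
  have h1m : 1 ≤ m := by omega
  choose t ht hr using h
  -- The additional step leaves the main label.
  refine ⟨⟨⟨machine m c, Equiv.refl _, Equiv.refl _⟩, p + 1, fun a => ⟨⟨t a + 1, ?_⟩, ?_⟩⟩⟩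
  · have hinit : initList (machine m c) ((ea a).map (Equiv.refl Γ').invFun) =
        ⟨some none, none, restr m (single 0 (ea a))⟩ := by
      have e : (ea a).map (Equiv.refl Γ').invFun = ea a := List.map_id _
      refine (congrArg (initList (machine m c)) e).trans ?_
      unfold initList
      congr 1
      funext (k : Fin (m + 1))
      by_cases hk : k = (0 : Fin (m + 1))
      · subst hk
        simp only [machine, restr, single]
        rfl
      · have hk' : (k : ℕ) ≠ 0 := fun e => hk (Fin.ext e)
        have : restr m (single 0 (ea a)) k = [] :=
          Function.update_of_ne (f := fun _ : ℕ => ([] : List Γ')) hk' _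
        rw [this]
        exact dif_neg hk
    have hhalt : haltList (machine m c) ((eb (f a)).map (Equiv.refl Γ').invFun) =
        ⟨none, none, restr m (single 1 (eb (f a)))⟩ := by
      have e : (eb (f a)).map (Equiv.refl Γ').invFun = eb (f a) := List.map_id _
      refine (congrArg (haltList (machine m c)) e).trans ?_
      unfold haltList
      congr 1
      funext (k : Fin (m + 1))
      by_cases hk : k = Fin.ofNat (m + 1) 1
      · subst hk
        rw [restr_ofNat h1m]
        simp only [machine, single]
        exact dif_pos rfl
      · have hk' : (k : ℕ) ≠ 1 := fun e => hk (by
          apply Fin.ext; rw [e]; simp [Nat.mod_eq_of_lt (show 1 < m + 1 by omega)])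
        have : restr m (single 1 (eb (f a))) k = [] :=
          Function.update_of_ne (f := fun _ : ℕ => ([] : List Γ')) hk' _
        rw [this]
        exact dif_neg hk
    have key := steps_stmt (m := m) (Λ := Option c.Lab)
      (fun l => l.elim (stmt m c some .halt) (code m c some .halt)) (hr a) some .halt hm
      (fun l => rfl)
    rw [Function.iterate_succ_apply]
    refine Eq.trans ?_ (key.trans ?_)
    · change _ = ((flip bind (machine m c).step)^[t a]) _
      congr 1
      change flip bind (machine m c).step
        (some (initList (machine m c) ((ea a).map (Equiv.refl Γ').invFun))) = _
      rw [hinit]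
      rfl
    · change _ = some (haltList (machine m c) ((eb (f a)).map (Equiv.refl Γ').invFun))
      rw [hhalt]
      rfl
  · rw [Polynomial.eval_add, Polynomial.eval_one]
    exact Nat.add_le_add_right (ht a) 1

end Cmd
end TwoMU

namespace TwoMU
open Computability (Γ')
open Function (update)

namespace Cmd

/-! ### Specifications with time bounds -/

/-- From register `v` and stacks `S`, the program `c` reaches the stacks `S'` within `B` jumps. -/
def SpecAt (v : Option Γ') (c : Cmd) (S S' : Stacks) (B : ℕ) : Prop :=
  ∃ v' t, t ≤ B ∧ Runs c v S t v' S'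

/-- From the stacks `S`, the program `c` reaches the stacks `S'` within `B` jumps. -/
def Spec (c : Cmd) (S S' : Stacks) (B : ℕ) : Prop := ∀ v, SpecAt v c S S' B

/-- A number in unary. -/
abbrev unary (n : ℕ) : List Γ' := List.replicate n Γ'.blank

theorem unary_succ (n : ℕ) : unary (n + 1) = Γ'.blank :: unary n := rfl

theorem Spec.mono {c S S' B B'} (h : Spec c S S' B) (hB : B ≤ B') : Spec c S S' B' := fun v =>
  let ⟨v', t, ht, hr⟩ := h v
  ⟨v', t, ht.trans hB, hr⟩

theorem Spec.to {c S S' T B B'} (h : Spec c S S' B) (hT : S' = T) (hB : B ≤ B') :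
    Spec c S T B' := hT ▸ h.mono hB

theorem Spec.of {c S S' T B} (h : Spec c S S' B) (hT : S = T) : Spec c T S' B := hT ▸ h

theorem Spec.seq {c d S S' S'' B B'} (h : Spec c S S' B) (h' : Spec d S' S'' B') :
    Spec (seq c d) S S'' (B + B') := fun v =>
  let ⟨v', _, ht, hr⟩ := h v
  let ⟨v'', _, ht', hr'⟩ := h' v'
  ⟨v'', _, Nat.add_le_add ht ht', hr.seq hr'⟩

theorem spec_skip (S) : Spec skip S S 0 := fun v => ⟨v, 0, le_rfl, .skip v S⟩

theorem spec_push (k a S) : Spec (push k fun _ => a) S (update S k (a :: S k)) 0 := fun v =>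
  ⟨v, 0, le_rfl, .push k _ v S⟩

theorem spec_pop (k S) : Spec (pop k) S (update S k (S k).tail) 0 := fun v =>
  ⟨_, 0, le_rfl, .pop k v S⟩

/-- The invariant is a sequence of stack contents: `st i` describes the moment before round `i`, and
the body of that round starts after the top symbol of `k` was removed. -/
theorem spec_loop {k : ℕ} {c : Cmd} (B K : ℕ) (st : ℕ → Stacks)
    (h : ∀ i < K, ∃ a l, st i k = a :: l ∧ SpecAt (some a) c (update (st i) k l) (st (i + 1)) B)
    (hK : st K k = []) : Spec (loop k c) (st 0) (st K) (K * (B + 1) + 1) := by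
  induction K generalizing st with
  | zero => exact fun v => ⟨none, 1, by omega, .loop_nil hK⟩
  | succ K ih =>
    intro v
    obtain ⟨a, l, hl, v', t, ht, hr⟩ := h 0 (Nat.succ_pos K)
    obtain ⟨v'', t', ht', hr'⟩ := ih (fun i => st (i + 1))
      (fun i hi => h (i + 1) (Nat.succ_lt_succ hi)) hK v'
    refine ⟨v'', _, ?_, .loop_cons hl hr hr'⟩
    rw [Nat.succ_mul]
    omega

/-- Run `c` or `d` according to whether the stack `k` is nonempty. -/
def ifne (k : ℕ) (c d : Cmd) : Cmd := seq (peek k) (ite Option.isSome c d)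

theorem spec_ifne_pos {k c d S S' B} (hk : S k ≠ []) (h : Spec c S S' B) :
    Spec (ifne k c d) S S' B := fun v => by
  obtain ⟨v', t, ht, hr⟩ := h (S k).head?
  refine ⟨v', 0 + t, by omega, .seq (.peek k v S) (.ite_true ?_ hr)⟩
  cases hS : S k with
  | nil => exact absurd hS hk
  | cons a l => rfl

theorem spec_ifne_neg {k c d S S' B} (hk : S k = []) (h : Spec d S S' B) :
    Spec (ifne k c d) S S' B := fun v => by
  obtain ⟨v', t, ht, hr⟩ := h (S k).head?
  refine ⟨v', 0 + t, by omega, .seq (.peek k v S) (.ite_false ?_ hr)⟩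
  rw [hk]
  rfl

/-- Empty the stack `k`. -/
def clear (k : ℕ) : Cmd := loop k skip

theorem spec_clear (k S) : Spec (clear k) S (update S k []) ((S k).length + 1) := by
  have h := spec_loop (k := k) (c := skip) 0 (S k).length
    (fun i => update S k ((S k).drop i)) (fun i hi => ?_) (by simp)
  · unfold clear
    simpa using h
  · refine ⟨(S k)[i], (S k).drop (i + 1), by simp, ?_⟩
    rw [Function.update_idem]
    exact spec_skip _ _

/-- Move the content of stack `k` to stack `d`, which reverses the order. -/
def move (k d : ℕ) : Cmd := loop k (push d fun s => s.getD Γ'.blank)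

theorem spec_move {k d : ℕ} (hkd : k ≠ d) (S) :
    Spec (move k d) S (update (update S d ((S k).reverse ++ S d)) k []) ((S k).length + 1) := by
  have h := spec_loop (k := k) (c := push d fun s => s.getD Γ'.blank) 0 (S k).length
    (fun i => update (update S d (((S k).take i).reverse ++ S d)) k ((S k).drop i))
    (fun i hi => ?_) (by simp)
  · unfold move
    simpa using h
  · refine ⟨(S k)[i], (S k).drop (i + 1), by simp, some (S k)[i], 0, le_rfl, ?_⟩
    have e : ((S k).take (i + 1)).reverse ++ S d = (S k)[i] :: (((S k).take i).reverse ++ S d) := by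
      rw [List.take_succ_eq_append_getElem hi, List.reverse_append]
      rfl
    rw [e]
    convert Runs.push d _ _ _ using 1
    rw [Function.update_idem, Function.update_of_ne hkd.symm, Function.update_self,
      Function.update_comm hkd, Function.update_idem]
    rfl

/-- Add the unary number on stack `k` to stack `d`, where stack `2` is auxiliary. -/
def copy (k d : ℕ) : Cmd :=
  seq (loop k (seq (push 2 fun _ => Γ'.blank) (push d fun _ => Γ'.blank))) (move 2 k)

/-- The loop empties `k` while writing two copies; the one on stack `2` is moved back to `k`. All
symbols are blanks, so the reversal by `move` is harmless. -/
theorem spec_copy {k d n : ℕ} (hkd : k ≠ d) (hk : k ≠ 2) (hd : d ≠ 2) {S : Stacks}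
    (h2 : S 2 = []) (hn : S k = unary n) :
    Spec (copy k d) S (update S d (unary n ++ S d)) (2 * n + 2) := by
  have h := spec_loop (k := k)
    (c := seq (push 2 fun _ => Γ'.blank) (push d fun _ => Γ'.blank)) 0 n
    (fun i => update (update (update S d (unary i ++ S d)) 2 (unary i)) k (unary (n - i)))
    (fun i hi => ?_) (by simp)
  · have h' := h.seq (spec_move (k := 2) (d := k) hk.symm _)
    have e₁ : update (update (update S d (unary 0 ++ S d)) 2 (unary 0)) k (unary (n - 0)) = S := by
      funext r
      simp only [Function.update_apply, List.replicate_zero, List.nil_append, Nat.sub_zero]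
      split_ifs <;> first | omega | rfl | simp_all
    simp only [e₁] at h'
    unfold copy
    convert h'.mono (B' := 2 * n + 2) ?_ using 1
    · funext r
      simp only [Function.update_apply, Nat.sub_self, List.replicate_zero]
      split_ifs <;> first | omega | rfl | simp_all
    · rw [Function.update_of_ne hk.symm, Function.update_self, List.length_replicate]
      omega
  · refine ⟨Γ'.blank, unary (n - (i + 1)), ?_, ?_⟩
    · have : n - i = n - (i + 1) + 1 := by omega
      rw [Function.update_self, this, unary_succ]
    · have h' := (spec_push 2 Γ'.blank (update (update (update (update S d (unary i ++ S d)) 2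
        (unary i)) k (unary (n - i))) k (unary (n - (i + 1))))).seq (spec_push d Γ'.blank _)
      convert h' _ using 1
      funext r
      simp only [Function.update_apply]
      split_ifs <;> first | omega | rfl

/-- Put `n` blanks on stack `k`. -/
def pushN (k : ℕ) : ℕ → Cmd
  | 0 => skip
  | n + 1 => seq (push k fun _ => Γ'.blank) (pushN k n)

theorem spec_pushN (k n S) : Spec (pushN k n) S (update S k (unary n ++ S k)) 0 := by
  induction n generalizing S with
  | zero => simpa [pushN] using spec_skip S
  | succ n ih =>
    have h := (spec_push k Γ'.blank S).seq (ih _)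
    rw [Function.update_idem, Function.update_self] at h
    unfold pushN
    convert h using 2
    rw [unary, List.replicate_succ', List.append_assoc]
    rfl

end Cmd

/-- Extension of an environment by the value of a new first variable. -/
def cons (a : ℕ) (ρ : ℕ → ℕ) : ℕ → ℕ
  | 0 => a
  | i + 1 => ρ i

@[simp] theorem cons_zero (a : ℕ) (ρ : ℕ → ℕ) : cons a ρ 0 = a := rfl
@[simp] theorem cons_succ (a : ℕ) (ρ : ℕ → ℕ) (i : ℕ) : cons a ρ (i + 1) = ρ i := rfl

/-! ### Arithmetic expressions over a string -/

/-- Expressions for numbers depending on a string `w`. The variables are de Bruijn-indices, and the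
bound ones range over the positions of `w`. -/
inductive Arith
  | var (i : ℕ)
  | const (c : ℕ)
  | add (a b : Arith)
  | sub (a b : Arith)
  | sym (s : Γ') (p : Arith)
  | ite (c a b : Arith)
  | cnt (a : Arith)
  | rec2 (t : Arith) (i j : ℕ) (f : Arith)

namespace Arith

/-- The value of an expression: `sym s p` tests whether `s` is the symbol at position `p`, `cnt a`
counts the positions where `a` is nonzero, and `rec2 t i j f` is the member with number `t` of the
sequence that starts with the variables `i` and `j`, and where every further member is given by
`cnt f` in terms of the previous one and the one before. -/
def val (w : List Γ') : Arith → (ℕ → ℕ) → ℕ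
  | var i, ρ => ρ i
  | const c, _ => c
  | add a b, ρ => val w a ρ + val w b ρ
  | sub a b, ρ => val w a ρ - val w b ρ
  | sym s p, ρ => if w[val w p ρ]? = some s then 1 else 0
  | ite c a b, ρ => if val w c ρ ≠ 0 then val w a ρ else val w b ρ
  | cnt a, ρ => Nat.count (fun y => val w a (cons y ρ) ≠ 0) w.length
  | rec2 t i j f, ρ =>
      ((fun q : ℕ × ℕ => (q.2, Nat.count (fun y => val w f (cons y (cons q.2 (cons q.1 ρ))) ≠ 0)
        w.length))^[val w t ρ] (ρ i, ρ j)).1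

/-- The program of a counter, given the program `c` of the condition. -/
def cntCmd (c : Cmd) (l : ℕ) : Cmd :=
  .seq (.copy 3 (l + 1)) (.seq (.loop (l + 1) (.seq c (.seq
    (.ifne (l + 3) (.seq (.clear (l + 3)) (.push l fun _ => Γ'.blank)) .skip)
    (.push (l + 2) fun _ => Γ'.blank)))) (.clear (l + 2)))

/-- The program of an expression, where `env` tells the stacks of the variables, and where the
result is put on stack `l`. -/
def cmd : Arith → (ℕ → ℕ) → ℕ → Cmd
  | var i, env, l => .copy (env i) l
  | const c, _, l => .pushN l c
  | add a b, env, l => .seq (cmd a env l) (.seq (cmd b env (l + 1)) (.move (l + 1) l))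
  | sub a b, env, l => .seq (cmd a env l) (.seq (cmd b env (l + 1)) (.loop (l + 1) (.pop l)))
  | sym s p, env, l => .seq (cmd p env l) (.seq
      (.loop l (.seq (.pop 0) (.ite Option.isSome (.push 2 fun s => s.getD Γ'.blank) .skip)))
      (.seq (.seq (.peek 0) (.ite (fun o => decide (o = some s)) (.push l fun _ => Γ'.blank) .skip))
        (.move 2 0)))
  | ite c a b, env, l => .seq (cmd c env l) (.ifne l (.seq (.clear l) (cmd a env l)) (cmd b env l))
  | cnt a, env, l => cntCmd (cmd a (cons (l + 2) env) (l + 3)) l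
  | rec2 t i j f, env, l => .seq (cmd t env (l + 2)) (.seq (.copy (env i) l) (.seq
      (.copy (env j) (l + 1)) (.seq (.loop (l + 2) (.seq
        (cntCmd (cmd f (cons (l + 5) (cons (l + 1) (cons l env))) (l + 6)) (l + 3))
        (.seq (.clear l) (.seq (.move (l + 1) l) (.move (l + 3) (l + 1)))))) (.clear (l + 1)))))

/-- A bound for the values, in terms of the length of the string. -/
def bd : Arith → ℕ → ℕ
  | var _, N => N
  | const c, _ => c
  | add a b, N => bd a N + bd b N
  | sub a _, N => bd a N
  | sym _ _, _ => 1
  | ite _ a b, N => bd a N + bd b N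
  | cnt _, N => N
  | rec2 _ _ _ _, N => N

/-- The time of a counter. -/
def cntTime (T V N : ℕ) : ℕ := (2 * N + 2) + ((N * ((T + ((V + 1) + 0)) + 1) + 1) + (N + 1))

/-- A bound for the number of jumps, in terms of the length of the string. -/
def time : Arith → ℕ → ℕ
  | var _, N => 2 * N + 2
  | const _, _ => 0
  | add a b, N => time a N + (time b N + (bd b N + 1))
  | sub a b, N => time a N + (time b N + (bd b N * (0 + 1) + 1))
  | sym _ p, N => time p N + ((bd p N * (0 + 1) + 1) + (0 + (N + 1)))
  | ite c a b, N => time c N + ((bd c N + 1) + time a N + time b N)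
  | cnt a, N => cntTime (time a N) (bd a N) N
  | rec2 t _ _ f, N => time t N + ((2 * N + 2) + ((2 * N + 2) + ((bd t N *
      ((cntTime (time f N) (bd f N) N + ((N + 1) + ((N + 1) + (N + 1)))) + 1) + 1) + (N + 1))))

open Polynomial in
theorem exists_poly_bd (a : Arith) : ∃ p : ℕ[X], ∀ N, p.eval N = a.bd N := by
  induction a with
  | var i => exact ⟨X, by simp [bd]⟩
  | const c => exact ⟨C c, by simp [bd]⟩
  | add a b iha ihb => exact ⟨iha.choose + ihb.choose, by
      simp [bd, iha.choose_spec, ihb.choose_spec]⟩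
  | sub a b iha _ => exact ⟨iha.choose, by simp [bd, iha.choose_spec]⟩
  | sym s p _ => exact ⟨1, by simp [bd]⟩
  | ite c a b _ iha ihb => exact ⟨iha.choose + ihb.choose, by
      simp [bd, iha.choose_spec, ihb.choose_spec]⟩
  | cnt a _ => exact ⟨X, by simp [bd]⟩
  | rec2 t i j f _ _ => exact ⟨X, by simp [bd]⟩

open Polynomial in
theorem exists_poly_time (a : Arith) : ∃ p : ℕ[X], ∀ N, p.eval N = a.time N := by
  induction a with
  | var i => exact ⟨2 * X + 2, by simp [time]⟩
  | const c => exact ⟨0, by simp [time]⟩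
  | add a b iha ihb =>
    obtain ⟨p, hp⟩ := iha
    obtain ⟨q, hq⟩ := ihb
    obtain ⟨r, hr⟩ := b.exists_poly_bd
    exact ⟨p + (q + (r + 1)), by simp [time, hp, hq, hr]⟩
  | sub a b iha ihb =>
    obtain ⟨p, hp⟩ := iha
    obtain ⟨q, hq⟩ := ihb
    obtain ⟨r, hr⟩ := b.exists_poly_bd
    exact ⟨p + (q + (r * (0 + 1) + 1)), by simp [time, hp, hq, hr]⟩
  | sym s a ih =>
    obtain ⟨p, hp⟩ := ih
    obtain ⟨r, hr⟩ := a.exists_poly_bd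
    exact ⟨p + ((r * (0 + 1) + 1) + (0 + (X + 1))), by simp [time, hp, hr]⟩
  | ite c a b ihc iha ihb =>
    obtain ⟨p, hp⟩ := ihc
    obtain ⟨q, hq⟩ := iha
    obtain ⟨r, hr⟩ := ihb
    obtain ⟨s, hs⟩ := c.exists_poly_bd
    exact ⟨p + ((s + 1) + q + r), by simp [time, hp, hq, hr, hs]⟩
  | cnt a ih =>
    obtain ⟨p, hp⟩ := ih
    obtain ⟨r, hr⟩ := a.exists_poly_bd
    exact ⟨(2 * X + 2) + ((X * ((p + ((r + 1) + 0)) + 1) + 1) + (X + 1)), by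
      simp [time, cntTime, hp, hr]⟩
  | rec2 t i j f iht ihf =>
    obtain ⟨p, hp⟩ := iht
    obtain ⟨q, hq⟩ := ihf
    obtain ⟨r, hr⟩ := t.exists_poly_bd
    obtain ⟨s, hs⟩ := f.exists_poly_bd
    exact ⟨p + ((2 * X + 2) + ((2 * X + 2) + ((r * ((((2 * X + 2) + ((X * ((q + ((s + 1) + 0)) + 1)
      + 1) + (X + 1))) + ((X + 1) + ((X + 1) + (X + 1)))) + 1) + 1) + (X + 1)))), by
      simp [time, cntTime, hp, hq, hr, hs]⟩

/-- The stacks in which expressions are evaluated: `0` holds the string, `3` its length, `2` is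
auxiliary, the variables are on the stacks given by `env`, and the stacks from `l` on are free. -/
structure Ok (w : List Γ') (ρ env : ℕ → ℕ) (l : ℕ) (S : Stacks) : Prop where
  input : S 0 = w
  aux : S 2 = []
  len : S 3 = Cmd.unary w.length
  lvl : 6 ≤ l
  free : ∀ r, l ≤ r → S r = []
  env : ∀ i, 5 ≤ env i ∧ env i < l ∧ S (env i) = Cmd.unary (ρ i) ∧ ρ i ≤ w.length

/-- Stack `4` is exempt because printers collect their output there between evaluations. -/
theorem Ok.extend {w ρ env l l' S S'} (h : Ok w ρ env l S) (hl : l ≤ l')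
    (hS : ∀ r < l, r ≠ 4 → S' r = S r) (hf : ∀ r, l' ≤ r → S' r = []) : Ok w ρ env l' S' := by
  have := h.lvl
  refine ⟨by rw [hS 0 (by omega) (by omega), h.input], by rw [hS 2 (by omega) (by omega), h.aux],
    by rw [hS 3 (by omega) (by omega), h.len], by omega, hf, fun i => ?_⟩
  obtain ⟨h1, h2, h3, h4⟩ := h.env i
  exact ⟨h1, by omega, by rw [hS _ h2 (by omega), h3], h4⟩

theorem Ok.cons {w ρ env l S r k} (h : Ok w ρ env l S) (hr : 5 ≤ r) (hrl : r < l)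
    (hS : S r = Cmd.unary k) (hk : k ≤ w.length) : Ok w (cons k ρ) (cons r env) l S :=
  ⟨h.input, h.aux, h.len, h.lvl, h.free, fun i => by
    cases i with
    | zero => exact ⟨hr, hrl, hS, hk⟩
    | succ i => exact h.env i⟩

/-- This makes unary arithmetic affordable. A member of a `rec2` sequence is either one of the two
initial variables or a counter, so it never exceeds the length, however long the recursion. -/
theorem val_le_bd {w : List Γ'} (a : Arith) {ρ : ℕ → ℕ} (hρ : ∀ i, ρ i ≤ w.length) :
    a.val w ρ ≤ a.bd w.length := by
  have hcount : ∀ (p : ℕ → Prop) [DecidablePred p] (n : ℕ), Nat.count p n ≤ n :=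
    fun p _ n => Nat.count_le p
  induction a with
  | var i => exact hρ i
  | const c => exact le_rfl
  | add a b iha ihb => exact Nat.add_le_add iha ihb
  | sub a b iha _ => exact (Nat.sub_le _ _).trans iha
  | sym s p _ => simp only [val, bd]; split_ifs <;> omega
  | ite c a b _ iha ihb => simp only [val, bd]; split_ifs <;> omega
  | cnt a _ => exact hcount _ _
  | rec2 t i j f _ _ =>
    simp only [val, bd]
    have key : ∀ k, ∀ q : ℕ × ℕ, q.1 ≤ w.length → q.2 ≤ w.length →
        ((fun q : ℕ × ℕ => (q.2, Nat.count (fun y => val w f (TwoMU.cons y (TwoMU.cons q.2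
          (TwoMU.cons q.1 ρ))) ≠ 0) w.length))^[k] q).1 ≤ w.length := by
      intro k
      induction k with
      | zero => exact fun q h _ => h
      | succ k ih =>
        intro q _ h2
        rw [Function.iterate_succ_apply]
        exact ih _ h2 (hcount _ _)
    exact key _ _ (hρ i) (hρ j)

/-- Invariant after `i` rounds: stack `l` holds the count over the positions below `i`, `l + 1` the
number of remaining rounds, and `l + 2` the value `i` of the bound variable. Stack `l + 3` receives
the value of the condition and is emptied again. -/
theorem cntCmd_spec {w : List Γ'} {ρ env : ℕ → ℕ} {l : ℕ} {S : Stacks} (h : Ok w ρ env l S)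
    (c : Cmd) (g : ℕ → ℕ) (T V : ℕ) (hg : ∀ y < w.length, g y ≤ V)
    (hc : ∀ y S', y < w.length → Ok w (TwoMU.cons y ρ) (TwoMU.cons (l + 2) env) (l + 3) S' →
      Cmd.Spec c S' (update S' (l + 3) (Cmd.unary (g y))) T) :
    Cmd.Spec (cntCmd c l) S (update S l (Cmd.unary (Nat.count (fun y => g y ≠ 0) w.length)))
      (cntTime T V w.length) := by
  have hl := h.lvl
  have hf := h.free
  set N := w.length with hN
  have h₁ := Cmd.spec_copy (k := 3) (d := l + 1) (n := N) (by omega) (by omega) (by omega) h.aux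
    h.len
  have h₂ := Cmd.spec_loop (k := l + 1) (c := .seq c (.seq
    (.ifne (l + 3) (.seq (.clear (l + 3)) (.push l fun _ => Γ'.blank)) .skip)
    (.push (l + 2) fun _ => Γ'.blank))) (T + ((V + 1) + 0)) N
    (fun i => update (update (update S l (Cmd.unary (Nat.count (fun y => g y ≠ 0) i))) (l + 1)
      (Cmd.unary (N - i))) (l + 2) (Cmd.unary i)) (fun i hi => ?_) (by simp)
  · refine (h₁.seq ((h₂.of ?_).seq (Cmd.spec_clear (l + 2) _))).to ?_ ?_
    · funext r
      simp only [Function.update_apply, Nat.count_zero, List.replicate_zero, Nat.sub_zero]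
      split_ifs <;> first | omega | rfl | simp_all
    · funext r
      simp only [Function.update_apply]
      split_ifs <;> first | omega | rfl | simp_all
    · simp [cntTime]
  · refine ⟨Γ'.blank, Cmd.unary (N - (i + 1)), ?_, ?_⟩
    · have : N - i = N - (i + 1) + 1 := by omega
      rw [Function.update_of_ne (by omega), Function.update_self, this, Cmd.unary_succ]
    · set S₁ := update (update (update (update S l (Cmd.unary (Nat.count (fun y => g y ≠ 0) i)))
        (l + 1) (Cmd.unary (N - i))) (l + 2) (Cmd.unary i)) (l + 1) (Cmd.unary (N - (i + 1)))
        with hS₁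
      have hOk : Ok w (TwoMU.cons i ρ) (TwoMU.cons (l + 2) env) (l + 3) S₁ := by
        refine (h.extend (by omega) (fun r hr _ => ?_) (fun r hr => ?_)).cons (by omega) (by omega)
          ?_ (by omega)
        · rw [hS₁]
          simp only [Function.update_apply]
          split_ifs <;> first | omega | rfl
        · rw [hS₁]
          simp only [Function.update_apply]
          split_ifs <;> first | omega | exact hf r (by omega)
        · rw [hS₁]
          simp
      have hV := hg i hi
      refine Cmd.Spec.seq (hc i S₁ hi hOk) (Cmd.Spec.seq (S' := update S₁ l
        (Cmd.unary (Nat.count (fun y => g y ≠ 0) (i + 1)))) ?_ ?_) _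
      · have := hf (l + 3) (by omega)
        by_cases h0 : g i = 0
        · refine Cmd.spec_ifne_neg (by simp [h0]) ((Cmd.spec_skip _).to ?_ (by omega))
          funext r
          simp only [hS₁, Function.update_apply, Nat.count_succ, h0]
          split_ifs <;> first | omega | rfl | simp_all
        · refine Cmd.spec_ifne_pos (by simpa using h0) (((Cmd.spec_clear (l + 3) _).seq
            (Cmd.spec_push l Γ'.blank _)).to ?_ (by simpa using hV))
          funext r
          have e : Nat.count (fun y => g y ≠ 0) (i + 1) = Nat.count (fun y => g y ≠ 0) i + 1 := by
            simp [Nat.count_succ, h0]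
          simp only [hS₁, Function.update_apply, e, Cmd.unary_succ]
          split_ifs <;> first | omega | rfl | simp_all
      · convert Cmd.spec_push (l + 2) Γ'.blank _ using 1
        funext r
        simp only [hS₁, Function.update_apply]
        split_ifs <;> first | omega | rfl

/-- An evaluation at level `l` finds the stacks from `l` on empty and finally changes only stack
`l`. Hence variables and intermediate results on lower stacks survive, and the induction is
compositional. -/
theorem cmd_spec {w : List Γ'} (a : Arith) : ∀ {ρ env : ℕ → ℕ} {l : ℕ} {S : Stacks},
    Ok w ρ env l S →
      Cmd.Spec (a.cmd env l) S (update S l (Cmd.unary (a.val w ρ))) (a.time w.length) := by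
  induction a with
  | var i =>
    intro ρ env l S h
    obtain ⟨h5, hl, hS, hle⟩ := h.env i
    have := h.lvl
    have h' := Cmd.spec_copy (k := env i) (d := l) (by omega) (by omega) (by omega) h.aux hS
    rw [h.free l le_rfl, List.append_nil] at h'
    exact h'.mono (by simp only [time]; omega)
  | const c =>
    intro ρ env l S h
    have h' := Cmd.spec_pushN l c S
    rw [h.free l le_rfl, List.append_nil] at h'
    exact h'
  | add a b iha ihb =>
    intro ρ env l S h
    have hl := h.lvl
    have hf := h.free
    have hok : Ok w ρ env (l + 1) (update S l (Cmd.unary (a.val w ρ))) :=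
      h.extend (by omega) (fun r hr _ => Function.update_of_ne (by omega) _ _)
        (fun r hr => by rw [Function.update_of_ne (by omega)]; exact hf r (by omega))
    refine ((iha h).seq ((ihb hok).seq
      (Cmd.spec_move (k := l + 1) (d := l) (by omega) _))).to ?_ ?_
    · funext r
      have := hf (l + 1) (by omega)
      simp only [Function.update_apply, val, Nat.add_comm (a.val w ρ)]
      split_ifs <;> first | omega | rfl | simp_all
    · have := val_le_bd b (ρ := ρ) (w := w) (fun i => (h.env i).2.2.2)
      simp only [time, Function.update_self, List.length_replicate]
      omega
  | sub a b iha ihb =>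
    intro ρ env l S h
    have hl := h.lvl
    have hf := h.free
    have hok : Ok w ρ env (l + 1) (update S l (Cmd.unary (a.val w ρ))) :=
      h.extend (by omega) (fun r hr _ => Function.update_of_ne (by omega) _ _)
        (fun r hr => by rw [Function.update_of_ne (by omega)]; exact hf r (by omega))
    have h₁ := Cmd.spec_loop (k := l + 1) (c := .pop l) 0 (b.val w ρ)
      (fun i => update (update S l (Cmd.unary (a.val w ρ - i))) (l + 1)
        (Cmd.unary (b.val w ρ - i))) (fun i hi => ?_) (by simp)
    · have := val_le_bd b (ρ := ρ) (w := w) (fun i => (h.env i).2.2.2)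
      refine ((iha h).seq ((ihb hok).seq h₁)).to ?_ ?_
      · funext r
        have := hf (l + 1) (by omega)
        simp only [Function.update_apply, val]
        split_ifs <;> first | omega | rfl | simp_all
      · simp only [time]
        omega
    · refine ⟨Γ'.blank, Cmd.unary (b.val w ρ - (i + 1)), ?_, ?_⟩
      · have : b.val w ρ - i = b.val w ρ - (i + 1) + 1 := by omega
        rw [Function.update_self, this, Cmd.unary_succ]
      · convert Cmd.spec_pop l _ _ using 1
        funext r
        simp only [Function.update_apply]
        split_ifs <;> first | omega | rfl | simp_all [Nat.sub_sub]
  | sym s p ih =>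
    intro ρ env l S h
    have hl := h.lvl
    have hf := h.free
    have hin := h.input
    have haux := h.aux
    set k := p.val w ρ with hk
    have h₁ := Cmd.spec_loop (k := l)
      (c := .seq (.pop 0) (.ite Option.isSome (.push 2 fun s => s.getD Γ'.blank) .skip)) 0 k
      (fun i => update (update (update S 0 (w.drop i)) 2 (w.take i).reverse) l
        (Cmd.unary (k - i))) (fun i hi => ?_) (by simp)
    · have h₂ : Cmd.Spec (.seq (.peek 0)
          (.ite (fun o => decide (o = some s)) (.push l fun _ => Γ'.blank) .skip))
          (update (update (update S 0 (w.drop k)) 2 (w.take k).reverse) l (Cmd.unary (k - k)))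
          (update (update (update S 0 (w.drop k)) 2 (w.take k).reverse) l
            (Cmd.unary ((sym s p).val w ρ))) 0 := by
        intro v
        have hhead : (update (update (update S 0 (w.drop k)) 2 (w.take k).reverse) l
            (Cmd.unary (k - k)) 0).head? = w[k]? := by
          rw [Function.update_of_ne (by omega), Function.update_of_ne (by omega),
            Function.update_self, List.head?_drop]
        by_cases hs : w[k]? = some s
        · refine ⟨w[k]?, 0 + 0, le_rfl, .seq (S' := update (update (update S 0 (w.drop k)) 2
            (w.take k).reverse) l (Cmd.unary (k - k))) ?_ (.ite_true (by simpa using hs) ?_)⟩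
          · rw [← hhead]
            exact .peek _ _ _
          · convert Cmd.Runs.push l _ _ _ using 1
            simp [val, ← hk, hs]
        · refine ⟨w[k]?, 0 + 0, le_rfl, .seq (S' := update (update (update S 0 (w.drop k)) 2
            (w.take k).reverse) l (Cmd.unary (k - k))) ?_ (.ite_false (by simpa using hs) ?_)⟩
          · rw [← hhead]
            exact .peek _ _ _
          · convert Cmd.Runs.skip _ _ using 1
            simp [val, ← hk, hs]
      have := val_le_bd p (ρ := ρ) (w := w) (fun i => (h.env i).2.2.2)
      refine ((ih h).seq ((h₁.of ?_).seq (h₂.seq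
        (Cmd.spec_move (k := 2) (d := 0) (by omega) _)))).to ?_ ?_
      · funext r
        simp only [Function.update_apply, List.drop_zero, List.take_zero, Nat.sub_zero]
        split_ifs <;> first | omega | rfl | simp_all
      · funext r
        simp only [Function.update_apply]
        split_ifs <;> first | omega | rfl | simp_all
      · simp only [time]
        rw [Function.update_of_ne (by omega), Function.update_self, List.length_reverse,
          List.length_take]
        omega
    · refine ⟨Γ'.blank, Cmd.unary (k - (i + 1)), ?_, ?_⟩
      · have : k - i = k - (i + 1) + 1 := by omega
        rw [Function.update_self, this, Cmd.unary_succ]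
      · set S₁ := update (update (update (update S 0 (w.drop i)) 2 (w.take i).reverse) l
          (Cmd.unary (k - i))) l (Cmd.unary (k - (i + 1))) with hS₁
        have h0 : S₁ 0 = w.drop i := by
          rw [hS₁, Function.update_of_ne (by omega), Function.update_of_ne (by omega),
            Function.update_of_ne (by omega), Function.update_self]
        -- Beyond the end of the string the pop yields `none` and nothing is transferred, in
        -- accordance with `take` and `drop`.
        by_cases hiw : i < w.length
        · refine ⟨some w[i], 0 + 0, le_rfl, .seq (.pop 0 _ _) (.ite_true ?_ ?_)⟩
          · simp [h0, hiw]
          · have : (S₁ 0).head? = some w[i] := by simp [h0, hiw]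
            rw [this]
            convert Cmd.Runs.push 2 _ _ _ using 1
            funext r
            have e := List.take_succ_eq_append_getElem hiw
            simp only [hS₁, Function.update_apply, e]
            split_ifs <;> first | omega | rfl | simp_all
        · refine ⟨none, 0 + 0, le_rfl, .seq (.pop 0 _ _) (.ite_false ?_ ?_)⟩
          · simp [h0, List.drop_eq_nil_of_le (not_lt.1 hiw)]
          · have : (S₁ 0).head? = none := by simp [h0, List.drop_eq_nil_of_le (not_lt.1 hiw)]
            rw [this]
            convert Cmd.Runs.skip _ _ using 1
            funext r
            have e₁ := List.drop_eq_nil_of_le (not_lt.1 hiw)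
            have e₂ := List.drop_eq_nil_of_le (show w.length ≤ i + 1 by omega)
            have e₃ := List.take_of_length_le (not_lt.1 hiw)
            have e₄ := List.take_of_length_le (show w.length ≤ i + 1 by omega)
            simp only [hS₁, Function.update_apply]
            split_ifs <;> first | omega | rfl | simp_all
  | ite c a b ihc iha ihb =>
    intro ρ env l S h
    have hf := h.free
    have hv := val_le_bd c (ρ := ρ) (w := w) (fun i => (h.env i).2.2.2)
    unfold cmd
    have e : update (update S l (Cmd.unary (c.val w ρ))) l [] = S := by
      rw [Function.update_idem, ← hf l le_rfl, Function.update_eq_self]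
    by_cases h0 : c.val w ρ = 0
    · have h' := (ihc h).seq (Cmd.spec_ifne_neg (k := l) (c := .seq (.clear l) (cmd a env l))
        (d := cmd b env l) (by simp [h0]) (S' := update S l (Cmd.unary (b.val w ρ)))
        (B := b.time w.length) (by
          rw [h0]
          have e' : update S l (Cmd.unary 0) = S := by
            rw [Cmd.unary, List.replicate_zero, ← hf l le_rfl, Function.update_eq_self]
          rw [e']
          exact ihb h))
      have hval : (ite c a b).val w ρ = b.val w ρ := by simp [val, h0]
      rw [hval]
      exact h'.mono (by simp only [time]; omega)
    · have h' := (ihc h).seq (Cmd.spec_ifne_pos (k := l) (c := .seq (.clear l) (cmd a env l))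
        (d := cmd b env l) (by simp [h0]) (S' := update S l (Cmd.unary (a.val w ρ)))
        (Cmd.Spec.seq (Cmd.spec_clear l _) (by rw [e]; exact iha h)))
      have hval : (ite c a b).val w ρ = a.val w ρ := by simp [val, h0]
      rw [hval]
      refine h'.mono ?_
      rw [Function.update_self, List.length_replicate]
      simp only [time]
      omega
  | cnt a ih =>
    intro ρ env l S h
    exact cntCmd_spec h _ (fun y => a.val w (TwoMU.cons y ρ)) _ _
      (fun y hy => val_le_bd a fun i => by
        cases i with
        | zero => exact hy.le
        | succ i => exact (h.env i).2.2.2)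
      (fun y S' _ hS' => ih hS')
  | rec2 t i j f iht ihf =>
    intro ρ env l S h
    have hl := h.lvl
    have hf := h.free
    obtain ⟨hi5, hil, hSi, hiN⟩ := h.env i
    obtain ⟨hj5, hjl, hSj, hjN⟩ := h.env j
    set N := w.length with hN
    set F := fun q : ℕ × ℕ => (q.2, Nat.count (fun y => val w f (TwoMU.cons y (TwoMU.cons q.2
      (TwoMU.cons q.1 ρ))) ≠ 0) N) with hF
    -- `Q k` consists of the members with numbers `k` and `k + 1`.
    set Q := fun k => F^[k] (ρ i, ρ j) with hQ
    have hQs : ∀ k, Q (k + 1) = F (Q k) := fun k => Function.iterate_succ_apply' _ _ _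
    have hQN : ∀ k, (Q k).1 ≤ N ∧ (Q k).2 ≤ N := by
      intro k
      induction k with
      | zero => exact ⟨hiN, hjN⟩
      | succ k ih =>
        rw [hQs]
        exact ⟨ih.2, Nat.count_le _⟩
    set m := t.val w ρ with hm
    have hmb : m ≤ t.bd N := val_le_bd t (fun i => (h.env i).2.2.2)
    have h₁ : Cmd.Spec (cmd t env (l + 2)) S (update S (l + 2) (Cmd.unary m)) (t.time N) :=
      iht (h.extend (by omega) (fun r _ _ => rfl) (fun r hr => hf r (by omega)))
    have h₂ := Cmd.spec_copy (k := env i) (d := l) (n := ρ i)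
      (S := update S (l + 2) (Cmd.unary m)) (by omega) (by omega) (by omega)
      (by rw [Function.update_of_ne (by omega), h.aux])
      (by rw [Function.update_of_ne (by omega), hSi])
    have h₃ := Cmd.spec_copy (k := env j) (d := l + 1) (n := ρ j)
      (S := update (update S (l + 2) (Cmd.unary m)) l (Cmd.unary (ρ i)))
      (by omega) (by omega) (by omega)
      (by rw [Function.update_of_ne (by omega), Function.update_of_ne (by omega), h.aux])
      (by rw [Function.update_of_ne (by omega), Function.update_of_ne (by omega), hSj])
    -- The stacks `l` and `l + 1` hold the last two members, and `l + 2` the number of remaining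
    -- rounds. The counter works at level `l + 3`, so its bound variable is on stack `l + 5`.
    have h₄ := Cmd.spec_loop (k := l + 2) (c := .seq
        (cntCmd (cmd f (TwoMU.cons (l + 5) (TwoMU.cons (l + 1) (TwoMU.cons l env))) (l + 6)) (l + 3))
        (.seq (.clear l) (.seq (.move (l + 1) l) (.move (l + 3) (l + 1)))))
      (cntTime (time f N) (bd f N) N + ((N + 1) + ((N + 1) + (N + 1)))) m
      (fun k => update (update (update S l (Cmd.unary (Q k).1)) (l + 1) (Cmd.unary (Q k).2)) (l + 2)
        (Cmd.unary (m - k))) (fun k hk => ?_) (by simp)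
    · refine (h₁.seq ((h₂.to (T := update (update S (l + 2) (Cmd.unary m)) l (Cmd.unary (ρ i))) ?_
        le_rfl).seq (h₃.seq ((h₄.of ?_).seq (Cmd.spec_clear (l + 1) _))))).to ?_ ?_
      · rw [Function.update_of_ne (by omega), hf l le_rfl, List.append_nil]
      · have := hf (l + 1) (by omega)
        funext r
        simp only [Function.update_apply, hQ, Function.iterate_zero, id, Nat.sub_zero]
        split_ifs <;> first | omega | rfl | simp_all
      · have := hf (l + 1) (by omega)
        have := hf (l + 2) (by omega)
        have e : (rec2 t i j f).val w ρ = (Q m).1 := rfl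
        funext r
        simp only [Function.update_apply, e, Nat.sub_self]
        split_ifs <;> first | omega | rfl | simp_all
      · have := (hQN m).2
        have hb := Nat.mul_le_mul_right
          (cntTime (time f N) (bd f N) N + ((N + 1) + ((N + 1) + (N + 1))) + 1) hmb
        rw [Function.update_of_ne (by omega), Function.update_self, List.length_replicate]
        simp only [time]
        omega
    · refine ⟨Γ'.blank, Cmd.unary (m - (k + 1)), ?_, ?_⟩
      · have : m - k = m - (k + 1) + 1 := by omega
        rw [Function.update_self, this, Cmd.unary_succ]
      · rw [Function.update_idem]
        set S₁ := update (update (update S l (Cmd.unary (Q k).1)) (l + 1) (Cmd.unary (Q k).2)) (l + 2)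
          (Cmd.unary (m - (k + 1))) with hS₁
        obtain ⟨hq₁, hq₂⟩ := hQN k
        have hok : Ok w (TwoMU.cons (Q k).2 (TwoMU.cons (Q k).1 ρ))
            (TwoMU.cons (l + 1) (TwoMU.cons l env)) (l + 3) S₁ := by
          refine ((h.extend (by omega) (fun r hr _ => ?_) (fun r hr => ?_)).cons (k := (Q k).1)
            (by omega) (by omega) ?_ hq₁).cons (by omega) (by omega) ?_ hq₂
          · rw [hS₁, Function.update_of_ne (by omega), Function.update_of_ne (by omega),
              Function.update_of_ne (by omega)]
          · rw [hS₁, Function.update_of_ne (by omega), Function.update_of_ne (by omega),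
              Function.update_of_ne (by omega), hf r (by omega)]
          · rw [hS₁, Function.update_of_ne (by omega), Function.update_of_ne (by omega),
              Function.update_self]
          · rw [hS₁, Function.update_of_ne (by omega), Function.update_self]
        have hc := cntCmd_spec hok (cmd f (TwoMU.cons (l + 5) (TwoMU.cons (l + 1)
          (TwoMU.cons l env))) (l + 6))
          (fun y => f.val w (TwoMU.cons y (TwoMU.cons (Q k).2 (TwoMU.cons (Q k).1 ρ)))) _ _
          (fun y hy => val_le_bd f fun i => by
            rcases i with _ | _ | _ | i
            · exact hy.le
            · exact hq₂
            · exact hq₁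
            · exact (h.env i).2.2.2)
          (fun y S' _ hS' => ihf hS')
        have e : (Q (k + 1)).2 = Nat.count (fun y => f.val w (TwoMU.cons y (TwoMU.cons (Q k).2
          (TwoMU.cons (Q k).1 ρ))) ≠ 0) N := by rw [hQs]
        have e' : (Q (k + 1)).1 = (Q k).2 := by rw [hQs]
        rw [← e] at hc
        have hf₃ := hf (l + 3) (by omega)
        refine ((hc.seq ((Cmd.spec_clear l _).seq ((Cmd.spec_move (k := l + 1) (d := l) (by omega)
          _).seq (Cmd.spec_move (k := l + 3) (d := l + 1) (by omega) _)))).to ?_ ?_) _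
        · funext r
          simp only [Function.update_apply, hS₁, e']
          split_ifs <;> first | omega | rfl | simp_all
        · have := (hQN (k + 1)).2
          simp only [Function.update_apply, hS₁]
          simp
          rw [e] at this
          rw [← hN]
          omega

end Arith
end TwoMU

namespace TwoMU
open Computability (Γ')
open Function (update)

/-! ### Output programs -/

/-- Programs that output a string. The loop `each o` runs `o` for every position of the input. -/
inductive Printer
  | nil
  | emit (s : Γ')
  | seq (o o' : Printer)
  | ite (c : Arith) (o o' : Printer)
  | each (o : Printer)

namespace Printer

/-- The output of a program. -/
def out (w : List Γ') : Printer → (ℕ → ℕ) → List Γ'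
  | nil, _ => []
  | emit s, _ => [s]
  | seq o o', ρ => out w o ρ ++ out w o' ρ
  | ite c o o', ρ => if c.val w ρ ≠ 0 then out w o ρ else out w o' ρ
  | each o, ρ => (List.range w.length).flatMap fun y => out w o (cons y ρ)

/-- The stack program of a printer; the output appears in reverse order on stack `4`. -/
def cmd : Printer → (ℕ → ℕ) → ℕ → Cmd
  | nil, _, _ => .skip
  | emit s, _, _ => .push 4 fun _ => s
  | seq o o', env, l => .seq (cmd o env l) (cmd o' env l)
  | ite c o o', env, l => .seq (c.cmd env l)
      (.ifne l (.seq (.clear l) (cmd o env l)) (cmd o' env l))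
  | each o, env, l => .seq (.copy 3 l) (.seq (.loop l (.seq (cmd o (cons (l + 1) env) (l + 2))
      (.push (l + 1) fun _ => Γ'.blank))) (.clear (l + 1)))

/-- A bound for the number of jumps. -/
def time : Printer → ℕ → ℕ
  | nil, _ => 0
  | emit _, _ => 0
  | seq o o', N => time o N + time o' N
  | ite c o o', N => c.time N + ((c.bd N + 1) + time o N + time o' N)
  | each o, N => (2 * N + 2) + ((N * ((time o N + 0) + 1) + 1) + (N + 1))

/-- A bound for the length of the output. -/
def size : Printer → ℕ → ℕ
  | nil, _ => 0
  | emit _, _ => 1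
  | seq o o', N => size o N + size o' N
  | ite _ o o', N => size o N + size o' N
  | each o, N => N * size o N

open Polynomial in
theorem exists_poly (o : Printer) :
    ∃ p q : ℕ[X], ∀ N, p.eval N = o.time N ∧ q.eval N = o.size N := by
  induction o with
  | nil => exact ⟨0, 0, by simp [time, size]⟩
  | emit s => exact ⟨0, 1, by simp [time, size]⟩
  | seq o o' ih ih' =>
    obtain ⟨p, q, h⟩ := ih
    obtain ⟨p', q', h'⟩ := ih'
    exact ⟨p + p', q + q', by simp [time, size, h, h']⟩
  | ite c o o' ih ih' =>
    obtain ⟨p, q, h⟩ := ih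
    obtain ⟨p', q', h'⟩ := ih'
    obtain ⟨r, hr⟩ := c.exists_poly_time
    obtain ⟨s, hs⟩ := c.exists_poly_bd
    exact ⟨r + ((s + 1) + p + p'), q + q', by simp [time, size, h, h', hr, hs]⟩
  | each o ih =>
    obtain ⟨p, q, h⟩ := ih
    exact ⟨(2 * X + 2) + ((X * ((p + 0) + 1) + 1) + (X + 1)), X * q, by simp [time, size, h]⟩

/-- The size bound pays for the final transfer of the output from stack `4` to stack `1`. -/
theorem length_out_le {w : List Γ'} (o : Printer) (ρ : ℕ → ℕ) :
    (o.out w ρ).length ≤ o.size w.length := by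
  induction o generalizing ρ with
  | nil => exact le_rfl
  | emit s => exact le_rfl
  | seq o o' ih ih' =>
    simp only [out, size, List.length_append]
    exact Nat.add_le_add (ih ρ) (ih' ρ)
  | ite c o o' ih ih' =>
    have := ih ρ
    have := ih' ρ
    simp only [out, size]
    split_ifs <;> omega
  | each o ih =>
    simp only [out, size]
    generalize w.length = N at *
    have : ∀ M, ((List.range M).flatMap fun y => out w o (cons y ρ)).length ≤ M * size o N := by
      intro M
      induction M with
      | zero => simp
      | succ M ihM =>
        rw [List.range_succ, List.flatMap_append, List.length_append, Nat.succ_mul]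
        have := ih (cons M ρ)
        simp only [List.flatMap_cons, List.flatMap_nil, List.append_nil]
        omega
    exact this N

theorem cmd_spec {w : List Γ'} (o : Printer) : ∀ {ρ env : ℕ → ℕ} {l : ℕ} {S : Stacks},
    Arith.Ok w ρ env l S →
      Cmd.Spec (o.cmd env l) S (update S 4 ((o.out w ρ).reverse ++ S 4)) (o.time w.length) := by
  induction o with
  | nil =>
    intro ρ env l S h
    exact (Cmd.spec_skip S).to (by simp [out]) le_rfl
  | emit s =>
    intro ρ env l S h
    exact Cmd.spec_push 4 s S
  | seq o o' ih ih' =>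
    intro ρ env l S h
    have hl := h.lvl
    have h' : Arith.Ok w ρ env l (update S 4 ((o.out w ρ).reverse ++ S 4)) :=
      h.extend le_rfl (fun r _ h4 => Function.update_of_ne h4 _ _)
        (fun r hr => by rw [Function.update_of_ne (by omega)]; exact h.free r hr)
    exact ((ih h).seq (ih' h')).to (by simp [out]) le_rfl
  | ite c o o' ih ih' =>
    intro ρ env l S h
    have hl := h.lvl
    have hv := Arith.val_le_bd c (ρ := ρ) (w := w) (fun i => (h.env i).2.2.2)
    have e : ∀ n, update (update S l (Cmd.unary n)) l [] = S := fun n => by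
      rw [Function.update_idem, ← h.free l le_rfl, Function.update_eq_self]
    by_cases h0 : c.val w ρ = 0
    · have hout : (ite c o o').out w ρ = o'.out w ρ := by simp [out, h0]
      rw [hout]
      refine ((c.cmd_spec h).seq (Cmd.spec_ifne_neg (by simp [h0]) ((ih' h).of ?_))).mono ?_
      · rw [h0, Cmd.unary, List.replicate_zero, ← h.free l le_rfl, Function.update_eq_self]
      · simp only [time]
        omega
    · have hout : (ite c o o').out w ρ = o.out w ρ := by simp [out, h0]
      rw [hout]
      refine ((c.cmd_spec h).seq (Cmd.spec_ifne_pos (by simpa using h0)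
        ((Cmd.spec_clear l _).seq ((ih h).of (e _).symm)))).mono ?_
      rw [Function.update_self, List.length_replicate]
      simp only [time]
      omega
  | each o ih =>
    intro ρ env l S h
    have hl := h.lvl
    have hf := h.free
    set N := w.length with hN
    set g := fun M => (List.range M).flatMap fun y => out w o (cons y ρ) with hg
    have h₁ := Cmd.spec_copy (k := 3) (d := l) (n := N) (by omega) (by omega) (by omega) h.aux
      h.len
    have h₂ := Cmd.spec_loop (k := l) (c := .seq (cmd o (cons (l + 1) env) (l + 2))
      (.push (l + 1) fun _ => Γ'.blank)) (time o N + 0) N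
      (fun i => update (update (update S 4 ((g i).reverse ++ S 4)) l (Cmd.unary (N - i))) (l + 1)
        (Cmd.unary i)) (fun i hi => ?_) (by simp)
    · refine (h₁.seq ((h₂.of ?_).seq (Cmd.spec_clear (l + 1) _))).to ?_ ?_
      · have := hf l le_rfl
        funext r
        simp only [Function.update_apply, hg, List.range_zero, List.flatMap_nil, List.reverse_nil,
          List.nil_append, Nat.sub_zero]
        split_ifs <;> first | omega | rfl | simp_all
      · have := hf l le_rfl
        have := hf (l + 1) (by omega)
        have e : (each o).out w ρ = g N := rfl
        funext r
        simp only [Function.update_apply, e, Nat.sub_self]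
        split_ifs <;> first | omega | rfl | simp_all
      · rw [Function.update_self, List.length_replicate]
        exact le_rfl
    · refine ⟨Γ'.blank, Cmd.unary (N - (i + 1)), ?_, ?_⟩
      · have : N - i = N - (i + 1) + 1 := by omega
        rw [Function.update_of_ne (by omega), Function.update_self, this, Cmd.unary_succ]
      · set S₁ := update (update (update (update S 4 ((g i).reverse ++ S 4)) l
          (Cmd.unary (N - i))) (l + 1) (Cmd.unary i)) l (Cmd.unary (N - (i + 1))) with hS₁
        have hOk : Arith.Ok w (cons i ρ) (cons (l + 1) env) (l + 2) S₁ := by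
          refine (h.extend (by omega) (fun r hr _ => ?_) (fun r hr => ?_)).cons (by omega)
            (by omega) ?_ (by omega)
          · rw [hS₁]
            simp only [Function.update_apply]
            split_ifs <;> first | omega | rfl
          · rw [hS₁]
            simp only [Function.update_apply]
            split_ifs <;> first | omega | exact hf r (by omega)
          · rw [hS₁]
            simp
        have e : g (i + 1) = g i ++ out w o (cons i ρ) := by
          simp [hg, List.range_succ]
        refine (((ih hOk).seq (Cmd.spec_push (l + 1) Γ'.blank _)).to ?_ le_rfl) _
        funext r
        simp only [Function.update_apply, hS₁, e]
        split_ifs <;> first | omega | rfl | simp_all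

/-- The complete stack program of a printer. -/
def prog (o : Printer) : Cmd :=
  -- The length of the string is written on stack `3` while the string passes to stack `2`; moving
  -- it back restores the order. Stack `5` remains empty and represents the value `0` of all free
  -- variables.
  .seq (.loop 0 (.seq (.push 2 fun s => s.getD Γ'.blank) (.push 3 fun _ => Γ'.blank)))
    (.seq (.move 2 0) (.seq (o.cmd (fun _ => 5) 6)
      -- Moving stack `4` to stack `1` undoes the reversal of the output. The pop from the empty
      -- stack `0` resets the register to `none`.
      (.seq (.clear 0) (.seq (.clear 3) (.seq (.move 4 1) (.pop 0))))))

theorem prog_spec (o : Printer) (w : List Γ') :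
    ∃ t, t ≤ (w.length * (0 + 1) + 1) + ((w.length + 1) + (o.time w.length + ((w.length + 1) +
      ((w.length + 1) + (o.size w.length + 1))))) ∧
      Cmd.Runs o.prog none (Cmd.single 0 w) t none (Cmd.single 1 (o.out w fun _ => 0)) := by
  set N := w.length with hN
  have h₁ := Cmd.spec_loop (k := 0)
    (c := .seq (.push 2 fun s => s.getD Γ'.blank) (.push 3 fun _ => Γ'.blank)) 0 N
    (fun i => update (update (update (fun _ => []) 2 (w.take i).reverse) 3 (Cmd.unary i)) 0
      (w.drop i)) (fun i hi => ?_) (by simp [hN])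
  · have h₂ := h₁.seq (Cmd.spec_move (k := 2) (d := 0) (by omega) _)
    have h₃ := h₂.of (T := Cmd.single 0 w) (by
      funext r
      simp only [Function.update_apply, Cmd.single, List.take_zero, List.drop_zero]
      split_ifs <;> rfl)
    have h₄ := h₃.to (T := update (update (fun _ => []) 3 (Cmd.unary N)) 0 w)
      (B' := (N * (0 + 1) + 1) + (N + 1)) (by
        funext r
        simp only [Function.update_apply]
        split_ifs <;> first | omega | rfl | simp_all) (by simp [hN])
    have hOk : Arith.Ok w (fun _ => 0) (fun _ => 5) 6
        (update (update (fun _ => []) 3 (Cmd.unary N)) 0 w) :=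
      ⟨by simp, by simp, by simp [hN], le_rfl, fun r hr => by
        rw [Function.update_of_ne (by omega), Function.update_of_ne (by omega)],
        fun i => ⟨le_rfl, by omega, by simp, Nat.zero_le _⟩⟩
    have h₅ := ((o.cmd_spec hOk).seq ((Cmd.spec_clear 0 _).seq ((Cmd.spec_clear 3 _).seq
      (Cmd.spec_move (k := 4) (d := 1) (by omega) _)))).to
      (T := Cmd.single 1 (o.out w fun _ => 0)) (B' := o.time N + ((N + 1) +
      ((N + 1) + (o.size N + 1)))) (by
        funext r
        simp only [Function.update_apply, Cmd.single]
        split_ifs <;> first | omega | rfl | simp_all) (by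
        have := o.length_out_le (w := w) (fun _ => 0)
        simp
        rw [← hN] at this ⊢
        omega)
    obtain ⟨v₁, t₁, ht₁, hr₁⟩ := h₄ none
    obtain ⟨v₂, t₂, ht₂, hr₂⟩ := h₅ v₁
    have hpop := Cmd.Runs.pop 0 v₂ (Cmd.single 1 (o.out w fun _ => 0))
    have e₀ : Cmd.single 1 (o.out w fun _ => 0) 0 = [] := by simp [Cmd.single]
    have e₁ : update (Cmd.single 1 (o.out w fun _ => 0)) 0 [] =
        Cmd.single 1 (o.out w fun _ => 0) := by
      conv_lhs => rw [← e₀, Function.update_eq_self]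
    rw [e₀, List.tail_nil, e₁, List.head?_nil] at hpop
    cases hr₁ with
    | seq ha hb =>
      cases hr₂ with
      | seq hc hd =>
        cases hd with
        | seq hd he =>
          cases he with
          | seq he hg =>
            exact ⟨_, by omega, ha.seq (hb.seq (hc.seq (hd.seq (he.seq (hg.seq hpop)))))⟩
  · refine ⟨w[i], w.drop (i + 1), by simp, some w[i], 0 + 0, le_rfl, .seq (.push 2 _ _ _) ?_⟩
    convert Cmd.Runs.push 3 _ _ _ using 1
    have e := List.take_succ_eq_append_getElem hi
    funext r
    simp only [Function.update_apply, e, List.reverse_append]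
    split_ifs <;> first | omega | contradiction | rfl

end Printer

/-- The interface between machines and mathematics: it now suffices to exhibit a printer with the
right output. -/
theorem polyTime_of_printer {α β : Type} {ea : α → List Γ'} {eb : β → List Γ'} {f : α → β}
    (o : Printer) (h : ∀ a, o.out (ea a) (fun _ => 0) = eb (f a)) : PolyTime ea eb f := by
  obtain ⟨p, q, hpq⟩ := o.exists_poly
  refine Cmd.polyTime_of_runs o.prog ((.X * (0 + 1) + 1) + ((.X + 1) + (p + ((.X + 1) +
      ((.X + 1) + (q + 1)))))) fun a => ?_
  obtain ⟨t, ht, hr⟩ := o.prog_spec (ea a)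
  refine ⟨t, ht.trans (le_of_eq ?_), h a ▸ hr⟩
  simp [hpq]

end TwoMU

namespace TwoMU

/-! ### Literals -/

section Literals

variable {V : Type}

@[simp] theorem compl_compl (x : Literal V) : compl (compl x) = x := by simp [compl]

@[simp] theorem compl_fst (x : Literal V) : (compl x).1 = x.1 := rfl

theorem compl_ne (x : Literal V) : compl x ≠ x := fun h => by
  have := congrArg Prod.snd h
  simp [compl] at this

theorem compl_injective : Function.Injective (compl : Literal V → Literal V) := fun x y h => by
  rw [← compl_compl x, h, compl_compl]

theorem compl_eq_comm {x y : Literal V} : compl x = y ↔ x = compl y :=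
  ⟨fun h => by rw [← h, compl_compl], fun h => by rw [h, compl_compl]⟩

theorem fst_eq_iff {x y : Literal V} : x.1 = y.1 ↔ x = y ∨ x = compl y := by
  obtain ⟨v, b⟩ := x
  obtain ⟨v', b'⟩ := y
  cases b <;> cases b' <;> simp [compl]

/-- Truth of a literal under an assignment. -/
def Holds (τ : V → Bool) (x : Literal V) : Prop := τ x.1 = x.2

theorem holds_compl {τ : V → Bool} {x : Literal V} : Holds τ (compl x) ↔ ¬ Holds τ x := by
  obtain ⟨v, b⟩ := x
  unfold Holds compl
  cases τ v <;> cases b <;> simp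

end Literals

/-! ### Presentations of clause-sets by walks -/

section ChainForm

variable {V : Type} [DecidableEq V]

/-- The clauses of `F` are the implications `φ k → φ (k + 1)` along a walk, where `φ 1, …, φ n` have
different variables, and where the walk starts with the complement of `φ x` and ends with the
complement of `φ y`. -/
structure ChainForm (F : ClauseSet V) (n x y : ℕ) (φ : ℕ → Literal V) : Prop where
  one_le : 1 ≤ x
  le : x ≤ y
  le_size : y ≤ n
  inj : ∀ j k, 1 ≤ j → j ≤ n → 1 ≤ k → k ≤ n → (φ j).1 = (φ k).1 → j = k
  first : φ 0 = compl (φ x)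
  last : φ (n + 1) = compl (φ y)
  eq : F = (Finset.range (n + 1)).image fun k => {compl (φ k), φ (k + 1)}

namespace ChainForm

variable {F : ClauseSet V} {n x y : ℕ} {φ : ℕ → Literal V}

theorem mem_iff (h : ChainForm F n x y φ) (C : Finset (Literal V)) :
    C ∈ F ↔ ∃ k ≤ n, {compl (φ k), φ (k + 1)} = C := by
  rw [h.eq]
  simp

theorem fst_eq (h : ChainForm F n x y φ) {k : ℕ} (hk : k ≤ n + 1) :
    ∃ j, 1 ≤ j ∧ j ≤ n ∧ (φ k).1 = (φ j).1 := by
  have h₁ := h.one_le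
  have h₂ := h.le
  have h₃ := h.le_size
  rcases Nat.eq_zero_or_pos k with rfl | hk0
  · exact ⟨x, h₁, by omega, by rw [h.first, compl_fst]⟩
  · rcases Nat.lt_or_ge n k with hk' | hk'
    · obtain rfl : k = n + 1 := by omega
      exact ⟨y, by omega, h₃, by rw [h.last, compl_fst]⟩
    · exact ⟨k, hk0, hk', rfl⟩

/-- Truth propagates along the walk. If `φ 0 = ¬φ x` were true, then `φ x` would be true as well; so
`φ x` is true. As `x ≤ y`, both `φ y` and the last literal `¬φ y` follow. -/
theorem not_satisfiable (h : ChainForm F n x y φ) : ¬ Satisfiable F := by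
  rintro ⟨τ, hτ⟩
  have h₁ := h.one_le
  have h₂ := h.le
  have h₃ := h.le_size
  have step : ∀ k ≤ n, Holds τ (φ k) → Holds τ (φ (k + 1)) := by
    intro k hk hh
    obtain ⟨z, hz, hz'⟩ := hτ _ ((h.mem_iff _).2 ⟨k, hk, rfl⟩)
    rcases Finset.mem_insert.1 hz with rfl | hz
    · exact absurd hh (holds_compl.1 hz')
    · rw [Finset.mem_singleton] at hz
      exact hz ▸ hz'
  have steps : ∀ d k, k + d ≤ n + 1 → Holds τ (φ k) → Holds τ (φ (k + d)) := by
    intro d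
    induction d with
    | zero => exact fun k _ hh => hh
    | succ d ih => exact fun k hk hh => step (k + d) (by omega) (ih k (by omega) hh)
  have h0 : ¬ Holds τ (φ 0) := fun h0 => by
    have := steps x 0 (by omega) h0
    rw [Nat.zero_add] at this
    rw [h.first, holds_compl] at h0
    exact h0 this
  rw [h.first, holds_compl, not_not] at h0
  have hy := steps (y - x) x (by omega) h0
  have hn := steps (n + 1 - x) x (by omega) h0
  rw [show x + (y - x) = y by omega] at hy
  rw [show x + (n + 1 - x) = n + 1 by omega, h.last, holds_compl] at hn
  exact hn hy

/-- As the variables are different, the truth values of `φ 1, …, φ n` can be prescribed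
independently. -/
theorem exists_assignment (h : ChainForm F n x y φ) (p : ℕ → Prop) :
    ∃ τ : V → Bool, ∀ j, 1 ≤ j → j ≤ n → (Holds τ (φ j) ↔ p j) := by
  classical
  refine ⟨fun v => if hv : ∃ j, 1 ≤ j ∧ j ≤ n ∧ (φ j).1 = v then
    (if p hv.choose then (φ hv.choose).2 else !(φ hv.choose).2) else true, fun j hj hj' => ?_⟩
  have hv : ∃ i, 1 ≤ i ∧ i ≤ n ∧ (φ i).1 = (φ j).1 := ⟨j, hj, hj', rfl⟩
  have hc : hv.choose = j :=
    h.inj _ _ hv.choose_spec.1 hv.choose_spec.2.1 hj hj' hv.choose_spec.2.2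
  unfold Holds
  simp only [dif_pos hv, hc]
  split_ifs with hp <;> simp [hp]

/-- Make `φ j` true exactly for `j ≤ k`: the implications before number `k` have true conclusions,
and those after it have false premises. -/
theorem satisfiable_except (h : ChainForm F n x y φ) {k : ℕ} (hk : k ≤ n) :
    ∃ τ : V → Bool, ∀ j ≤ n, j ≠ k →
      ∃ z ∈ ({compl (φ j), φ (j + 1)} : Finset (Literal V)), τ z.1 = z.2 := by
  have h₁ := h.one_le
  have h₂ := h.le
  have h₃ := h.le_size
  obtain ⟨τ, hτ⟩ := h.exists_assignment fun j => j ≤ k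
  refine ⟨τ, fun j hj hjk => ?_⟩
  rcases Nat.lt_or_ge j k with hlt | hge
  · exact ⟨φ (j + 1), by simp, (hτ (j + 1) (by omega) (by omega)).2 hlt⟩
  · refine ⟨compl (φ j), by simp, holds_compl.2 fun hh => ?_⟩
    have := (hτ j (by omega) hj).1 hh
    omega

/-- If two steps gave the same clause, then an assignment satisfying all steps but one of them would
satisfy `F`. -/
theorem clause_injective (h : ChainForm F n x y φ) {j k : ℕ} (hj : j ≤ n) (hk : k ≤ n)
    (e : ({compl (φ j), φ (j + 1)} : Finset (Literal V)) = {compl (φ k), φ (k + 1)}) : j = k := by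
  by_contra hjk
  obtain ⟨τ, hτ⟩ := h.satisfiable_except hk
  refine h.not_satisfiable ⟨τ, fun C hC => ?_⟩
  obtain ⟨i, hi, rfl⟩ := (h.mem_iff C).1 hC
  by_cases hik : i = k
  · rw [hik, ← e]
    exact hτ j hj hjk
  · exact hτ i hi hik

theorem isMU (h : ChainForm F n x y φ) : IsMU F := by
  refine ⟨h.not_satisfiable, fun C hC => ?_⟩
  obtain ⟨k, hk, rfl⟩ := (h.mem_iff C).1 hC
  obtain ⟨τ, hτ⟩ := h.satisfiable_except hk
  refine ⟨τ, fun D hD => ?_⟩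
  obtain ⟨hne, hD⟩ := Finset.mem_erase.1 hD
  obtain ⟨j, hj, rfl⟩ := (h.mem_iff D).1 hD
  exact hτ j hj fun e => hne (by rw [e])

theorem card (h : ChainForm F n x y φ) : F.card = n + 1 := by
  rw [h.eq, Finset.card_image_of_injOn, Finset.card_range]
  intro j hj k hk e
  exact h.clause_injective (Nat.lt_succ_iff.1 (by simpa using hj))
    (Nat.lt_succ_iff.1 (by simpa using hk)) e

theorem mem_vars_iff (h : ChainForm F n x y φ) (v : V) :
    v ∈ vars F ↔ ∃ j, 1 ≤ j ∧ j ≤ n ∧ (φ j).1 = v := by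
  simp only [vars, Finset.mem_biUnion, Finset.mem_image]
  constructor
  · rintro ⟨C, hC, z, hz, rfl⟩
    obtain ⟨k, hk, rfl⟩ := (h.mem_iff C).1 hC
    rcases Finset.mem_insert.1 hz with rfl | hz
    · obtain ⟨j, h1, h2, h3⟩ := h.fst_eq (k := k) (by omega)
      exact ⟨j, h1, h2, h3.symm⟩
    · rw [Finset.mem_singleton] at hz
      obtain ⟨j, h1, h2, h3⟩ := h.fst_eq (k := k + 1) (by omega)
      exact ⟨j, h1, h2, by rw [hz, h3]⟩
  · rintro ⟨j, h1, h2, rfl⟩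
    exact ⟨_, (h.mem_iff _).2 ⟨j, h2, rfl⟩, compl (φ j), by simp, rfl⟩

theorem vars_eq (h : ChainForm F n x y φ) :
    vars F = (Finset.Icc 1 n).image fun j => (φ j).1 := by
  ext v
  rw [h.mem_vars_iff]
  simp [and_assoc]

theorem card_vars (h : ChainForm F n x y φ) : (vars F).card = n := by
  rw [h.vars_eq, Finset.card_image_of_injOn]
  · simp
  · intro j hj k hk e
    simp only [Finset.coe_Icc, Set.mem_Icc] at hj hk
    exact h.inj j k hj.1 hj.2 hk.1 hk.2 e

theorem mem_lits_iff (h : ChainForm F n x y φ) (z : Literal V) :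
    z ∈ lits F ↔ ∃ j, 1 ≤ j ∧ j ≤ n ∧ (z = φ j ∨ z = compl (φ j)) := by
  simp only [lits, Finset.mem_product, Finset.mem_univ, and_true, h.mem_vars_iff]
  simp only [← fst_eq_iff, eq_comm]

theorem isClauseSet (h : ChainForm F n x y φ) : IsClauseSet F := by
  have h₁ := h.one_le
  have h₂ := h.le
  have h₃ := h.le_size
  have key : ∀ k ≤ n, φ (k + 1) ≠ φ k := by
    intro k hk e
    rcases Nat.eq_zero_or_pos k with rfl | hk0
    · rw [h.first] at e
      have := h.inj (0 + 1) x (by omega) (by omega) h₁ (by omega) (by rw [e, compl_fst])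
      rw [← this] at e
      exact compl_ne _ e.symm
    · rcases Nat.lt_or_ge k n with hkn | hkn
      · have := h.inj (k + 1) k (by omega) hkn hk0 hk (by rw [e])
        omega
      · obtain rfl : k = n := by omega
        rw [h.last] at e
        have := h.inj y k (by omega) h₃ hk0 hk (by rw [← e, compl_fst])
        rw [this] at e
        exact compl_ne _ e
  intro C hC z hz hz'
  obtain ⟨k, hk, rfl⟩ := (h.mem_iff C).1 hC
  simp only [Finset.mem_insert, Finset.mem_singleton] at hz hz'
  have := key k hk
  rcases hz with rfl | rfl <;> rcases hz' with e | e
  · exact compl_ne _ e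
  · rw [compl_compl] at e
    exact this e.symm
  · exact this (compl_injective e)
  · exact compl_ne _ e

theorem isTwoMUDefOne (h : ChainForm F n x y φ) : IsTwoMUDefOne F := by
  refine ⟨h.isClauseSet, fun C hC => ?_, h.isMU, ?_, fun e => ?_⟩
  · obtain ⟨k, hk, rfl⟩ := (h.mem_iff C).1 hC
    exact Finset.card_le_two
  · unfold deficiency
    rw [h.card, h.card_vars]
    simp
  · have : (∅ : Finset (Literal V)) ∈ F := by simp [e]
    obtain ⟨k, _, hk⟩ := (h.mem_iff _).1 this
    simp at hk

/-- Reversal of the walk. -/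
theorem flip (h : ChainForm F n x y φ) :
    ChainForm F n (n + 1 - y) (n + 1 - x) fun k => compl (φ (n + 1 - k)) := by
  have h₁ := h.one_le
  have h₂ := h.le
  have h₃ := h.le_size
  refine ⟨by omega, by omega, by omega, fun j k hj hj' hk hk' e => ?_, ?_, ?_, ?_⟩
  · have := h.inj (n + 1 - j) (n + 1 - k) (by omega) (by omega) (by omega) (by omega) e
    omega
  · simp only [Nat.sub_zero]
    rw [h.last, show n + 1 - (n + 1 - y) = y by omega]
  · simp only [Nat.sub_self]
    rw [h.first, show n + 1 - (n + 1 - x) = x by omega]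
  -- Step `k` of the reversed walk is the contrapositive of step `n - k`.
  · ext C
    rw [h.mem_iff]
    simp only [Finset.mem_image, Finset.mem_range, Nat.lt_succ_iff, compl_compl]
    constructor
    · rintro ⟨k, hk, rfl⟩
      refine ⟨n - k, by omega, ?_⟩
      rw [show n + 1 - (n - k) = k + 1 by omega, show n + 1 - (n - k + 1) = k by omega,
        Finset.pair_comm]
    · rintro ⟨k, hk, rfl⟩
      refine ⟨n - k, by omega, ?_⟩
      rw [show n + 1 - k = n - k + 1 by omega, show n + 1 - (k + 1) = n - k by omega,
        Finset.pair_comm]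

theorem exists_normal (h : ChainForm F n x y φ) :
    ∃ x' y' φ', x' + y' ≤ n + 1 ∧ ChainForm F n x' y' φ' := by
  have h₂ := h.le
  have h₃ := h.le_size
  by_cases hxy : x + y ≤ n + 1
  · exact ⟨x, y, φ, hxy, h⟩
  · exact ⟨_, _, _, by omega, h.flip⟩

theorem map {G : ClauseSet V} (h : ChainForm F n x y φ) {f : Literal V → Literal V}
    (hf : Set.InjOn f (lits F : Set (Literal V)))
    (hc : ∀ x ∈ lits F, f (compl x) = compl (f x)) (hG : F.image (fun C => C.image f) = G) :
    ChainForm G n x y (f ∘ φ) := by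
  have h₁ := h.one_le
  have h₂ := h.le
  have h₃ := h.le_size
  have hl : ∀ j, 1 ≤ j → j ≤ n → φ j ∈ lits F := fun j hj hj' =>
    (h.mem_lits_iff _).2 ⟨j, hj, hj', .inl rfl⟩
  have hl' : ∀ j, 1 ≤ j → j ≤ n → compl (φ j) ∈ lits F := fun j hj hj' =>
    (h.mem_lits_iff _).2 ⟨j, hj, hj', .inr rfl⟩
  have hl0 : ∀ j ≤ n + 1, φ j ∈ lits F := fun j hj => by
    obtain ⟨i, hi, hi', e⟩ := h.fst_eq hj
    exact (h.mem_lits_iff _).2 ⟨i, hi, hi', fst_eq_iff.1 e⟩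
  refine ⟨h₁, h₂, h₃, fun j k hj hj' hk hk' e => ?_, ?_, ?_, ?_⟩
  · refine h.inj j k hj hj' hk hk' ?_
    rw [fst_eq_iff]
    rcases fst_eq_iff.1 e with e | e
    · exact .inl (hf (hl j hj hj') (hl k hk hk') e)
    · simp only [Function.comp] at e
      rw [← hc _ (hl k hk hk')] at e
      exact .inr (hf (hl j hj hj') (hl' k hk hk') e)
  · simp only [Function.comp]
    rw [h.first, hc _ (hl x h₁ (by omega))]
  · simp only [Function.comp]
    rw [h.last, hc _ (hl y (by omega) h₃)]
  · rw [← hG, h.eq, Finset.image_image]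
    refine Finset.image_congr fun k hk => ?_
    have hk' : k ≤ n := Nat.lt_succ_iff.1 (by simpa using hk)
    simp only [Function.comp, Finset.image_insert, Finset.image_singleton]
    rw [hc _ (hl0 k (by omega))]

theorem map_iso {G : ClauseSet V} (h : ChainForm F n x y φ) (i : Iso F G) :
    ∃ ψ, ChainForm G n x y ψ := by
  obtain ⟨f, hf, hc, hG⟩ := i
  exact ⟨_, h.map hf.injOn hc hG⟩

/-- The isomorphism sends `φ j` to `ψ j` and `¬φ j` to `¬ψ j`. Since `x` and `y` agree, it also maps
the end points of the one walk to those of the other. -/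
theorem iso {G : ClauseSet V} {ψ : ℕ → Literal V} (h : ChainForm F n x y φ)
    (h' : ChainForm G n x y ψ) : Iso F G := by
  classical
  have h₁ := h.one_le
  have h₂ := h.le
  have h₃ := h.le_size
  let f : Literal V → Literal V := fun z =>
    if hz : ∃ j, 1 ≤ j ∧ j ≤ n ∧ z = φ j then ψ hz.choose else
    if hz : ∃ j, 1 ≤ j ∧ j ≤ n ∧ z = compl (φ j) then compl (ψ hz.choose) else z
  have f₁ : ∀ j, 1 ≤ j → j ≤ n → f (φ j) = ψ j := by
    intro j hj hj'
    have hz : ∃ i, 1 ≤ i ∧ i ≤ n ∧ φ j = φ i := ⟨j, hj, hj', rfl⟩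
    have : hz.choose = j := h.inj _ _ hz.choose_spec.1 hz.choose_spec.2.1 hj hj'
      (by rw [← hz.choose_spec.2.2])
    simp only [f, dif_pos hz, this]
  have f₂ : ∀ j, 1 ≤ j → j ≤ n → f (compl (φ j)) = compl (ψ j) := by
    intro j hj hj'
    have hn : ¬ ∃ i, 1 ≤ i ∧ i ≤ n ∧ compl (φ j) = φ i := by
      rintro ⟨i, hi, hi', e⟩
      have := h.inj j i hj hj' hi hi' (by rw [← e, compl_fst])
      rw [this] at e
      exact compl_ne _ e
    have hz : ∃ i, 1 ≤ i ∧ i ≤ n ∧ compl (φ j) = compl (φ i) := ⟨j, hj, hj', rfl⟩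
    have : hz.choose = j := h.inj _ _ hz.choose_spec.1 hz.choose_spec.2.1 hj hj'
      (by rw [← compl_injective hz.choose_spec.2.2])
    simp only [f, dif_neg hn, dif_pos hz, this]
  have fc : ∀ z ∈ lits F, f (compl z) = compl (f z) := by
    intro z hz
    obtain ⟨j, hj, hj', rfl | rfl⟩ := (h.mem_lits_iff z).1 hz
    · rw [f₁ j hj hj', f₂ j hj hj']
    · rw [compl_compl, f₁ j hj hj', f₂ j hj hj', compl_compl]
  have f₃ : ∀ j ≤ n + 1, f (φ j) = ψ j := by
    intro j hj
    rcases Nat.eq_zero_or_pos j with rfl | hj0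
    · rw [h.first, h'.first, f₂ x h₁ (by omega)]
    · rcases Nat.lt_or_ge n j with hj' | hj'
      · obtain rfl : j = n + 1 := by omega
        rw [h.last, h'.last, f₂ y (by omega) h₃]
      · exact f₁ j hj0 hj'
  refine ⟨f, ⟨fun z hz => ?_, fun z hz z' hz' e => ?_, fun z hz => ?_⟩, fc, ?_⟩
  · obtain ⟨j, hj, hj', rfl | rfl⟩ := (h.mem_lits_iff z).1 hz
    · rw [f₁ j hj hj']
      exact (h'.mem_lits_iff _).2 ⟨j, hj, hj', .inl rfl⟩
    · rw [f₂ j hj hj']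
      exact (h'.mem_lits_iff _).2 ⟨j, hj, hj', .inr rfl⟩
  · obtain ⟨j, hj, hj', rfl | rfl⟩ := (h.mem_lits_iff z).1 hz <;>
    obtain ⟨k, hk, hk', rfl | rfl⟩ := (h.mem_lits_iff z').1 hz' <;>
    simp only [f₁ j hj hj', f₂ j hj hj', f₁ k hk hk', f₂ k hk hk'] at e <;>
    have := h'.inj j k hj hj' hk hk' (by simpa using congrArg Prod.fst e) <;>
    subst this
    · rfl
    · exact absurd e.symm (compl_ne _)
    · exact absurd e (compl_ne _)
    · rfl
  · obtain ⟨j, hj, hj', rfl | rfl⟩ := (h'.mem_lits_iff z).1 hz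
    · exact ⟨φ j, (h.mem_lits_iff _).2 ⟨j, hj, hj', .inl rfl⟩, f₁ j hj hj'⟩
    · exact ⟨compl (φ j), (h.mem_lits_iff _).2 ⟨j, hj, hj', .inr rfl⟩, f₂ j hj hj'⟩
  · rw [h.eq, h'.eq, Finset.image_image]
    refine Finset.image_congr fun k hk => ?_
    have hk' : k ≤ n := Nat.lt_succ_iff.1 (by simpa using hk)
    have hl : φ k ∈ lits F := by
      obtain ⟨i, hi, hi', e⟩ := h.fst_eq (k := k) (by omega)
      exact (h.mem_lits_iff _).2 ⟨i, hi, hi', fst_eq_iff.1 e⟩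
    simp only [Function.comp, Finset.image_insert, Finset.image_singleton]
    rw [fc _ hl, f₃ k (by omega), f₃ (k + 1) (by omega)]

end ChainForm

end ChainForm
end TwoMU

namespace TwoMU

/-! ### Undoing a resolution step, and occurrences of literals -/

section Existence

variable {V : Type} [DecidableEq V]

theorem mem_vars {F : ClauseSet V} {v : V} : v ∈ vars F ↔ ∃ C ∈ F, ∃ z ∈ C, z.1 = v := by
  simp [vars]

namespace ChainForm

variable {F : ClauseSet V} {n x y : ℕ} {φ : ℕ → Literal V}

/-- Subdivision of an implication by a new literal. -/
theorem subdivide (h : ChainForm F n x y φ) {k : ℕ} (hk : k ≤ n) {z : Literal V}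
    (hz : z.1 ∉ vars F) {G : ClauseSet V}
    (hG : ∀ C, C ∈ G ↔ (C ∈ F ∧ C ≠ {compl (φ k), φ (k + 1)}) ∨ C = {compl (φ k), z} ∨
      C = {compl z, φ (k + 1)}) :
    ∃ x' y' ψ, ChainForm G (n + 1) x' y' ψ := by
  have h₁ := h.one_le
  have h₂ := h.le
  have h₃ := h.le_size
  have hv : ∀ j, 1 ≤ j → j ≤ n → (φ j).1 ≠ z.1 := fun j hj hj' e =>
    hz ((h.mem_vars_iff _).2 ⟨j, hj, hj', e⟩)
  -- The new literal gets position `k + 1`. All later positions move up by one, including `x` and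
  -- `y` if they exceed `k`.
  set ψ : ℕ → Literal V := fun j => if j ≤ k then φ j else if j = k + 1 then z else φ (j - 1)
    with hψ
  have ψ₁ : ∀ j ≤ k, ψ j = φ j := fun j hj => by simp [hψ, hj]
  have ψ₂ : ψ (k + 1) = z := by simp [hψ]
  have ψ₃ : ∀ j, k < j → ψ (j + 1) = φ j := fun j hj => by
    simp only [hψ]
    rw [if_neg (by omega), if_neg (by omega), Nat.add_sub_cancel]
  have hs : ∀ a, ψ (if a ≤ k then a else a + 1) = φ a := by
    intro a
    split_ifs with ha
    · exact ψ₁ a ha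
    · exact ψ₃ a (by omega)
  refine ⟨if x ≤ k then x else x + 1, if y ≤ k then y else y + 1, ψ, ?_, ?_, ?_, ?_, ?_, ?_, ?_⟩
  · split_ifs <;> omega
  · split_ifs <;> omega
  · split_ifs <;> omega
  · have key : ∀ j, 1 ≤ j → j ≤ n + 1 → j = k + 1 ∨
        ∃ i, 1 ≤ i ∧ i ≤ n ∧ ψ j = φ i ∧ j = if i ≤ k then i else i + 1 := by
      intro j hj hj'
      rcases Nat.lt_trichotomy j (k + 1) with hlt | heq | hgt
      · exact .inr ⟨j, hj, by omega, ψ₁ j (by omega), by rw [if_pos (by omega)]⟩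
      · exact .inl heq
      · obtain ⟨i, rfl⟩ : ∃ i, j = i + 1 := ⟨j - 1, by omega⟩
        exact .inr ⟨i, by omega, by omega, ψ₃ i (by omega), by rw [if_neg (by omega)]⟩
    intro j j' hj hj₁ hj' hj₁' e
    rcases key j hj hj₁ with rfl | ⟨i, hi, hi', e₁, e₂⟩ <;>
    rcases key j' hj' hj₁' with rfl | ⟨i₁, hi₁, hi₁', e₁', e₂'⟩
    · rfl
    · rw [ψ₂, e₁'] at e
      exact absurd e.symm (hv _ hi₁ hi₁')
    · rw [ψ₂, e₁] at e
      exact absurd e (hv _ hi hi')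
    · rw [e₁, e₁'] at e
      rw [e₂, e₂', h.inj i i₁ hi hi' hi₁ hi₁' e]
  · rw [ψ₁ 0 (by omega), h.first, hs]
  · rw [ψ₃ (n + 1) (by omega), h.last, hs]
  · ext C
    rw [hG, h.mem_iff]
    simp only [Finset.mem_image, Finset.mem_range]
    constructor
    · rintro (⟨⟨j, hj, rfl⟩, hne⟩ | rfl | rfl)
      · rcases Nat.lt_trichotomy j k with hlt | heq | hgt
        · exact ⟨j, by omega, by rw [ψ₁ j hlt.le, ψ₁ (j + 1) hlt]⟩
        · exact absurd (by rw [heq]) hne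
        · exact ⟨j + 1, by omega, by rw [ψ₃ j hgt, ψ₃ (j + 1) (by omega)]⟩
      · exact ⟨k, by omega, by rw [ψ₁ k le_rfl, ψ₂]⟩
      · exact ⟨k + 1, by omega, by rw [ψ₂, ψ₃ (k + 1) (by omega)]⟩
    · rintro ⟨j, hj, rfl⟩
      rcases Nat.lt_trichotomy j k with hlt | heq | hgt
      · refine .inl ⟨⟨j, by omega, by rw [ψ₁ j hlt.le, ψ₁ (j + 1) hlt]⟩, fun e => ?_⟩
        rw [ψ₁ j hlt.le, ψ₁ (j + 1) hlt] at e
        have := h.clause_injective (by omega) hk e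
        omega
      · subst heq
        exact .inr (.inl (by rw [ψ₁ j le_rfl, ψ₂]))
      · obtain ⟨i, rfl⟩ : ∃ i, j = i + 1 := ⟨j - 1, by omega⟩
        rcases Nat.eq_or_lt_of_le (show k ≤ i by omega) with rfl | hlt
        · exact .inr (.inr (by rw [ψ₂, ψ₃ (k + 1) (by omega)]))
        · rw [ψ₃ i hlt, ψ₃ (i + 1) (by omega)]
          refine .inl ⟨⟨i, by omega, rfl⟩, fun e => ?_⟩
          have := h.clause_injective (by omega) hk e
          omega

/-- Replacement of a first unit-clause. -/
theorem prepend_unit (h : ChainForm F n 1 y φ) {z : Literal V} (hz : z.1 ∉ vars F)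
    {G : ClauseSet V}
    (hG : ∀ C, C ∈ G ↔ (C ∈ F ∧ C ≠ {φ 1}) ∨ C = {z} ∨ C = {compl z, φ 1}) :
    ∃ x' y' ψ, ChainForm G (n + 1) x' y' ψ := by
  have h₂ := h.le
  have h₃ := h.le_size
  have hv : ∀ j, 1 ≤ j → j ≤ n → (φ j).1 ≠ z.1 := fun j hj hj' e =>
    hz ((h.mem_vars_iff _).2 ⟨j, hj, hj', e⟩)
  have hu : ({compl (φ 0), φ (0 + 1)} : Finset (Literal V)) = {φ 1} := by simp [h.first]
  -- The start `¬φ 1 → φ 1` of the walk is replaced by `¬z → z → φ 1`.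
  set ψ : ℕ → Literal V := fun j => if j = 0 then compl z else if j = 1 then z else φ (j - 1)
    with hψ
  have ψ₀ : ψ 0 = compl z := rfl
  have ψ₁ : ψ 1 = z := rfl
  have ψ₂ : ∀ j, 1 ≤ j → ψ (j + 1) = φ j := fun j hj => by
    simp only [hψ]
    rw [if_neg (by omega), if_neg (by omega), Nat.add_sub_cancel]
  refine ⟨1, y + 1, ψ, le_rfl, by omega, by omega, ?_, by rw [ψ₀, ψ₁], ?_, ?_⟩
  · have key : ∀ j, 1 ≤ j → j ≤ n + 1 → j = 1 ∨
        ∃ i, 1 ≤ i ∧ i ≤ n ∧ ψ j = φ i ∧ j = i + 1 := by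
      intro j hj hj'
      rcases Nat.eq_or_lt_of_le hj with heq | hgt
      · exact .inl heq.symm
      · obtain ⟨i, rfl⟩ : ∃ i, j = i + 1 := ⟨j - 1, by omega⟩
        exact .inr ⟨i, by omega, by omega, ψ₂ i (by omega), rfl⟩
    intro j j' hj hj₁ hj' hj₁' e
    rcases key j hj hj₁ with rfl | ⟨i, hi, hi', e₁, e₂⟩ <;>
    rcases key j' hj' hj₁' with rfl | ⟨i₁, hi₁, hi₁', e₁', e₂'⟩
    · rfl
    · rw [ψ₁, e₁'] at e
      exact absurd e.symm (hv _ hi₁ hi₁')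
    · rw [ψ₁, e₁] at e
      exact absurd e (hv _ hi hi')
    · rw [e₁, e₁'] at e
      rw [e₂, e₂', h.inj i i₁ hi hi' hi₁ hi₁' e]
  · rw [ψ₂ (n + 1) (by omega), h.last, ψ₂ y h₂]
  · ext C
    rw [hG, h.mem_iff]
    simp only [Finset.mem_image, Finset.mem_range]
    constructor
    · rintro (⟨⟨j, hj, rfl⟩, hne⟩ | rfl | rfl)
      · rcases Nat.eq_zero_or_pos j with rfl | hj0
        · exact absurd hu hne
        · exact ⟨j + 1, by omega, by rw [ψ₂ j hj0, ψ₂ (j + 1) (by omega)]⟩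
      · exact ⟨0, by omega, by simp [ψ₀, ψ₁]⟩
      · exact ⟨1, by omega, by rw [ψ₁, ψ₂ 1 le_rfl]⟩
    · rintro ⟨j, hj, rfl⟩
      rcases j with _ | _ | j
      · exact .inr (.inl (by simp [ψ₀, ψ₁]))
      · exact .inr (.inr (by rw [Nat.zero_add, ψ₁, ψ₂ 1 le_rfl]))
      · rw [ψ₂ (j + 1) (by omega), ψ₂ (j + 1 + 1) (by omega)]
        refine .inl ⟨⟨j + 1, by omega, rfl⟩, fun e => ?_⟩
        rw [← hu] at e
        have := h.clause_injective (by omega) (Nat.zero_le n) e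
        omega

/-- Replacement of a unit-clause. -/
theorem split_unit (h : ChainForm F n x y φ) {z a : Literal V} (hz : z.1 ∉ vars F) (ha : {a} ∈ F)
    {G : ClauseSet V} (hG : ∀ C, C ∈ G ↔ (C ∈ F ∧ C ≠ {a}) ∨ C = {z} ∨ C = {compl z, a}) :
    ∃ x' y' ψ, ChainForm G (n + 1) x' y' ψ := by
  have h₁ := h.one_le
  have h₂ := h.le
  have h₃ := h.le_size
  obtain ⟨k, hk, e⟩ := (h.mem_iff _).1 ha
  have e₁ : compl (φ k) = a := by
    have : compl (φ k) ∈ ({a} : Finset (Literal V)) := by simp [← e]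
    simpa using this
  have e₂ : φ (k + 1) = a := by
    have : φ (k + 1) ∈ ({a} : Finset (Literal V)) := by simp [← e]
    simpa using this
  -- A unit-clause `{a}` is a step `¬a → a`. Inner steps join different variables, so it is the
  -- first or the last step; reversal reduces the last one to the first.
  rcases Nat.eq_zero_or_pos k with rfl | hk0
  · obtain rfl : x = 1 := h.inj _ _ h₁ (by omega) le_rfl (by omega) (by
      rw [h.first, compl_compl] at e₁
      rw [e₁, ← e₂])
    subst e₂
    exact h.prepend_unit hz hG
  · rcases Nat.lt_or_ge k n with hkn | hkn
    · have := h.inj k (k + 1) hk0 hk (by omega) hkn (by rw [e₂, ← e₁, compl_fst])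
      omega
    · obtain rfl : k = n := by omega
      have hy : y = k := h.inj _ _ (by omega) h₃ hk0 hk (by
        rw [h.last] at e₂
        rw [← compl_fst (φ y), e₂, ← e₁, compl_fst])
      have h' := h.flip
      rw [show k + 1 - y = 1 by omega] at h'
      refine h'.prepend_unit hz (fun C => ?_)
      simp only [Nat.add_sub_cancel, e₁]
      exact hG C

end ChainForm

/-- Removing another clause could not make `F` satisfiable, as the empty clause would remain. -/
theorem IsMU.eq_of_empty_mem {F : ClauseSet V} (h : IsMU F) (he : ∅ ∈ F) : F = {∅} := by
  refine Finset.eq_singleton_iff_unique_mem.2 ⟨he, fun C hC => ?_⟩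
  by_contra hne
  obtain ⟨τ, hτ⟩ := h.2 C hC
  obtain ⟨z, hz, -⟩ := hτ ∅ (Finset.mem_erase.2 ⟨fun e => hne e.symm, he⟩)
  simp at hz

/-- Otherwise the variable occurs only as `¬z`. Take an assignment satisfying all clauses except one
that contains `¬z`, and change it so that `¬z` becomes true: no clause contains `z`, so nothing is
lost, and `F` would be satisfied. -/
theorem IsMU.exists_mem {F : ClauseSet V} (h : IsMU F) {z : Literal V} (hz : z.1 ∈ vars F) :
    ∃ C ∈ F, z ∈ C := by
  by_contra hno
  push Not at hno
  obtain ⟨C, hC, z', hz', e⟩ := mem_vars.1 hz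
  obtain ⟨τ, hτ⟩ := h.2 C hC
  have e' : z' = compl z := (fst_eq_iff.1 e).resolve_left fun e => hno C hC (e ▸ hz')
  refine h.1 ⟨Function.update τ z.1 (!z.2), fun D hD => ?_⟩
  by_cases hDC : D = C
  · exact ⟨z', hDC ▸ hz', by simp [e', compl]⟩
  · obtain ⟨u, hu, hu'⟩ := hτ D (Finset.mem_erase.2 ⟨hDC, hD⟩)
    refine ⟨u, hu, ?_⟩
    by_cases huz : u.1 = z.1
    · have : u = compl z := (fst_eq_iff.1 huz).resolve_left fun e => hno D hD (e ▸ hu)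
      simp [this, compl]
    · rw [Function.update_of_ne huz, hu']

theorem IsMU.litDegree_pos {F : ClauseSet V} (h : IsMU F) {z : Literal V} (hz : z.1 ∈ vars F) :
    0 < litDegree F z := by
  obtain ⟨C, hC, hzC⟩ := h.exists_mem hz
  exact Finset.card_pos.2 ⟨C, Finset.mem_filter.2 ⟨hC, hzC⟩⟩

/-- Both sides count the pairs of a clause and a literal in it. -/
theorem sum_litDegree (F : ClauseSet V) :
    ∑ v ∈ vars F, (litDegree F (v, true) + litDegree F (v, false)) = ∑ C ∈ F, C.card := by
  have h₁ : ∀ C ∈ F, C.card = ((lits F).filter fun z => z ∈ C).card := by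
    intro C hC
    congr 1
    ext z
    simp only [Finset.mem_filter, iff_and_self]
    intro hz
    exact (mem_lits_iff F z).2 ⟨C, hC, z, hz, rfl⟩
  rw [Finset.sum_congr rfl h₁]
  have := Finset.sum_card_bipartiteAbove_eq_sum_card_bipartiteBelow
    (fun (z : Literal V) (C : Finset (Literal V)) => z ∈ C) (s := lits F) (t := F)
  simp only [Finset.bipartiteAbove, Finset.bipartiteBelow] at this
  rw [← this, lits, Finset.sum_product]
  refine Finset.sum_congr rfl fun v _ => ?_
  simp [litDegree]

end Existence
end TwoMU

namespace TwoMU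

/-! ### Singular variables, resolution, and existence of the walk -/

section Existence

variable {V : Type} [DecidableEq V]

namespace IsTwoMUDefOne

variable {F : ClauseSet V}

theorem card_eq (h : IsTwoMUDefOne F) : F.card = (vars F).card + 1 := by
  have := h.2.2.2.1
  unfold deficiency at this
  omega

theorem empty_notMem (h : IsTwoMUDefOne F) : ∅ ∉ F := fun he =>
  h.2.2.2.2 (h.2.2.1.eq_of_empty_mem he)

theorem vars_nonempty (h : IsTwoMUDefOne F) : (vars F).Nonempty := by
  have hc := h.card_eq
  obtain ⟨C, hC⟩ : F.Nonempty := Finset.card_pos.1 (by omega)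
  obtain ⟨z, hz⟩ : C.Nonempty := Finset.nonempty_iff_ne_empty.2 fun e => h.empty_notMem (e ▸ hC)
  exact ⟨z.1, mem_vars.2 ⟨C, hC, z, hz, rfl⟩⟩

theorem card_image_fst (h : IsTwoMUDefOne F) {C : Finset (Literal V)} (hC : C ∈ F) :
    (C.image Prod.fst).card = C.card := by
  refine Finset.card_image_of_injOn fun z hz z' hz' e => ?_
  refine (fst_eq_iff.1 e).resolve_right fun e' => h.1 C hC z' hz' ?_
  exact e' ▸ hz

theorem image_fst_subset {C : Finset (Literal V)} (hC : C ∈ F) :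
    C.image Prod.fst ⊆ vars F := fun v hv => by
  obtain ⟨z, hz, rfl⟩ := Finset.mem_image.1 hv
  exact mem_vars.2 ⟨C, hC, z, hz, rfl⟩

theorem exists_unique_clause {z : Literal V} (hz : litDegree F z = 1) :
    ∃ C ∈ F, z ∈ C ∧ ∀ D ∈ F, z ∈ D → D = C := by
  obtain ⟨C, hC⟩ := Finset.card_eq_one.1 hz
  have hm : ∀ D, D ∈ F ∧ z ∈ D ↔ D = C := fun D => by
    rw [← Finset.mem_singleton, ← hC, Finset.mem_filter]
  exact ⟨C, ((hm C).2 rfl).1, ((hm C).2 rfl).2, fun D hD hz => (hm D).1 ⟨hD, hz⟩⟩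

/-- Some variable occurs once positively and once negatively. -/
theorem exists_singular (h : IsTwoMUDefOne F) :
    ∃ v ∈ vars F, litDegree F (v, true) = 1 ∧ litDegree F (v, false) = 1 := by
  by_contra hno
  push Not at hno
  have hdeg : ∀ v ∈ vars F, 3 ≤ litDegree F (v, true) + litDegree F (v, false) := by
    intro v hv
    have h₁ := h.2.2.1.litDegree_pos (z := (v, true)) hv
    have h₂ := h.2.2.1.litDegree_pos (z := (v, false)) hv
    have := hno v hv
    omega
  have hsum := sum_litDegree F
  -- If every variable occurs at least three times, then `3n ≤ ∑ |C| ≤ 2(n + 1)`, hence `n ≤ 2`.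
  have h3 : (vars F).card * 3 ≤ ∑ C ∈ F, C.card := by
    rw [← hsum, ← smul_eq_mul]
    exact Finset.card_nsmul_le_sum _ _ _ hdeg
  have h2 : ∑ C ∈ F, C.card ≤ F.card * 2 := by
    rw [← smul_eq_mul]
    exact Finset.sum_le_card_nsmul _ _ _ h.2.1
  have hcard := h.card_eq
  have hpos := Finset.card_pos.2 h.vars_nonempty
  have hle : ∀ C ∈ F, C.card ≤ (vars F).card := fun C hC => by
    rw [← h.card_image_fst hC]
    exact Finset.card_le_card (image_fst_subset hC)
  -- For `n = 1` the clauses have at most one literal, so there are at most two occurrences instead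
  -- of three.
  rcases Nat.lt_or_ge (vars F).card 2 with hlt | hge
  · have : ∑ C ∈ F, C.card ≤ F.card * 1 := by
      rw [← smul_eq_mul]
      exact Finset.sum_le_card_nsmul _ _ _ fun C hC => (hle C hC).trans (by omega)
    omega
  have hn : (vars F).card = 2 := by omega
  -- For `n = 2` equality holds throughout: there are three clauses, each with two literals, and so
  -- each contains both variables.
  have htwo : ∀ C ∈ F, C.card = 2 := by
    intro C hC
    by_contra hne
    have : ∑ C ∈ F, C.card < ∑ C ∈ F, 2 :=
      Finset.sum_lt_sum h.2.1 ⟨C, hC, lt_of_le_of_ne (h.2.1 C hC) hne⟩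
    simp only [Finset.sum_const, smul_eq_mul] at this
    omega
  have himg : ∀ C ∈ F, C.image Prod.fst = vars F := fun C hC =>
    Finset.eq_of_subset_of_card_le (image_fst_subset hC) (by
      rw [h.card_image_fst hC, htwo C hC, hn])
  have hmem : ∀ z : Literal V, z.1 ∈ vars F → ∀ C ∈ F, z ∈ C ∨ compl z ∈ C := by
    intro z hz C hC
    rw [← himg C hC] at hz
    obtain ⟨z', hz', e⟩ := Finset.mem_image.1 hz
    rcases fst_eq_iff.1 e with rfl | rfl
    · exact .inl hz'
    · exact .inr hz'
  obtain ⟨v, hv⟩ := h.vars_nonempty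
  have hF : F.card = litDegree F (v, true) + litDegree F (v, false) := by
    unfold litDegree
    rw [← Finset.card_union_of_disjoint]
    · congr 1
      ext C
      simp only [Finset.mem_union, Finset.mem_filter]
      constructor
      · intro hC
        exact (hmem (v, true) hv C hC).imp (fun h => ⟨hC, h⟩) (fun h => ⟨hC, h⟩)
      · rintro (h | h) <;> exact h.1
    · rw [Finset.disjoint_left]
      intro C h₁ h₂
      exact h.1 C (Finset.mem_filter.1 h₁).1 _ (Finset.mem_filter.1 h₁).2
        (Finset.mem_filter.1 h₂).2
  -- The variable `v` occurs in all three clauses, so one of its two literals occurs only once.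
  obtain ⟨b, hb⟩ : ∃ b, litDegree F (v, b) = 1 := by
    have := hdeg v hv
    have h₁ := h.2.2.1.litDegree_pos (z := (v, true)) hv
    have h₂ := h.2.2.1.litDegree_pos (z := (v, false)) hv
    by_cases h1 : litDegree F (v, true) = 1
    · exact ⟨true, h1⟩
    · exact ⟨false, by omega⟩
  obtain ⟨C, hC, hvC, huniq⟩ := exists_unique_clause hb
  obtain ⟨z, hz, hzv⟩ : ∃ z ∈ C, z ≠ (v, b) :=
    Finset.exists_mem_ne (by rw [htwo C hC]; omega) _
  have hzv' : z.1 ≠ v := fun e => by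
    rcases fst_eq_iff.1 (show z.1 = ((v, b) : Literal V).1 from e) with e | e
    · exact hzv e
    · exact h.1 C hC (v, b) hvC (e ▸ hz)
  -- Falsifying that literal satisfies all clauses but `C`, and `C` is satisfied by its other
  -- literal `z`, which has a different variable.
  refine h.2.2.1.1 ⟨Function.update (fun _ => z.2) v (!b), fun D hD => ?_⟩
  by_cases hDC : D = C
  · exact ⟨z, hDC ▸ hz, by rw [Function.update_of_ne hzv']⟩
  · have := (hmem (v, b) hv D hD).resolve_left fun h => hDC (huniq D hD h)
    exact ⟨_, this, by simp [compl]⟩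

/-- Resolution on a variable occurring once positively and once negatively. -/
theorem resolve (h : IsTwoMUDefOne F) {v : V} {C₁ C₂ : Finset (Literal V)} (h₁ : C₁ ∈ F)
    (h₂ : C₂ ∈ F) (hv₁ : (v, true) ∈ C₁) (hv₂ : (v, false) ∈ C₂)
    (hu₁ : ∀ D ∈ F, (v, true) ∈ D → D = C₁) (hu₂ : ∀ D ∈ F, (v, false) ∈ D → D = C₂)
    (hne : C₁.erase (v, true) ∪ C₂.erase (v, false) ≠ ∅) :
    let R := C₁.erase (v, true) ∪ C₂.erase (v, false)
    let G := (F.erase C₁).erase C₂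
    R ∉ G ∧ IsTwoMUDefOne (insert R G) ∧ v ∉ vars (insert R G) ∧
      (vars F).card = (vars (insert R G)).card + 1 := by
  intro R G
  have h12 : C₁ ≠ C₂ := fun e => h.1 C₁ h₁ _ hv₁ (by rw [e]; exact hv₂)
  have hGF : ∀ D ∈ G, D ∈ F ∧ D ≠ C₁ ∧ D ≠ C₂ := fun D hD => by
    have h' := Finset.mem_erase.1 hD
    have h'' := Finset.mem_erase.1 h'.2
    exact ⟨h''.2, h''.1, h'.1⟩
  have hFG : ∀ D ∈ F, D ≠ C₁ → D ≠ C₂ → D ∈ G := fun D hD hD₁ hD₂ =>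
    Finset.mem_erase.2 ⟨hD₂, Finset.mem_erase.2 ⟨hD₁, hD⟩⟩
  have hvG : ∀ D ∈ G, ∀ z ∈ D, z.1 ≠ v := by
    rintro D hD ⟨v', b⟩ hz rfl
    obtain ⟨hD, hD₁, hD₂⟩ := hGF D hD
    cases b
    · exact hD₂ (hu₂ D hD hz)
    · exact hD₁ (hu₁ D hD hz)
  have hvR : ∀ z ∈ R, z.1 ≠ v := by
    rintro ⟨v', b⟩ hz rfl
    rcases Finset.mem_union.1 hz with hz | hz <;> obtain ⟨hz₁, hz₂⟩ := Finset.mem_erase.1 hz <;>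
      cases b
    · exact h.1 C₁ h₁ _ hv₁ hz₂
    · exact hz₁ rfl
    · exact hz₁ rfl
    · exact h.1 C₂ h₂ _ hv₂ hz₂
  have hsatR : ∀ τ : V → Bool, (∃ z ∈ C₁, τ z.1 = z.2) → (∃ z ∈ C₂, τ z.1 = z.2) →
      ∃ z ∈ R, τ z.1 = z.2 := by
    rintro τ ⟨z₁, hz₁, e₁⟩ ⟨z₂, hz₂, e₂⟩
    by_cases hv : z₁ = (v, true)
    · refine ⟨z₂, Finset.mem_union_right _ (Finset.mem_erase.2 ⟨?_, hz₂⟩), e₂⟩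
      rintro rfl
      rw [hv] at e₁
      simp only at e₁ e₂
      simp [e₁] at e₂
    · exact ⟨z₁, Finset.mem_union_left _ (Finset.mem_erase.2 ⟨hv, hz₁⟩), e₁⟩
  -- The true literal of the resolvent takes care of one parent clause, and the value of `v` can be
  -- chosen for the other.
  have hsatF : ∀ τ : V → Bool, (∃ z ∈ R, τ z.1 = z.2) → ∃ b,
      (∃ z ∈ C₁, Function.update τ v b z.1 = z.2) ∧ ∃ z ∈ C₂, Function.update τ v b z.1 = z.2 := by
    rintro τ ⟨z, hz, e⟩
    have hzv := hvR z hz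
    rcases Finset.mem_union.1 hz with hz | hz
    · exact ⟨false, ⟨z, Finset.mem_of_mem_erase hz, by rw [Function.update_of_ne hzv, e]⟩,
        _, hv₂, by simp⟩
    · exact ⟨true, ⟨_, hv₁, by simp⟩, z, Finset.mem_of_mem_erase hz, by
        rw [Function.update_of_ne hzv, e]⟩
  have hunsat : ¬ Satisfiable (insert R G) := by
    rintro ⟨τ, hτ⟩
    obtain ⟨b, hb₁, hb₂⟩ := hsatF τ (hτ R (Finset.mem_insert_self _ _))
    refine h.2.2.1.1 ⟨Function.update τ v b, fun D hD => ?_⟩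
    by_cases hD₁ : D = C₁
    · exact hD₁ ▸ hb₁
    by_cases hD₂ : D = C₂
    · exact hD₂ ▸ hb₂
    have hDG := hFG D hD hD₁ hD₂
    obtain ⟨z, hz, e⟩ := hτ D (Finset.mem_insert_of_mem hDG)
    exact ⟨z, hz, by rw [Function.update_of_ne (hvG D hDG z hz), e]⟩
  have hGsat : Satisfiable G := by
    obtain ⟨τ, hτ⟩ := h.2.2.1.2 C₁ h₁
    exact ⟨τ, fun D hD => hτ D (Finset.mem_of_mem_erase hD)⟩
  -- Otherwise the new clause-set would be `G`, which is satisfiable as a proper subset of `F`.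
  have hRG : R ∉ G := fun hR => hunsat (by rwa [Finset.insert_eq_of_mem hR])
  have hmin : ∀ D ∈ insert R G, Satisfiable ((insert R G).erase D) := by
    intro D hD
    rcases Finset.mem_insert.1 hD with rfl | hDG
    · rwa [Finset.erase_insert hRG]
    · obtain ⟨hDF, hD₁, hD₂⟩ := hGF D hDG
      obtain ⟨τ, hτ⟩ := h.2.2.1.2 D hDF
      refine ⟨τ, fun E hE => ?_⟩
      obtain ⟨hED, hE⟩ := Finset.mem_erase.1 hE
      rcases Finset.mem_insert.1 hE with rfl | hEG
      · exact hsatR τ (hτ C₁ (Finset.mem_erase.2 ⟨hD₁.symm, h₁⟩))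
          (hτ C₂ (Finset.mem_erase.2 ⟨hD₂.symm, h₂⟩))
      · exact hτ E (Finset.mem_erase.2 ⟨hED, (hGF E hEG).1⟩)
  -- A tautological resolvent would be satisfied by the assignment that satisfies `G`.
  have hRtaut : ∀ z ∈ R, compl z ∉ R := by
    intro z hz hz'
    obtain ⟨τ, hτ⟩ := hGsat
    refine hunsat ⟨τ, fun D hD => ?_⟩
    rcases Finset.mem_insert.1 hD with rfl | hD
    · by_cases hh : Holds τ z
      · exact ⟨z, hz, hh⟩
      · exact ⟨compl z, hz', holds_compl.2 hh⟩
    · exact hτ D hD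
  have hvars : vars F = insert v (vars (insert R G)) := by
    ext u
    simp only [Finset.mem_insert, mem_vars]
    constructor
    · rintro ⟨D, hD, z, hz, rfl⟩
      by_cases hzv : z.1 = v
      · exact .inl hzv
      refine .inr ?_
      have hzt : ∀ b, z ≠ (v, b) := fun b e => hzv (by rw [e])
      by_cases hD₁ : D = C₁
      · exact ⟨R, .inl rfl, z, Finset.mem_union_left _ (Finset.mem_erase.2 ⟨hzt _, hD₁ ▸ hz⟩), rfl⟩
      by_cases hD₂ : D = C₂
      · exact ⟨R, .inl rfl, z, Finset.mem_union_right _ (Finset.mem_erase.2 ⟨hzt _, hD₂ ▸ hz⟩), rfl⟩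
      exact ⟨D, .inr (hFG D hD hD₁ hD₂), z, hz, rfl⟩
    · rintro (rfl | ⟨D, rfl | hD, z, hz, rfl⟩)
      · exact ⟨C₁, h₁, _, hv₁, rfl⟩
      · rcases Finset.mem_union.1 hz with hz | hz
        · exact ⟨C₁, h₁, z, Finset.mem_of_mem_erase hz, rfl⟩
        · exact ⟨C₂, h₂, z, Finset.mem_of_mem_erase hz, rfl⟩
      · exact ⟨D, (hGF D hD).1, z, hz, rfl⟩
  have hvnot : v ∉ vars (insert R G) := by
    rw [mem_vars]
    rintro ⟨D, hD, z, hz, e⟩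
    rcases Finset.mem_insert.1 hD with rfl | hD
    · exact hvR z hz e
    · exact hvG D hD z hz e
  have hcv : (vars F).card = (vars (insert R G)).card + 1 := by
    rw [hvars, Finset.card_insert_of_notMem hvnot]
  have hcF : F.card = (insert R G).card + 1 := by
    rw [Finset.card_insert_of_notMem hRG]
    have e₁ := Finset.card_erase_of_mem h₁
    have e₂ := Finset.card_erase_of_mem (Finset.mem_erase.2 ⟨h12.symm, h₂⟩)
    have : 0 < (F.erase C₁).card := Finset.card_pos.2 ⟨_, Finset.mem_erase.2 ⟨h12.symm, h₂⟩⟩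
    have e₃ : G.card = ((F.erase C₁).erase C₂).card := rfl
    omega
  refine ⟨hRG, ⟨?_, ?_, ⟨hunsat, hmin⟩, ?_, ?_⟩, hvnot, hcv⟩
  · intro D hD
    rcases Finset.mem_insert.1 hD with rfl | hD
    · exact hRtaut
    · exact h.1 D (hGF D hD).1
  · intro D hD
    rcases Finset.mem_insert.1 hD with rfl | hD
    · have e₁ := Finset.card_erase_of_mem hv₁
      have e₂ := Finset.card_erase_of_mem hv₂
      have e₃ := h.2.1 C₁ h₁
      have e₄ := h.2.1 C₂ h₂
      exact (Finset.card_union_le _ _).trans (by omega)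
    · exact h.2.1 D (hGF D hD).1
  · have := h.card_eq
    unfold deficiency
    omega
  · intro e
    have : R ∈ ({∅} : ClauseSet V) := e ▸ Finset.mem_insert_self _ _
    exact hne (Finset.mem_singleton.1 this)

/-- Induction on the number of variables: resolve on a singular variable, and insert it again into
the walk of the smaller clause-set. -/
theorem exists_chainForm (h : IsTwoMUDefOne F) :
    ∃ x y φ, ChainForm F (vars F).card x y φ := by
  obtain ⟨n, hn⟩ : ∃ n, (vars F).card = n := ⟨_, rfl⟩
  induction n generalizing F with
  | zero =>
    have := Finset.card_pos.2 h.vars_nonempty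
    omega
  | succ n ih =>
    obtain ⟨v, hv, hd₁, hd₂⟩ := h.exists_singular
    obtain ⟨C₁, h₁, hv₁, hu₁⟩ := exists_unique_clause hd₁
    obtain ⟨C₂, h₂, hv₂, hu₂⟩ := exists_unique_clause hd₂
    have h12 : C₁ ≠ C₂ := fun e => h.1 C₁ h₁ _ hv₁ (by rw [e]; exact hv₂)
    set A := C₁.erase (v, true) with hA
    set B := C₂.erase (v, false) with hB
    have eA : C₁ = insert (v, true) A := (Finset.insert_erase hv₁).symm
    have eB : C₂ = insert (v, false) B := (Finset.insert_erase hv₂).symm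
    by_cases hR : A ∪ B = ∅
    -- With an empty resolvent the parents are `{v}` and `{¬v}`. They are already unsatisfiable, so
    -- by minimality there are no other clauses.
    · obtain ⟨hA0, hB0⟩ := Finset.union_eq_empty.1 hR
      rw [hA0] at eA
      rw [hB0] at eB
      have hF : F = {C₁, C₂} := by
        by_contra hne
        obtain ⟨D, hD, hDn⟩ : ∃ D ∈ F, D ∉ ({C₁, C₂} : ClauseSet V) := by
          by_contra hno
          push Not at hno
          refine hne (Finset.Subset.antisymm hno ?_)
          intro D hD
          rcases Finset.mem_insert.1 hD with rfl | hD
          · exact h₁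
          · exact (Finset.mem_singleton.1 hD) ▸ h₂
        simp only [Finset.mem_insert, Finset.mem_singleton, not_or] at hDn
        obtain ⟨τ, hτ⟩ := h.2.2.1.2 D hD
        obtain ⟨z, hz, e⟩ := hτ C₁ (Finset.mem_erase.2 ⟨fun e => hDn.1 e.symm, h₁⟩)
        obtain ⟨z', hz', e'⟩ := hτ C₂ (Finset.mem_erase.2 ⟨fun e => hDn.2 e.symm, h₂⟩)
        simp only [eA, eB, insert_empty_eq, Finset.mem_singleton] at hz hz'
        subst hz hz'
        simp only at e e'
        simp [e] at e'
      have hn1 : (vars F).card = 1 := by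
        have := h.card_eq
        rw [hF, Finset.card_pair h12] at this
        rw [hF]
        omega
      -- The walk is `¬v → v → ¬v`.
      refine ⟨1, 1, fun k => if k = 1 then (v, true) else (v, false), le_rfl, le_rfl, by omega,
        fun j k _ _ _ _ _ => by omega, by simp [compl], by simp [hn1, compl], ?_⟩
      rw [hn1, hF, eA, eB]
      ext C
      simp [Finset.range_add_one, compl]
      tauto
    · obtain ⟨hRG, hF', hv', hcv⟩ := h.resolve h₁ h₂ hv₁ hv₂ hu₁ hu₂ hR
      rw [← hA, ← hB] at hRG hF' hv' hcv
      set G := (F.erase C₁).erase C₂ with hG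
      set R := A ∪ B with hRdef
      obtain ⟨x, y, φ, hφ⟩ := ih hF' (by omega)
      rw [hcv]
      have hRF : R ∈ insert R G := Finset.mem_insert_self _ _
      have hFmem : ∀ C, C ∈ F ↔ (C ∈ insert R G ∧ C ≠ R) ∨ C = C₁ ∨ C = C₂ := by
        intro C
        have h0 : C ∈ insert R G ∧ C ≠ R ↔ C ∈ G := by
          rw [Finset.mem_insert]
          constructor
          · rintro ⟨h | h, hn⟩
            · exact absurd h hn
            · exact h
          · exact fun h => ⟨.inr h, fun e => hRG (e ▸ h)⟩
        rw [h0, hG, Finset.mem_erase, Finset.mem_erase]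
        constructor
        · intro hC
          tauto
        · rintro (h | rfl | rfl)
          exacts [h.2.2, h₁, h₂]
      have hcA : A.card ≤ 1 := by
        have := h.2.1 C₁ h₁
        rw [hA, Finset.card_erase_of_mem hv₁]
        omega
      have hcB : B.card ≤ 1 := by
        have := h.2.1 C₂ h₂
        rw [hB, Finset.card_erase_of_mem hv₂]
        omega
      have hA' : A = ∅ ∨ ∃ a, A = {a} := by
        rcases A.eq_empty_or_nonempty with h | ⟨a, ha⟩
        · exact .inl h
        · exact .inr ⟨a, Finset.eq_singleton_iff_unique_mem.2 ⟨ha, fun b hb =>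
            Finset.card_le_one.1 hcA b hb a ha⟩⟩
      have hB' : B = ∅ ∨ ∃ a, B = {a} := by
        rcases B.eq_empty_or_nonempty with h | ⟨a, ha⟩
        · exact .inl h
        · exact .inr ⟨a, Finset.eq_singleton_iff_unique_mem.2 ⟨ha, fun b hb =>
            Finset.card_le_one.1 hcB b hb a ha⟩⟩
      have hcompl : compl ((v, true) : Literal V) = (v, false) := rfl
      have hcompl' : compl ((v, false) : Literal V) = (v, true) := rfl
      suffices hs : ∃ x' y' ψ, ChainForm F ((vars (insert R G)).card + 1) x' y' ψ from hs
      rcases hA' with hA0 | ⟨a, ha⟩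
      · rcases hB' with hB0 | ⟨b, hb⟩
        · exact absurd (by rw [hRdef, hA0, hB0]; rfl) hR
        · have eR : R = {b} := by rw [hRdef, hA0, hb, Finset.empty_union]
          refine hφ.split_unit (z := (v, true)) (a := b) hv' (eR ▸ hRF) fun C => ?_
          rw [hFmem, eA, eB, hA0, hb, hcompl, eR]
          simp
      · rcases hB' with hB0 | ⟨b, hb⟩
        · have eR : R = {a} := by rw [hRdef, hB0, ha, Finset.union_empty]
          refine hφ.split_unit (z := (v, false)) (a := a) hv' (eR ▸ hRF) fun C => ?_
          rw [hFmem, eA, eB, hB0, ha, hcompl', eR]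
          simp only [insert_empty_eq]
          tauto
        · have eR : R = {a, b} := by rw [hRdef, ha, hb]; rfl
          -- The new variable subdivides step `k`. Possibly `a = b`, when both parents contain `a`;
          -- the subdivided step is then `¬a → a`.
          obtain ⟨k, hk, ek⟩ := (hφ.mem_iff R).1 hRF
          have hab : (a = compl (φ k) ∧ b = φ (k + 1)) ∨ (b = compl (φ k) ∧ a = φ (k + 1)) := by
            have ha' : a ∈ ({compl (φ k), φ (k + 1)} : Finset (Literal V)) := by simp [ek, eR]
            have hb' : b ∈ ({compl (φ k), φ (k + 1)} : Finset (Literal V)) := by simp [ek, eR]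
            have hc' : compl (φ k) ∈ ({a, b} : Finset (Literal V)) := by simp [← eR, ← ek]
            have hd' : φ (k + 1) ∈ ({a, b} : Finset (Literal V)) := by simp [← eR, ← ek]
            simp only [Finset.mem_insert, Finset.mem_singleton] at ha' hb' hc' hd'
            rcases ha' with ha' | ha' <;> rcases hb' with hb' | hb'
            · exact .inl ⟨ha', hb'.trans (ha'.symm.trans (by
                rcases hd' with e | e
                · exact e.symm
                · exact ha'.trans (hb'.symm.trans e.symm)))⟩
            · exact .inl ⟨ha', hb'⟩
            · exact .inr ⟨hb', ha'⟩
            · exact .inr ⟨hb'.trans (ha'.symm.trans (by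
                rcases hc' with e | e
                · exact e.symm
                · exact ha'.trans (hb'.symm.trans e.symm))), ha'⟩
          rcases hab with ⟨hak, hbk⟩ | ⟨hbk, hak⟩
          · refine hφ.subdivide hk (z := (v, true)) hv' fun C => ?_
            rw [hFmem, eA, eB, ha, hb, hcompl, ← ek, hak, hbk,
              Finset.pair_comm (v, true) (compl (φ k))]
          · refine hφ.subdivide hk (z := (v, false)) hv' fun C => ?_
            rw [hFmem, eA, eB, ha, hb, hcompl', ← ek, hak, hbk, Finset.pair_comm (v, false)]
            tauto

end IsTwoMUDefOne

end Existence
end TwoMU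

namespace TwoMU

/-! ### Combinatorial form of the implication graphs -/

section GraphForms

/-- Explicit form of the implication graphs: two chains `φ true` and `φ false` of length `n`, each
of which is continued at both ends by vertices of the other one. -/
structure GraphForm {α : Type} (vert : α → Prop) (adj : α → α → Prop) (n x y : ℕ)
    (φ : Bool → ℕ → α) : Prop where
  one_le : 1 ≤ x
  le : x ≤ y
  le_size : y ≤ n
  inj : ∀ s t j k, 1 ≤ j → j ≤ n → 1 ≤ k → k ≤ n → φ s j = φ t k → s = t ∧ j = k
  first : ∀ s, φ s 0 = φ (!s) x
  last : ∀ s, φ s (n + 1) = φ (!s) y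
  vert_iff : ∀ a, vert a ↔ ∃ s k, 1 ≤ k ∧ k ≤ n ∧ φ s k = a
  adj_iff : ∀ a b, adj a b ↔ ∃ s k, k ≤ n ∧
    (φ s k = a ∧ φ s (k + 1) = b ∨ φ s k = b ∧ φ s (k + 1) = a)

/-- A vertex with three distinct neighbours. -/
def Branch {α : Type} (adj : α → α → Prop) (a : α) : Prop :=
  ∃ b c d, adj a b ∧ adj a c ∧ adj a d ∧ b ≠ c ∧ b ≠ d ∧ c ≠ d

open Classical in
/-- One step of the walk that avoids turning back. -/
noncomputable def walkStep (adj : ℕ → ℕ → Prop) (N : ℕ) (q : ℕ × ℕ) : ℕ × ℕ :=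
  (q.2, Nat.count (fun u => ∃ z < N, adj q.2 z ∧ z ≠ q.1 ∧ u < z) N)

/-- The walk that starts with `a`, `b` and avoids turning back. -/
noncomputable def walk (adj : ℕ → ℕ → Prop) (N a b k : ℕ) : ℕ := ((walkStep adj N)^[k] (a, b)).1

/-- The walk starting with `a`, `b` reaches its first branching vertex after `L` steps. -/
def FirstBranch (adj : ℕ → ℕ → Prop) (N a b L : ℕ) : Prop :=
  1 ≤ L ∧ Branch adj (walk adj N a b L) ∧ ∀ k < L, 1 ≤ k → ¬ Branch adj (walk adj N a b k)

/-- Two walks from a branching vertex reach their first branching vertices after `L` steps. -/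
def TwinWalks (adj : ℕ → ℕ → Prop) (N L : ℕ) : Prop :=
  ∃ a b c, Branch adj a ∧ adj a b ∧ adj a c ∧ b ≠ c ∧
    FirstBranch adj N a b L ∧ FirstBranch adj N a c L

/-- There is a vertex with four neighbours, or there are three branching vertices. -/
def ManyBranches {α : Type} (adj : α → α → Prop) : Prop :=
  (∃ a b c d e, adj a b ∧ adj a c ∧ adj a d ∧ adj a e ∧
    b ≠ c ∧ b ≠ d ∧ b ≠ e ∧ c ≠ d ∧ c ≠ e ∧ d ≠ e) ∨
  ∃ a b c, Branch adj a ∧ Branch adj b ∧ Branch adj c ∧ a ≠ b ∧ a ≠ c ∧ b ≠ c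

namespace GraphForm

variable {α : Type} {vert : α → Prop} {adj : α → α → Prop} {n x y : ℕ} {φ : Bool → ℕ → α}

theorem inj_iff (h : GraphForm vert adj n x y φ) {s t : Bool} {j k : ℕ} (hj : 1 ≤ j) (hj' : j ≤ n)
    (hk : 1 ≤ k) (hk' : k ≤ n) : φ s j = φ t k ↔ s = t ∧ j = k :=
  ⟨h.inj s t j k hj hj' hk hk', by rintro ⟨rfl, rfl⟩; rfl⟩

theorem vert_apply (h : GraphForm vert adj n x y φ) {s : Bool} {j : ℕ} (hj : j ≤ n + 1) :
    vert (φ s j) := by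
  have h₁ := h.one_le
  have h₂ := h.le
  have h₃ := h.le_size
  rcases Nat.eq_zero_or_pos j with rfl | hj0
  · exact (h.vert_iff _).2 ⟨!s, x, by omega, by omega, (h.first s).symm⟩
  rcases Nat.lt_or_ge n j with hn | hn
  · obtain rfl : j = n + 1 := by omega
    exact (h.vert_iff _).2 ⟨!s, y, by omega, by omega, (h.last s).symm⟩
  · exact (h.vert_iff _).2 ⟨s, j, hj0, hn, rfl⟩

theorem adj_symm (h : GraphForm vert adj n x y φ) {a b : α} (hab : adj a b) : adj b a := by
  obtain ⟨s, k, hk, e⟩ := (h.adj_iff a b).1 hab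
  exact (h.adj_iff b a).2 ⟨s, k, hk, e.symm⟩

theorem vert_of_adj (h : GraphForm vert adj n x y φ) {a b : α} (hab : adj a b) : vert a := by
  obtain ⟨s, k, hk, ⟨rfl, -⟩ | ⟨-, rfl⟩⟩ := (h.adj_iff a b).1 hab
  exacts [h.vert_apply (by omega), h.vert_apply (by omega)]

theorem adj_succ (h : GraphForm vert adj n x y φ) (s : Bool) {j : ℕ} (hj : j ≤ n) :
    adj (φ s j) (φ s (j + 1)) := (h.adj_iff _ _).2 ⟨s, j, hj, .inl ⟨rfl, rfl⟩⟩

/-- The neighbours of the vertices of the chains. -/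
theorem adj_apply_iff (h : GraphForm vert adj n x y φ) {s : Bool} {j : ℕ} (hj : 1 ≤ j)
    (hj' : j ≤ n) (b : α) : adj (φ s j) b ↔
      b = φ s (j - 1) ∨ b = φ s (j + 1) ∨ (j = x ∧ b = φ (!s) 1) ∨ (j = y ∧ b = φ (!s) n) := by
  have h₁ := h.one_le
  have h₂ := h.le
  have h₃ := h.le_size
  constructor
  · intro hb
    obtain ⟨t, k, hk, ⟨e, rfl⟩ | ⟨rfl, e⟩⟩ := (h.adj_iff _ _).1 hb
    · rcases Nat.eq_zero_or_pos k with rfl | hk0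
      · rw [h.first] at e
        obtain ⟨rfl, rfl⟩ := h.inj _ _ _ _ h₁ (by omega) hj hj' e
        exact .inr (.inr (.inl ⟨rfl, by simp⟩))
      · obtain ⟨rfl, rfl⟩ := h.inj _ _ _ _ hk0 hk hj hj' e
        exact .inr (.inl rfl)
    · rcases Nat.lt_or_ge k n with hkn | hkn
      · obtain ⟨rfl, rfl⟩ := h.inj _ _ _ _ (by omega) hkn hj hj' e
        exact .inl rfl
      · obtain rfl : k = n := by omega
        rw [h.last] at e
        obtain ⟨rfl, rfl⟩ := h.inj _ _ _ _ (by omega) h₃ hj hj' e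
        exact .inr (.inr (.inr ⟨rfl, by simp⟩))
  · rintro (rfl | rfl | ⟨rfl, rfl⟩ | ⟨rfl, rfl⟩)
    · have := h.adj_succ s (j := j - 1) (by omega)
      rw [Nat.sub_add_cancel hj] at this
      exact h.adj_symm this
    · exact h.adj_succ s hj'
    · have := h.adj_succ (!s) (j := 0) (by omega)
      rwa [h.first, Bool.not_not] at this
    · have := h.adj_succ (!s) (j := n) le_rfl
      rw [h.last, Bool.not_not] at this
      exact h.adj_symm this

/-- The additional neighbour `φ (!s) 1` of `φ s x` is the predecessor `φ s 0` if `x = 1`, and a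
third neighbour otherwise. Likewise `φ (!s) n` is a third neighbour of `φ s y` unless `y = n`. -/
theorem branch_iff (h : GraphForm vert adj n x y φ) {s : Bool} {j : ℕ} (hj : 1 ≤ j)
    (hj' : j ≤ n) : Branch adj (φ s j) ↔ (j = x ∧ 2 ≤ x) ∨ (j = y ∧ y < n) := by
  have h₁ := h.one_le
  have h₂ := h.le
  have h₃ := h.le_size
  constructor
  · rintro ⟨b, c, d, hb, hc, hd, hbc, hbd, hcd⟩
    by_contra hno
    have key : ∀ b, adj (φ s j) b → b = φ s (j - 1) ∨ b = φ s (j + 1) := by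
      intro b hb
      rcases (h.adj_apply_iff hj hj' b).1 hb with e | e | ⟨rfl, e⟩ | ⟨rfl, e⟩
      · exact .inl e
      · exact .inr e
      · obtain rfl : j = 1 := by omega
        exact .inl (by rw [e, h.first])
      · obtain rfl : j = n := by omega
        exact .inr (by rw [e, h.last])
    rcases key b hb with eb | eb <;> rcases key c hc with ec | ec <;>
      rcases key d hd with ed | ed
    all_goals first
      | exact hbc (eb.trans ec.symm)
      | exact hbd (eb.trans ed.symm)
      | exact hcd (ec.trans ed.symm)
  · rintro (⟨rfl, hx⟩ | ⟨rfl, hy⟩)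
    · refine ⟨φ s (j - 1), φ s (j + 1), φ (!s) 1, (h.adj_apply_iff hj hj' _).2 (.inl rfl),
        (h.adj_apply_iff hj hj' _).2 (.inr (.inl rfl)),
        (h.adj_apply_iff hj hj' _).2 (.inr (.inr (.inl ⟨rfl, rfl⟩))), ?_, ?_, ?_⟩
      · rcases Nat.lt_or_ge j n with hjn | hjn
        · rw [Ne, h.inj_iff (by omega) (by omega) (by omega) (by omega)]
          omega
        · obtain rfl : j = n := by omega
          rw [h.last, Ne, h.inj_iff (by omega) (by omega) (by omega) (by omega)]
          simp
      · rw [Ne, h.inj_iff (by omega) (by omega) (by omega) (by omega)]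
        simp
      · rcases Nat.lt_or_ge j n with hjn | hjn
        · rw [Ne, h.inj_iff (by omega) (by omega) (by omega) (by omega)]
          simp
        · obtain rfl : j = n := by omega
          rw [h.last, Ne, h.inj_iff (by omega) (by omega) (by omega) (by omega)]
          omega
    · refine ⟨φ s (j - 1), φ s (j + 1), φ (!s) n, (h.adj_apply_iff hj hj' _).2 (.inl rfl),
        (h.adj_apply_iff hj hj' _).2 (.inr (.inl rfl)),
        (h.adj_apply_iff hj hj' _).2 (.inr (.inr (.inr ⟨rfl, rfl⟩))), ?_, ?_, ?_⟩
      · rcases Nat.lt_or_ge 1 j with hj1 | hj1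
        · rw [Ne, h.inj_iff (by omega) (by omega) (by omega) (by omega)]
          omega
        · obtain rfl : j = 1 := by omega
          rw [Nat.sub_self, h.first, Ne, h.inj_iff (by omega) (by omega) (by omega) (by omega)]
          simp
      · rcases Nat.lt_or_ge 1 j with hj1 | hj1
        · rw [Ne, h.inj_iff (by omega) (by omega) (by omega) (by omega)]
          simp
        · obtain rfl : j = 1 := by omega
          rw [Nat.sub_self, h.first, Ne, h.inj_iff (by omega) (by omega) (by omega) (by omega)]
          omega
      · rw [Ne, h.inj_iff (by omega) (by omega) (by omega) (by omega)]
        simp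

/-- Following a chain means not turning back. For `n = 1` this fails, since both neighbours of `φ s
1` on its chain are `φ (!s) 1`. -/
theorem pred_ne_succ (h : GraphForm vert adj n x y φ) (hn : 2 ≤ n) {s : Bool} {j : ℕ} (hj : 1 ≤ j)
    (hj' : j ≤ n) : φ s (j - 1) ≠ φ s (j + 1) := by
  have h₁ := h.one_le
  have h₂ := h.le
  have h₃ := h.le_size
  rcases Nat.lt_or_ge 1 j with h1 | h1
  · rcases Nat.lt_or_ge j n with h2 | h2
    · rw [Ne, h.inj_iff (by omega) (by omega) (by omega) (by omega)]
      omega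
    · obtain rfl : j = n := by omega
      rw [h.last, Ne, h.inj_iff (by omega) (by omega) (by omega) (by omega)]
      simp
  · obtain rfl : j = 1 := by omega
    rw [Nat.sub_self, h.first, Ne, h.inj_iff (by omega) (by omega) (by omega) (by omega)]
    simp

/-- If `x = 1`, then only the two vertices `φ s y` can branch, with at most three neighbours. If `x
≥ 2`, then `y < n` by normalisation: for `x < y` there are four branching vertices, and for `x = y`
two with four neighbours. -/
theorem manyBranches_iff (h : GraphForm vert adj n x y φ) (hxy : x + y ≤ n + 1) :
    ManyBranches adj ↔ 2 ≤ x := by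
  have h₁ := h.one_le
  have h₂ := h.le
  have h₃ := h.le_size
  constructor
  · intro hm
    by_contra hx
    obtain rfl : x = 1 := by omega
    rcases hm with ⟨a, b, c, d, e, hb, hc, hd, he, hbc, hbd, hbe, hcd, hce, hde⟩ |
      ⟨a, b, c, ha, hb, hc, hab, hac, hbc⟩
    · obtain ⟨s, j, hj, hj', rfl⟩ := (h.vert_iff a).1 (h.vert_of_adj hb)
      have key : ∀ b, adj (φ s j) b → b = φ s (j - 1) ∨ b = φ s (j + 1) ∨ b = φ (!s) n := by
        intro b hb
        rcases (h.adj_apply_iff hj hj' b).1 hb with e | e | ⟨rfl, e⟩ | ⟨rfl, e⟩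
        · exact .inl e
        · exact .inr (.inl e)
        · exact .inl (by rw [e, h.first])
        · exact .inr (.inr e)
      rcases key b hb with eb | eb | eb <;> rcases key c hc with ec | ec | ec <;>
        rcases key d hd with ed | ed | ed <;> rcases key e he with ee | ee | ee
      all_goals first
        | exact hbc (eb.trans ec.symm)
        | exact hbd (eb.trans ed.symm)
        | exact hcd (ec.trans ed.symm)
        | exact hbe (eb.trans ee.symm)
        | exact hce (ec.trans ee.symm)
        | exact hde (ed.trans ee.symm)
    · have key : ∀ a, Branch adj a → a = φ true y ∨ a = φ false y := by
        intro a ha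
        obtain ⟨s, j, hj, hj', rfl⟩ :=
          (h.vert_iff a).1 (h.vert_of_adj ha.choose_spec.choose_spec.choose_spec.1)
        rcases (h.branch_iff hj hj').1 ha with hb | ⟨rfl, -⟩
        · omega
        · cases s
          · exact .inr rfl
          · exact .inl rfl
      rcases key a ha with ea | ea <;> rcases key b hb with eb | eb <;>
        rcases key c hc with ec | ec
      all_goals first
        | exact hab (ea.trans eb.symm)
        | exact hac (ea.trans ec.symm)
        | exact hbc (eb.trans ec.symm)
  · intro hx
    rcases Nat.lt_or_ge x y with hlt | hge
    · refine .inr ⟨φ true x, φ false x, φ true y, (h.branch_iff h₁ (by omega)).2 (.inl ⟨rfl, hx⟩),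
        (h.branch_iff h₁ (by omega)).2 (.inl ⟨rfl, hx⟩),
        (h.branch_iff (by omega) h₃).2 (.inr ⟨rfl, by omega⟩), ?_, ?_, ?_⟩ <;>
      · rw [Ne, h.inj_iff (by omega) (by omega) (by omega) (by omega)]
        first | omega | simp
    · obtain rfl : x = y := by omega
      have hN := fun b => h.adj_apply_iff (s := true) h₁ h₃ b
      refine .inl ⟨φ true x, φ true (x - 1), φ true (x + 1), φ false 1, φ false n,
        (hN _).2 (.inl rfl), (hN _).2 (.inr (.inl rfl)), (hN _).2 (.inr (.inr (.inl ⟨rfl, rfl⟩))),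
        (hN _).2 (.inr (.inr (.inr ⟨rfl, rfl⟩))), ?_, ?_, ?_, ?_, ?_, ?_⟩ <;>
      · rw [Ne, h.inj_iff (by omega) (by omega) (by omega) (by omega)]
        first | omega | simp

theorem map {β : Type} {vert' : β → Prop} {adj' : β → β → Prop} (h : GraphForm vert adj n x y φ)
    (e : α → β) (he : ∀ a b, vert a → vert b → e a = e b → a = b)
    (hv : ∀ b, vert' b ↔ ∃ a, vert a ∧ e a = b)
    (ha : ∀ b b', adj' b b' ↔ ∃ a a', adj a a' ∧ e a = b ∧ e a' = b') :
    GraphForm vert' adj' n x y fun s k => e (φ s k) := by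
  refine ⟨h.one_le, h.le, h.le_size, fun s t j k hj hj' hk hk' q => h.inj s t j k hj hj' hk hk'
    (he _ _ (h.vert_apply (by omega)) (h.vert_apply (by omega)) q), fun s => by rw [h.first],
    fun s => by rw [h.last], fun b => ?_, fun b b' => ?_⟩
  · rw [hv]
    constructor
    · rintro ⟨a, hva, rfl⟩
      obtain ⟨s, k, hk, hk', rfl⟩ := (h.vert_iff a).1 hva
      exact ⟨s, k, hk, hk', rfl⟩
    · rintro ⟨s, k, hk, hk', rfl⟩
      exact ⟨_, (h.vert_iff _).2 ⟨s, k, hk, hk', rfl⟩, rfl⟩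
  · rw [ha]
    constructor
    · rintro ⟨a, a', haa, rfl, rfl⟩
      obtain ⟨s, k, hk, ⟨rfl, rfl⟩ | ⟨rfl, rfl⟩⟩ := (h.adj_iff a a').1 haa
      exacts [⟨s, k, hk, .inl ⟨rfl, rfl⟩⟩, ⟨s, k, hk, .inr ⟨rfl, rfl⟩⟩]
    · rintro ⟨s, k, hk, ⟨rfl, rfl⟩ | ⟨rfl, rfl⟩⟩
      · exact ⟨_, _, h.adj_succ s hk, rfl, rfl⟩
      · exact ⟨_, _, h.adj_symm (h.adj_succ s hk), rfl, rfl⟩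

end GraphForm

section Walks

/-- The number of `u` that lie below some admissible successor is the largest admissible successor.
Here `c` is the only one, so the counter returns `c`. -/
theorem walkStep_eq {adj : ℕ → ℕ → Prop} {N a b c : ℕ} (hc : c < N)
    (h : ∀ z, adj b z → z = a ∨ z = c) (hbc : adj b c) (hac : c ≠ a) :
    walkStep adj N (a, b) = (b, c) := by
  classical
  unfold walkStep
  refine Prod.ext rfl ?_
  have : ∀ u, (∃ z < N, adj b z ∧ z ≠ a ∧ u < z) ↔ u < c := by
    intro u
    constructor
    · rintro ⟨z, -, hz, hza, huz⟩
      rcases h z hz with rfl | rfl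
      · exact absurd rfl hza
      · exact huz
    · exact fun hu => ⟨c, hc, hbc, hac, hu⟩
  simp only [this]
  rw [Nat.count_eq_card_filter_range]
  have : (Finset.range N).filter (fun u => u < c) = Finset.range c := by
    ext u
    simp only [Finset.mem_filter, Finset.mem_range]
    omega
  rw [this, Finset.card_range]

/-- At an inner vertex with only two neighbours, the walk has no choice but to continue along `ψ`.
-/
theorem walk_eq {adj : ℕ → ℕ → Prop} {N L : ℕ} (ψ : ℕ → ℕ)
    (h : ∀ k, 1 ≤ k → k < L → ψ (k + 1) < N ∧
      (∀ z, adj (ψ k) z → z = ψ (k - 1) ∨ z = ψ (k + 1)) ∧ adj (ψ k) (ψ (k + 1)) ∧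
      ψ (k + 1) ≠ ψ (k - 1)) :
    ∀ k ≤ L, walk adj N (ψ 0) (ψ 1) k = ψ k := by
  have key : ∀ k < L, (walkStep adj N)^[k] (ψ 0, ψ 1) = (ψ k, ψ (k + 1)) := by
    intro k
    induction k with
    | zero => exact fun _ => rfl
    | succ k ih =>
      intro hk
      obtain ⟨q₁, q₂, q₃, q₄⟩ := h (k + 1) (by omega) hk
      rw [Function.iterate_succ_apply', ih (by omega)]
      exact walkStep_eq q₁ q₂ q₃ q₄
  intro k hk
  rcases Nat.lt_or_ge k L with hkL | hkL
  · unfold walk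
    rw [key k hkL]
  · obtain rfl : k = L := by omega
    rcases k with - | k
    · rfl
    · unfold walk
      rw [Function.iterate_succ_apply', key k (by omega)]
      rfl

theorem FirstBranch.unique {adj : ℕ → ℕ → Prop} {N a b L L' : ℕ} (h : FirstBranch adj N a b L)
    (h' : FirstBranch adj N a b L') : L = L' := by
  rcases Nat.lt_trichotomy L L' with hlt | rfl | hlt
  · exact absurd h.2.1 (h'.2.2 L hlt h.1)
  · rfl
  · exact absurd h'.2.1 (h.2.2 L' hlt h'.1)

end Walks

namespace GraphForm

variable {vert : ℕ → Prop} {adj : ℕ → ℕ → Prop} {n x y N : ℕ} {φ : Bool → ℕ → ℕ}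

theorem adj_of_not_branch (h : GraphForm vert adj n x y φ) {s : Bool} {j : ℕ} (hj : 1 ≤ j)
    (hj' : j ≤ n) (hb : ¬ ((j = x ∧ 2 ≤ x) ∨ (j = y ∧ y < n))) {z : ℕ} (hz : adj (φ s j) z) :
    z = φ s (j - 1) ∨ z = φ s (j + 1) := by
  rcases (h.adj_apply_iff hj hj' z).1 hz with e | e | ⟨rfl, e⟩ | ⟨rfl, e⟩
  · exact .inl e
  · exact .inr e
  · have := h.one_le
    obtain rfl : j = 1 := by omega
    exact .inl (by rw [e, h.first])
  · have := h.le_size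
    obtain rfl : j = n := by omega
    exact .inr (by rw [e, h.last])

/-- No inner vertex of the stretch from `a` to `a + L` branches, so the walk follows the chain. The
values `a = 0` and `a + L = n + 1` are allowed; there the stretch begins or ends on the other chain.
-/
theorem firstBranch_up (h : GraphForm vert adj n x y φ) (hN : ∀ a, vert a → a < N) (hn : 2 ≤ n)
    {s : Bool} {a L : ℕ} (hL : 1 ≤ L) (haL : a + L ≤ n + 1)
    (hb : ∀ j, a < j → j < a + L → ¬ ((j = x ∧ 2 ≤ x) ∨ (j = y ∧ y < n)))
    (he : Branch adj (φ s (a + L))) : FirstBranch adj N (φ s a) (φ s (a + 1)) L := by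
  have key := walk_eq (adj := adj) (N := N) (L := L) (fun k => φ s (a + k)) (by
    intro k hk hkL
    refine ⟨hN _ (h.vert_apply (by omega)), fun z hz => ?_, h.adj_succ s (by omega), ?_⟩
    · have := h.adj_of_not_branch (by omega) (by omega) (hb (a + k) (by omega) (by omega)) hz
      rwa [Nat.add_sub_assoc hk] at this
    · have := h.pred_ne_succ hn (s := s) (j := a + k) (by omega) (by omega)
      rw [Nat.add_sub_assoc hk] at this
      exact this.symm)
  simp only [Nat.add_zero] at key
  refine ⟨hL, by rwa [key L le_rfl], fun k hk hk1 => ?_⟩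
  rw [key k hk.le, h.branch_iff (by omega) (by omega)]
  exact hb _ (by omega) (by omega)

theorem firstBranch_down (h : GraphForm vert adj n x y φ) (hN : ∀ a, vert a → a < N) (hn : 2 ≤ n)
    {s : Bool} {b L : ℕ} (hL : 1 ≤ L) (hLb : L ≤ b) (hbn : b ≤ n + 1)
    (hb : ∀ j, b - L < j → j < b → ¬ ((j = x ∧ 2 ≤ x) ∨ (j = y ∧ y < n)))
    (he : Branch adj (φ s (b - L))) : FirstBranch adj N (φ s b) (φ s (b - 1)) L := by
  have key := walk_eq (adj := adj) (N := N) (L := L) (fun k => φ s (b - k)) (by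
    intro k hk hkL
    have e₁ : b - (k - 1) = b - k + 1 := by omega
    have e₂ : b - (k + 1) = b - k - 1 := by omega
    simp only [e₁, e₂]
    refine ⟨hN _ (h.vert_apply (by omega)), fun z hz => ?_, ?_, ?_⟩
    · exact (h.adj_of_not_branch (by omega) (by omega) (hb (b - k) (by omega) (by omega)) hz).symm
    · exact (h.adj_apply_iff (by omega) (by omega) _).2 (.inl rfl)
    · exact h.pred_ne_succ hn (s := s) (j := b - k) (by omega) (by omega))
  simp only [Nat.sub_zero] at key
  refine ⟨hL, by rwa [key L le_rfl], fun k hk hk1 => ?_⟩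
  rw [key k hk.le, h.branch_iff (by omega) (by omega)]
  exact hb _ (by omega) (by omega)

/-- If `x ≥ 2`, then descending the one chain from `φ s x` to `φ s 0 = φ (!s) x`, and ascending the
other one from `φ (!s) 0 = φ s x` to `φ (!s) x`, both take `x` steps. At the upper ends the length
is `n + 1 - y`. No other lengths arise: of two different edges at a branching vertex, at least one
belongs to such a pair. -/
theorem twinWalks_iff (h : GraphForm vert adj n x y φ) (hN : ∀ a, vert a → a < N) (L : ℕ) :
    TwinWalks adj N L ↔ (L = x ∧ 2 ≤ x) ∨ (L + y = n + 1 ∧ y < n) := by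
  have h₁ := h.one_le
  have h₂ := h.le
  have h₃ := h.le_size
  have A₁ : ∀ s, 2 ≤ x → FirstBranch adj N (φ s x) (φ s (x - 1)) x := fun s hx =>
    h.firstBranch_down hN (by omega) h₁ le_rfl (by omega) (fun j hj hj' => by omega) (by
      rw [Nat.sub_self, h.first, h.branch_iff h₁ (by omega)]
      exact .inl ⟨rfl, hx⟩)
  have A₂ : ∀ s, 2 ≤ x → FirstBranch adj N (φ s x) (φ (!s) 1) x := fun s hx => by
    have := h.firstBranch_up hN (by omega) (s := !s) (a := 0) (L := x) h₁ (by omega)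
      (fun j hj hj' => by omega) (by
        rw [Nat.zero_add, h.branch_iff h₁ (by omega)]
        exact .inl ⟨rfl, hx⟩)
    rwa [h.first, Bool.not_not] at this
  have B₁ : ∀ s, y < n → FirstBranch adj N (φ s y) (φ s (y + 1)) (n + 1 - y) := fun s hy =>
    h.firstBranch_up hN (by omega) (by omega) (by omega) (fun j hj hj' => by omega) (by
      rw [show y + (n + 1 - y) = n + 1 by omega, h.last, h.branch_iff (by omega) (by omega)]
      exact .inr ⟨rfl, hy⟩)
  have B₂ : ∀ s, y < n → FirstBranch adj N (φ s y) (φ (!s) n) (n + 1 - y) := fun s hy => by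
    have := h.firstBranch_down hN (by omega) (s := !s) (b := n + 1) (L := n + 1 - y) (by omega)
      (by omega) le_rfl (fun j hj hj' => by omega) (by
        rw [show n + 1 - (n + 1 - y) = y by omega, h.branch_iff (by omega) (by omega)]
        exact .inr ⟨rfl, hy⟩)
    rwa [h.last, Bool.not_not] at this
  constructor
  · rintro ⟨a, b, c, ha, hb, hc, hbc, fb, fc⟩
    -- Either of the two edges at `φ s x` that belong to the lower pair forces `L = x`.
    have RA : ∀ s b', a = φ s x → 2 ≤ x → FirstBranch adj N a b' L →
        b' = φ s (x - 1) ∨ b' = φ (!s) 1 → (L = x ∧ 2 ≤ x) ∨ (L + y = n + 1 ∧ y < n) := by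
      rintro s b' rfl hx f (rfl | rfl)
      · exact .inl ⟨f.unique (A₁ s hx), hx⟩
      · exact .inl ⟨f.unique (A₂ s hx), hx⟩
    have RB : ∀ s b', a = φ s y → y < n → FirstBranch adj N a b' L →
        b' = φ s (y + 1) ∨ b' = φ (!s) n → (L = x ∧ 2 ≤ x) ∨ (L + y = n + 1 ∧ y < n) := by
      rintro s b' rfl hy f (rfl | rfl)
      · have := f.unique (B₁ s hy)
        omega
      · have := f.unique (B₂ s hy)
        omega
    obtain ⟨s, j, hj, hj', rfl⟩ := (h.vert_iff a).1 (h.vert_of_adj hb)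
    have nb := (h.adj_apply_iff hj hj' b).1 hb
    have nc := (h.adj_apply_iff hj hj' c).1 hc
    by_cases hx : j = x ∧ 2 ≤ x
    · obtain ⟨rfl, hx⟩ := hx
      by_cases hbA : b = φ s (j - 1) ∨ b = φ (!s) 1
      · exact RA s b rfl hx fb hbA
      by_cases hcA : c = φ s (j - 1) ∨ c = φ (!s) 1
      · exact RA s c rfl hx fc hcA
      by_cases hy : j = y ∧ y < n
      · obtain ⟨rfl, hy⟩ := hy
        refine RB s b rfl hy fb ?_
        tauto
      -- Only one edge at this vertex lies outside the lower pair, so `b` and `c` cannot both avoid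
      -- the pair.
      · have key : ∀ b, ¬ (b = φ s (j - 1) ∨ b = φ (!s) 1) →
            (b = φ s (j - 1) ∨ b = φ s (j + 1) ∨ (j = j ∧ b = φ (!s) 1) ∨
              (j = y ∧ b = φ (!s) n)) → b = φ s (j + 1) := by
          rintro b hb' (e | e | ⟨-, e⟩ | ⟨rfl, e⟩)
          · exact absurd (.inl e) hb'
          · exact e
          · exact absurd (.inr e) hb'
          · obtain rfl : j = n := by omega
            rw [e, h.last]
        exact absurd ((key b hbA nb).trans (key c hcA nc).symm) hbc
    · have hy : j = y ∧ y < n := ((h.branch_iff hj hj').1 ha).resolve_left hx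
      obtain ⟨rfl, hy⟩ := hy
      by_cases hbB : b = φ s (j + 1) ∨ b = φ (!s) n
      · exact RB s b rfl hy fb hbB
      by_cases hcB : c = φ s (j + 1) ∨ c = φ (!s) n
      · exact RB s c rfl hy fc hcB
      have key : ∀ b, ¬ (b = φ s (j + 1) ∨ b = φ (!s) n) →
          (b = φ s (j - 1) ∨ b = φ s (j + 1) ∨ (j = x ∧ b = φ (!s) 1) ∨
            (j = j ∧ b = φ (!s) n)) → b = φ s (j - 1) := by
        rintro b hb' (e | e | ⟨rfl, e⟩ | ⟨-, e⟩)
        · exact e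
        · exact absurd (.inl e) hb'
        · obtain rfl : j = 1 := by omega
          rw [e, Nat.sub_self, h.first]
        · exact absurd (.inr e) hb'
      exact absurd ((key b hbB nb).trans (key c hcB nc).symm) hbc
  · rintro (⟨rfl, hx⟩ | ⟨hL, hy⟩)
    · refine ⟨φ true L, φ true (L - 1), φ false 1, (h.branch_iff h₁ (by omega)).2 (.inl ⟨rfl, hx⟩),
        (h.adj_apply_iff h₁ (by omega) _).2 (.inl rfl),
        (h.adj_apply_iff h₁ (by omega) _).2 (.inr (.inr (.inl ⟨rfl, rfl⟩))), ?_, A₁ _ hx, A₂ _ hx⟩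
      rw [Ne, h.inj_iff (by omega) (by omega) (by omega) (by omega)]
      simp
    · obtain rfl : L = n + 1 - y := by omega
      refine ⟨φ true y, φ true (y + 1), φ false n,
        (h.branch_iff (by omega) (by omega)).2 (.inr ⟨rfl, hy⟩),
        (h.adj_apply_iff (by omega) (by omega) _).2 (.inr (.inl rfl)),
        (h.adj_apply_iff (by omega) (by omega) _).2 (.inr (.inr (.inr ⟨rfl, rfl⟩))), ?_,
        B₁ _ hy, B₂ _ hy⟩
      rw [Ne, h.inj_iff (by omega) (by omega) (by omega) (by omega)]
      simp

open Classical in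
theorem count_vert (h : GraphForm vert adj n x y φ) (hN : ∀ a, vert a → a < N) :
    Nat.count vert N = 2 * n := by
  rw [Nat.count_eq_card_filter_range]
  have : (Finset.range N).filter vert =
      ((Finset.univ : Finset Bool) ×ˢ Finset.Icc 1 n).image fun q => φ q.1 q.2 := by
    ext a
    simp only [Finset.mem_filter, Finset.mem_range, Finset.mem_image, Finset.mem_product,
      Finset.mem_univ, true_and, Finset.mem_Icc, Prod.exists]
    rw [h.vert_iff]
    constructor
    · rintro ⟨-, s, k, hk, hk', e⟩
      exact ⟨s, k, ⟨hk, hk'⟩, e⟩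
    · rintro ⟨s, k, ⟨hk, hk'⟩, e⟩
      exact ⟨e ▸ hN _ (h.vert_apply (by omega)), s, k, hk, hk', e⟩
  rw [this, Finset.card_image_of_injOn, Finset.card_product]
  · simp
  · rintro ⟨s, j⟩ hj ⟨t, k⟩ hk e
    simp only [Finset.coe_product, Finset.coe_univ, Finset.coe_Icc, Set.mem_prod, Set.mem_univ,
      true_and, Set.mem_Icc] at hj hk
    obtain ⟨rfl, rfl⟩ := h.inj s t j k hj.1 hj.2 hk.1 hk.2 e
    rfl

end GraphForm

open Classical in
/-- The parameters determined by a graph with vertices below `N`. -/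
def HasParams (vert : ℕ → Prop) (adj : ℕ → ℕ → Prop) (N n x y : ℕ) : Prop :=
  Nat.count vert N = 2 * n ∧ 1 ≤ x ∧ x ≤ y ∧ y ≤ n ∧ x + y ≤ n + 1 ∧
    (∀ L < N, TwinWalks adj N L ↔ (L = x ∧ 2 ≤ x) ∨ (L + y = n + 1 ∧ y < n)) ∧
    (ManyBranches adj ↔ 2 ≤ x)

/-- By normalisation `x ≤ n + 1 - y`, so `x` is the smaller twin length if there are two of them. A
single length `L` leaves open whether `x = n + 1 - y = L`, or `x = 1` and `n + 1 - y = L`;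
`ManyBranches` decides this. -/
theorem GraphForm.hasParams_iff {vert : ℕ → Prop} {adj : ℕ → ℕ → Prop} {n x y N : ℕ}
    {φ : Bool → ℕ → ℕ} (h : GraphForm vert adj n x y φ) (hN : ∀ a, vert a → a < N)
    (hxy : x + y ≤ n + 1) (n' x' y' : ℕ) :
    HasParams vert adj N n' x' y' ↔ n' = n ∧ x' = x ∧ y' = y := by
  have h₁ := h.one_le
  have h₂ := h.le
  have h₃ := h.le_size
  have hnN : 2 * n ≤ N := by
    classical
    rw [← h.count_vert hN]
    exact Nat.count_le _
  constructor
  · rintro ⟨q₀, q₁, q₂, q₃, q₄, q₅, q₆⟩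
    rw [h.count_vert hN] at q₀
    obtain rfl : n' = n := by omega
    rw [h.manyBranches_iff hxy] at q₆
    simp only [h.twinWalks_iff hN] at q₅
    -- The lengths coming from the two triples are all that has to be compared. They are at most
    -- `n`, hence less than `N`, because `2 * n ≤ N` and `n ≥ 1`.
    have e₁ := q₅ x (by omega)
    have e₂ := q₅ (n' + 1 - y) (by omega)
    have e₃ := q₅ x' (by omega)
    have e₄ := q₅ (n' + 1 - y') (by omega)
    omega
  · rintro ⟨rfl, rfl, rfl⟩
    exact ⟨h.count_vert hN, h₁, h₂, h₃, hxy, fun L _ => h.twinWalks_iff hN L,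
      h.manyBranches_iff hxy⟩

/-- The normalised parameters are determined by the graph. -/
theorem GraphForm.params_unique {α : Type} {vert : α → Prop} {adj : α → α → Prop}
    {n x y n' x' y' : ℕ} {φ ψ : Bool → ℕ → α} (h : GraphForm vert adj n x y φ)
    (h' : GraphForm vert adj n' x' y' ψ) (hxy : x + y ≤ n + 1) (hxy' : x' + y' ≤ n' + 1) :
    n' = n ∧ x' = x ∧ y' = y := by
  have hfin : {a | vert a}.Finite := by
    have : {a | vert a} ⊆ (fun q : Bool × ℕ => φ q.1 q.2) ''
        (((Finset.univ : Finset Bool) ×ˢ Finset.Icc 1 n : Finset _) : Set (Bool × ℕ)) := by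
      intro a ha
      obtain ⟨s, k, hk, hk', rfl⟩ := (h.vert_iff a).1 ha
      exact ⟨(s, k), by simp [hk, hk'], rfl⟩
    exact ((Finset.finite_toSet _).image _).subset this
  -- Walks are defined for natural numbers only, so the finitely many vertices are numbered.
  obtain ⟨e, he⟩ := Set.countable_iff_exists_injOn.1 hfin.countable
  obtain ⟨N, hN⟩ := (hfin.image e).bddAbove
  have he' : ∀ a b, vert a → vert b → e a = e b → a = b := fun a b ha hb q => he ha hb q
  have g := h.map (vert' := fun b => ∃ a, vert a ∧ e a = b)
    (adj' := fun b b' => ∃ a a', adj a a' ∧ e a = b ∧ e a' = b') e he' (fun _ => Iff.rfl)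
    fun _ _ => Iff.rfl
  have g' := h'.map (vert' := fun b => ∃ a, vert a ∧ e a = b)
    (adj' := fun b b' => ∃ a a', adj a a' ∧ e a = b ∧ e a' = b') e he' (fun _ => Iff.rfl)
    fun _ _ => Iff.rfl
  have hN' : ∀ b, (∃ a, vert a ∧ e a = b) → b < N + 1 := by
    rintro b ⟨a, ha, rfl⟩
    exact Nat.lt_succ_of_le (hN ⟨a, ha, rfl⟩)
  exact (g.hasParams_iff hN' hxy n' x' y').1 ((g'.hasParams_iff hN' hxy' n' x' y').2
    ⟨rfl, rfl, rfl⟩)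

end GraphForms
end TwoMU

namespace TwoMU

/-! ### From walks of literals to implication graphs, and completeness of the parameters -/

section Bridge

namespace GraphForm

variable {n x y n' x' y' : ℕ}

/-- Graphs with the same parameters are isomorphic. -/
theorem graphIso {W W' : Type} {G : Graph W} {H : Graph W'} {φ : Bool → ℕ → W} {ψ : Bool → ℕ → W'}
    (h : GraphForm (· ∈ G.verts) G.Adj n x y φ) (h' : GraphForm (· ∈ H.verts) H.Adj n x y ψ) :
    GraphIso G H := by
  classical
  have h₁ := h.one_le
  have h₂ := h.le
  have h₃ := h.le_size
  choose s k hk hk' e using fun a : G.verts => (h.vert_iff a.1).1 a.2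
  let f : G.verts → H.verts := fun a => ⟨ψ (s a) (k a), h'.vert_apply (by have := hk' a; omega)⟩
  have f₁ : ∀ t j (hv : φ t j ∈ G.verts), j ≤ n + 1 → (f ⟨φ t j, hv⟩).1 = ψ t j := by
    have base : ∀ t j (hv : φ t j ∈ G.verts), 1 ≤ j → j ≤ n → (f ⟨φ t j, hv⟩).1 = ψ t j := by
      intro t j hv hj hj'
      obtain ⟨e₁, e₂⟩ := h.inj _ _ _ _ (hk _) (hk' _) hj hj' (e ⟨φ t j, hv⟩)
      simp only [f, e₁, e₂]
    intro t j hv hj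
    rcases Nat.eq_zero_or_pos j with rfl | hj0
    · rw [h'.first]
      simp only [h.first]
      exact base _ _ _ h₁ (by omega)
    · rcases Nat.lt_or_ge n j with hj' | hj'
      · obtain rfl : j = n + 1 := by omega
        rw [h'.last]
        simp only [h.last]
        exact base _ _ _ (by omega) h₃
      · exact base _ _ _ hj0 hj'
  have finj : Function.Injective f := by
    intro a b q
    have := congrArg Subtype.val q
    obtain ⟨e₁, e₂⟩ := h'.inj _ _ _ _ (hk a) (hk' a) (hk b) (hk' b) this
    exact Subtype.ext (by rw [← e a, ← e b, e₁, e₂])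
  have fsurj : Function.Surjective f := by
    rintro ⟨b, hb⟩
    obtain ⟨t, j, hj, hj', rfl⟩ := (h'.vert_iff b).1 hb
    exact ⟨⟨φ t j, h.vert_apply (by omega)⟩, Subtype.ext (f₁ _ _ _ (by omega))⟩
  have fbij : Function.Bijective f := ⟨finj, fsurj⟩
  refine ⟨⟨Equiv.ofBijective f fbij, ?_⟩⟩
  rintro ⟨a, ha⟩ ⟨b, hb⟩
  change H.Adj (f ⟨a, ha⟩).1 (f ⟨b, hb⟩).1 ↔ G.Adj a b
  rw [h'.adj_iff, h.adj_iff]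
  have key : ∀ t j, j ≤ n + 1 → ∀ a (ha : a ∈ G.verts), ψ t j = (f ⟨a, ha⟩).1 ↔ φ t j = a := by
    intro t j hj a ha
    constructor
    · intro q
      have hv : φ t j ∈ G.verts := h.vert_apply hj
      have := finj (Subtype.ext ((f₁ t j hv hj).trans q))
      exact congrArg Subtype.val this
    · rintro rfl
      exact (f₁ t j ha hj).symm
  constructor
  · rintro ⟨t, j, hj, q⟩
    refine ⟨t, j, hj, ?_⟩
    rwa [key t j (by omega) a ha, key t (j + 1) (by omega) b hb, key t j (by omega) b hb,
      key t (j + 1) (by omega) a ha] at q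
  · rintro ⟨t, j, hj, q⟩
    refine ⟨t, j, hj, ?_⟩
    rwa [key t j (by omega) a ha, key t (j + 1) (by omega) b hb, key t j (by omega) b hb,
      key t (j + 1) (by omega) a ha]

theorem of_graphIso {W W' : Type} {G : Graph W} {H : Graph W'} {φ : Bool → ℕ → W}
    (h : GraphForm (· ∈ G.verts) G.Adj n x y φ) (i : GraphIso G H) :
    ∃ ψ, GraphForm (· ∈ H.verts) H.Adj n x y ψ := by
  classical
  obtain ⟨i⟩ := i
  have h₂ := h.le
  have h₃ := h.le_size
  have hv : φ true x ∈ G.verts := h.vert_apply (by omega)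
  -- Outside the vertex set the value of `e` is irrelevant; any vertex of `H` serves as default.
  let e : W → W' := fun a => if ha : a ∈ G.verts then (i ⟨a, ha⟩).1 else (i ⟨_, hv⟩).1
  have he : ∀ a (ha : a ∈ G.verts), e a = (i ⟨a, ha⟩).1 := fun a ha => dif_pos ha
  refine ⟨_, h.map e ?_ ?_ ?_⟩
  · intro a b ha hb q
    rw [he a ha, he b hb] at q
    have := i.injective (Subtype.ext q)
    exact congrArg Subtype.val this
  · intro b
    constructor
    · intro hb
      refine ⟨(i.symm ⟨b, hb⟩).1, (i.symm ⟨b, hb⟩).2, ?_⟩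
      rw [he _ (i.symm ⟨b, hb⟩).2]
      simp
    · rintro ⟨a, ha, rfl⟩
      rw [he a ha]
      exact (i ⟨a, ha⟩).2
  · intro b b'
    constructor
    · intro hbb
      have hb := H.edge_vert hbb
      have hb' := H.edge_vert hbb.symm
      refine ⟨(i.symm ⟨b, hb⟩).1, (i.symm ⟨b', hb'⟩).1, ?_, ?_, ?_⟩
      · have : H.coe.Adj ⟨b, hb⟩ ⟨b', hb'⟩ := hbb
        exact (i.symm.map_rel_iff).2 this
      · rw [he _ (i.symm ⟨b, hb⟩).2]
        simp
      · rw [he _ (i.symm ⟨b', hb'⟩).2]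
        simp
    · rintro ⟨a, a', haa, rfl, rfl⟩
      rw [he a (G.edge_vert haa), he a' (G.edge_vert haa.symm)]
      exact (i.map_rel_iff (a := ⟨a, G.edge_vert haa⟩) (b := ⟨a', G.edge_vert haa.symm⟩)).2 haa

end GraphForm

variable {V : Type} [DecidableEq V]

/-- Since `{b, b} = {b}`, the arcs of unit-clauses and those of binary clauses have a common
description. -/
theorem idg_adj_iff_mem (F : ClauseSet V) (a b : Literal V) :
    (idg F).Adj a b ↔ {compl a, b} ∈ F := by
  simp only [idg]
  constructor
  · rintro (⟨rfl, hb⟩ | ⟨p, q, -, hpq, rfl, rfl⟩)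
    · simpa using hb
    · simpa using hpq
  · intro hF
    by_cases e : a = compl b
    · subst e
      exact .inl ⟨rfl, by simpa using hF⟩
    · exact .inr ⟨compl a, b, fun q => e (compl_eq_comm.1 q), hF, by simp, rfl⟩

namespace ChainForm

variable {F : ClauseSet V} {n x y : ℕ} {φ : ℕ → Literal V}

theorem succ_ne (h : ChainForm F n x y φ) {k : ℕ} (hk : k ≤ n) : φ k ≠ φ (k + 1) := fun e => by
  have hC := (h.mem_iff _).2 ⟨k, hk, rfl⟩
  refine h.isClauseSet _ hC (φ (k + 1)) (by simp) ?_
  rw [← e]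
  simp

/-- Each clause contributes its implication along the walk and the contrapositive. -/
theorem idg_adj_iff (h : ChainForm F n x y φ) (a b : Literal V) : (idg F).Adj a b ↔
    ∃ k ≤ n, (φ k = a ∧ φ (k + 1) = b) ∨ (compl (φ (k + 1)) = a ∧ compl (φ k) = b) := by
  rw [idg_adj_iff_mem, h.mem_iff]
  refine exists_congr fun k => and_congr_right fun _ => ?_
  constructor
  · intro e
    have ha : compl a ∈ ({compl (φ k), φ (k + 1)} : Finset (Literal V)) := by simp [e]
    have hb : b ∈ ({compl (φ k), φ (k + 1)} : Finset (Literal V)) := by simp [e]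
    have hc : compl (φ k) ∈ ({compl a, b} : Finset (Literal V)) := by simp [← e]
    have hd : φ (k + 1) ∈ ({compl a, b} : Finset (Literal V)) := by simp [← e]
    simp only [Finset.mem_insert, Finset.mem_singleton] at ha hb hc hd
    rcases ha with ha | ha
    · rcases hb with hb | hb
      · refine .inl ⟨(compl_injective ha).symm, ?_⟩
        rcases hd with q | q
        · exact q.trans (ha.trans hb.symm)
        · exact q
      · exact .inl ⟨(compl_injective ha).symm, hb.symm⟩
    · refine .inr ⟨compl_eq_comm.2 ha.symm, ?_⟩
      rcases hb with hb | hb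
      · exact hb.symm
      · rcases hc with q | q
        · exact q.trans (ha.trans hb.symm)
        · exact q
  · rintro (⟨rfl, rfl⟩ | ⟨rfl, rfl⟩)
    · rfl
    · rw [compl_compl, Finset.pair_comm]

/-- The implication graph of a clause-set in chain form. -/
theorem graphForm (h : ChainForm F n x y φ) : GraphForm (· ∈ (ig F).verts) (ig F).Adj n x y
    fun s k => bif s then φ k else compl (φ k) := by
  refine ⟨h.one_le, h.le, h.le_size, fun s t j k hj hj' hk hk' e => ?_, fun s => ?_, fun s => ?_,
    fun a => ?_, fun a b => ?_⟩
  · obtain rfl : j = k := h.inj j k hj hj' hk hk' (by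
      have := congrArg Prod.fst e
      cases s <;> cases t <;> exact this)
    refine ⟨?_, rfl⟩
    cases s <;> cases t
    · rfl
    · exact absurd e (compl_ne _)
    · exact absurd e.symm (compl_ne _)
    · rfl
  · cases s <;> simp [h.first]
  · cases s <;> simp [h.last]
  · refine (h.mem_lits_iff a).trans ?_
    constructor
    · rintro ⟨j, hj, hj', rfl | rfl⟩
      exacts [⟨true, j, hj, hj', rfl⟩, ⟨false, j, hj, hj', rfl⟩]
    · rintro ⟨s, j, hj, hj', rfl⟩
      cases s
      exacts [⟨j, hj, hj', .inr rfl⟩, ⟨j, hj, hj', .inl rfl⟩]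
  · simp only [ig, h.idg_adj_iff]
    constructor
    · rintro ⟨-, ⟨k, hk, q | q⟩ | ⟨k, hk, q | q⟩⟩
      exacts [⟨true, k, hk, .inl q⟩, ⟨false, k, hk, .inr ⟨q.2, q.1⟩⟩, ⟨true, k, hk, .inr q⟩,
        ⟨false, k, hk, .inl ⟨q.2, q.1⟩⟩]
    · rintro ⟨s, k, hk, ⟨rfl, rfl⟩ | ⟨rfl, rfl⟩⟩ <;> have hne := h.succ_ne hk <;> cases s
      · exact ⟨fun e => hne (compl_injective e), .inr ⟨k, hk, .inr ⟨rfl, rfl⟩⟩⟩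
      · exact ⟨hne, .inl ⟨k, hk, .inl ⟨rfl, rfl⟩⟩⟩
      · exact ⟨fun e => hne (compl_injective e).symm, .inl ⟨k, hk, .inr ⟨rfl, rfl⟩⟩⟩
      · exact ⟨hne.symm, .inr ⟨k, hk, .inl ⟨rfl, rfl⟩⟩⟩

theorem eq_of_graphIso {V' : Type} [DecidableEq V'] {F' : ClauseSet V'} {n' x' y' : ℕ}
    {φ' : ℕ → Literal V'} (h : ChainForm F n x y φ) (h' : ChainForm F' n' x' y' φ')
    (hxy : x + y ≤ n + 1) (hxy' : x' + y' ≤ n' + 1) (i : GraphIso (ig F) (ig F')) :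
    n' = n ∧ x' = x ∧ y' = y := by
  obtain ⟨ψ, hψ⟩ := h.graphForm.of_graphIso i
  exact hψ.params_unique h'.graphForm hxy hxy'

theorem eq_of_iso {F' : ClauseSet V} {n' x' y' : ℕ} {φ' : ℕ → Literal V}
    (h : ChainForm F n x y φ) (h' : ChainForm F' n' x' y' φ')
    (hxy : x + y ≤ n + 1) (hxy' : x' + y' ≤ n' + 1) (i : Iso F F') :
    n' = n ∧ x' = x ∧ y' = y := by
  obtain ⟨ψ, hψ⟩ := h.map_iso i
  exact hψ.graphForm.params_unique h'.graphForm hxy hxy'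

/-- Different steps give different clauses, so clauses can be counted by their indices. -/
theorem card_filter (h : ChainForm F n x y φ) (p : Finset (Literal V) → Prop) [DecidablePred p] :
    (F.filter p).card =
      ((Finset.range (n + 1)).filter fun k => p {compl (φ k), φ (k + 1)}).card := by
  rw [h.eq, Finset.filter_image, Finset.card_image_of_injOn]
  intro j hj k hk e
  simp only [Finset.coe_filter, Finset.mem_range, Set.mem_ofPred_eq] at hj hk
  exact h.clause_injective (by omega) (by omega) e

/-- This locates the unit-clauses: inner steps join different variables, so only the two ends of the
walk can yield one. -/
theorem compl_eq_succ_iff (h : ChainForm F n x y φ) {k : ℕ} (hk : k ≤ n) :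
    compl (φ k) = φ (k + 1) ↔ (k = 0 ∧ x = 1) ∨ (k = n ∧ y = n) := by
  have h₁ := h.one_le
  have h₂ := h.le
  have h₃ := h.le_size
  rcases Nat.eq_zero_or_pos k with rfl | hk0
  · rw [h.first, compl_compl]
    constructor
    · intro e
      have := h.inj x 1 h₁ (by omega) le_rfl (by omega) (by rw [e])
      omega
    · rintro (⟨-, rfl⟩ | ⟨rfl, -⟩)
      · rfl
      · omega
  · rcases Nat.lt_or_ge k n with hkn | hkn
    · constructor
      · intro e
        have := h.inj k (k + 1) hk0 hk (by omega) (by omega) (by rw [← e, compl_fst])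
        omega
      · omega
    · obtain rfl : k = n := by omega
      rw [h.last]
      constructor
      · intro e
        have := h.inj k y hk0 hk (by omega) h₃ (by rw [compl_injective e])
        omega
      · rintro (⟨rfl, -⟩ | ⟨-, rfl⟩)
        · omega
        · rfl

theorem unitCount_eq (h : ChainForm F n x y φ) :
    unitCount F = (if x = 1 then 1 else 0) + if y = n then 1 else 0 := by
  have h₁ := h.one_le
  have h₂ := h.le
  have h₃ := h.le_size
  unfold unitCount
  rw [h.card_filter]
  have : (Finset.range (n + 1)).filter
      (fun k => ({compl (φ k), φ (k + 1)} : Finset (Literal V)).card = 1) =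
      (if x = 1 then {0} else ∅) ∪ if y = n then {n} else ∅ := by
    ext k
    simp only [Finset.mem_filter, Finset.mem_range, Finset.mem_union]
    have : k < n + 1 → ((({compl (φ k), φ (k + 1)} : Finset (Literal V)).card = 1) ↔
        (k = 0 ∧ x = 1) ∨ (k = n ∧ y = n)) := by
      intro hk
      rw [← h.compl_eq_succ_iff (by omega)]
      constructor
      · intro hc
        by_contra hne
        rw [Finset.card_pair hne] at hc
        omega
      · intro e
        simp [e]
    constructor
    · rintro ⟨hk, hc⟩
      rcases (this hk).1 hc with ⟨rfl, e⟩ | ⟨rfl, e⟩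
      · exact .inl (by simp [e])
      · exact .inr (by simp [e])
    · rintro (hk | hk)
      · split_ifs at hk with e
        · obtain rfl := Finset.mem_singleton.1 hk
          exact ⟨by omega, (this (by omega)).2 (.inl ⟨rfl, e⟩)⟩
        · simp at hk
      · split_ifs at hk with e
        · obtain rfl := Finset.mem_singleton.1 hk
          exact ⟨by omega, (this (by omega)).2 (.inr ⟨rfl, e⟩)⟩
        · simp at hk
  rw [this, Finset.card_union_of_disjoint]
  · split_ifs <;> simp
  · split_ifs <;> simp
    omega

/-- As a conclusion `φ j` occurs in step `j - 1` only. As the complement of a premise it occurs at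
most in step `0`, namely if `j = x`; these two steps differ because `x ≥ 2`. -/
theorem litDegree_eq (h : ChainForm F n x y φ) (hx : 2 ≤ x) {j : ℕ} (hj : 1 ≤ j) (hj' : j ≤ n) :
    litDegree F (φ j) = if j = x then 2 else 1 := by
  have h₂ := h.le
  have h₃ := h.le_size
  unfold litDegree
  rw [h.card_filter]
  have hne : ∀ i, 1 ≤ i → i ≤ n → φ j ≠ compl (φ i) := by
    intro i hi hi' e
    have := h.inj j i hj hj' hi hi' (by rw [e, compl_fst])
    subst this
    exact compl_ne _ e.symm
  have : (Finset.range (n + 1)).filter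
      (fun k => φ j ∈ ({compl (φ k), φ (k + 1)} : Finset (Literal V))) =
      if j = x then {0, j - 1} else {j - 1} := by
    ext k
    simp only [Finset.mem_filter, Finset.mem_range, Finset.mem_insert, Finset.mem_singleton]
    constructor
    · rintro ⟨hk, e | e⟩
      · rcases Nat.eq_zero_or_pos k with rfl | hk0
        · rw [h.first, compl_compl] at e
          have := h.inj j x hj hj' (by omega) (by omega) (by rw [e])
          simp [this]
        · exact absurd e (hne k hk0 (by omega))
      · rcases Nat.lt_or_ge k n with hkn | hkn
        · have := h.inj j (k + 1) hj hj' (by omega) (by omega) (by rw [e])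
          subst this
          split_ifs <;> simp
        · obtain rfl : k = n := by omega
          rw [h.last] at e
          exact absurd e (hne y (by omega) h₃)
    · intro hk
      have hj1 : j - 1 < n + 1 ∧ (φ j = compl (φ (j - 1)) ∨ φ j = φ (j - 1 + 1)) :=
        ⟨by omega, .inr (by rw [Nat.sub_add_cancel hj])⟩
      split_ifs at hk with e
      · rcases Finset.mem_insert.1 hk with rfl | hk
        · exact ⟨by omega, .inl (by rw [h.first, compl_compl, e])⟩
        · obtain rfl := Finset.mem_singleton.1 hk
          exact hj1
      · obtain rfl := Finset.mem_singleton.1 hk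
        exact hj1
  rw [this]
  split_ifs with e
  · exact Finset.card_pair (by omega)
  · simp

/-- Among the `φ j` only `φ x` occurs twice, and by reversal, among the `¬φ j` only `¬φ y`. They
have the same variable exactly for `x = y`. -/
theorem exists_litDegree_iff (h : ChainForm F n x y φ) (hx : 2 ≤ x) (hy : y < n) :
    (∃ v : V, litDegree F (v, true) = 2 ∧ litDegree F (v, false) = 2) ↔ x = y := by
  have h₂ := h.le
  have hpos : ∀ j, 1 ≤ j → j ≤ n → litDegree F (φ j) = if j = x then 2 else 1 := fun j hj hj' =>
    h.litDegree_eq hx hj hj'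
  have hneg : ∀ j, 1 ≤ j → j ≤ n → litDegree F (compl (φ j)) = if j = y then 2 else 1 := by
    intro j hj hj'
    have := h.flip.litDegree_eq (by omega) (j := n + 1 - j) (by omega) (by omega)
    simp only [show n + 1 - (n + 1 - j) = j by omega] at this
    rw [this]
    exact if_congr (by omega) rfl rfl
  have swap : ∀ z : Literal V, (litDegree F (z.1, true) = 2 ∧ litDegree F (z.1, false) = 2) ↔
      litDegree F z = 2 ∧ litDegree F (compl z) = 2 := by
    rintro ⟨v, b⟩
    cases b
    · exact and_comm
    · exact Iff.rfl
  constructor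
  · rintro ⟨v, hv⟩
    have hvF : v ∈ vars F := by
      have : 0 < litDegree F (v, true) := by omega
      obtain ⟨C, hC⟩ := Finset.card_pos.1 this
      obtain ⟨hC, hz⟩ := Finset.mem_filter.1 hC
      exact mem_vars.2 ⟨C, hC, _, hz, rfl⟩
    obtain ⟨j, hj, hj', rfl⟩ := (h.mem_vars_iff v).1 hvF
    rw [swap, hpos j hj hj', hneg j hj hj'] at hv
    split_ifs at hv <;> omega
  · rintro rfl
    refine ⟨(φ x).1, (swap _).2 ?_⟩
    rw [hpos x (by omega) (by omega), hneg x (by omega) (by omega)]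
    simp

end ChainForm

/-! ### The four families -/

omit [DecidableEq V] in
theorem intLit_neg (ι : ℕ+ ↪ V) {k : ℕ} (hk : 1 ≤ k) :
    intLit ι (-(k : ℤ)) = compl (intLit ι (k : ℤ)) := by
  have h₁ : (0 : ℤ) < k := by omega
  have h₂ : ¬ (0 : ℤ) < -k := by omega
  simp only [intLit, compl, Int.natAbs_neg, h₁, h₂, decide_true, decide_false, Bool.not_true]

omit [DecidableEq V] in
theorem intLit_fst_injective (ι : ℕ+ ↪ V) {j k : ℕ} (hj : 1 ≤ j) (hk : 1 ≤ k)
    (h : (intLit ι (j : ℤ)).1 = (intLit ι (k : ℤ)).1) : j = k := by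
  have := ι.injective h
  simp only [Int.natAbs_natCast] at this
  have := congrArg PNat.val this
  rwa [Nat.toPNat'_coe, Nat.toPNat'_coe, if_pos (by omega), if_pos (by omega)] at this

namespace Pattern

/-- The lower attachment index. -/
def lo : Pattern → ℕ
  | U2 _ => 1
  | U1 _ _ => 1
  | U0i _ i => i
  | U0xy _ x _ => x

/-- The upper attachment index. -/
def hi : Pattern → ℕ
  | U2 n => n
  | U1 _ i => i
  | U0i _ i => i
  | U0xy _ _ y => y

/-- The pattern with given size and attachment indices. -/
def ofTriple (n x y : ℕ) : Pattern :=
  if x = 1 then if y = n then U2 n else U1 n y else if x = y then U0i n x else U0xy n x y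

/-- The walk through the literals `1, 2, …, n` of a pattern. -/
def walk (ι : ℕ+ ↪ V) (n x y k : ℕ) : Literal V :=
  if k = 0 then intLit ι (-(x : ℤ)) else if k = n + 1 then intLit ι (-(y : ℤ)) else intLit ι (k : ℤ)

theorem Valid.bounds {T : Pattern} (h : T.Valid) :
    1 ≤ T.lo ∧ T.lo ≤ T.hi ∧ T.hi ≤ T.size ∧ T.lo + T.hi ≤ T.size + 1 := by
  cases T <;> simp only [Valid, lo, hi, size] at * <;> omega

theorem Valid.eq_ofTriple {T : Pattern} (h : T.Valid) : T = ofTriple T.size T.lo T.hi := by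
  cases T with
  | U2 n => simp [ofTriple, lo, hi, size]
  | U1 n i =>
    have : i ≠ n := by
      have := h.2
      have := h.1
      omega
    simp [ofTriple, lo, hi, size, this]
  | U0i n i =>
    have : i ≠ 1 := by
      have := h.2.1
      omega
    simp [ofTriple, lo, hi, size, this]
  | U0xy n x y =>
    have : x ≠ 1 := by
      have := h.2.1
      omega
    simp [ofTriple, lo, hi, size, this, h.2.2.1.ne]

/-- With `Valid.eq_ofTriple` this identifies the members of the four families with the normalised
triples. -/
theorem valid_ofTriple {n x y : ℕ} (h₁ : 1 ≤ x) (h₂ : x ≤ y) (h₃ : y ≤ n) (h : x + y ≤ n + 1) :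
    (ofTriple n x y).Valid ∧ (ofTriple n x y).size = n ∧ (ofTriple n x y).lo = x ∧
      (ofTriple n x y).hi = y := by
  unfold ofTriple
  split_ifs with e₁ e₂ e₂
  · exact ⟨show 1 ≤ n by omega, rfl, e₁.symm, e₂.symm⟩
  · exact ⟨show 2 ≤ n ∧ 1 ≤ y ∧ y ≤ n - 1 by omega, rfl, e₁.symm, rfl⟩
  · exact ⟨show 3 ≤ n ∧ 2 ≤ x ∧ 2 * x ≤ n + 1 by omega, rfl, rfl, e₂⟩
  · exact ⟨show 4 ≤ n ∧ 2 ≤ x ∧ x < y ∧ y ≤ n - 1 ∧ x + y ≤ n + 1 by omega, rfl, rfl, rfl⟩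

/-- The unit-clauses `{1}` and `{-n}` are the pairs with `lo = 1` and `hi = n`, so one expression
covers all families. -/
theorem clauseSet_eq (ι : ℕ+ ↪ V) {T : Pattern} (h : T.Valid) :
    T.clauseSet ι = chain ι T.size ∪ {{intLit ι (T.lo : ℤ), intLit ι 1},
      {intLit ι (-(T.size : ℤ)), intLit ι (-(T.hi : ℤ))}} := by
  cases T <;> simp only [clauseSet, lo, hi, size, Nat.cast_one, Finset.pair_eq_singleton]
  · rw [Finset.pair_comm (intLit ι 1)]
  · rw [Finset.pair_comm (intLit ι 1)]

theorem chainForm (ι : ℕ+ ↪ V) {T : Pattern} (h : T.Valid) :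
    ChainForm (T.clauseSet ι) T.size T.lo T.hi (walk ι T.size T.lo T.hi) := by
  obtain ⟨h₁, h₂, h₃, -⟩ := h.bounds
  rw [clauseSet_eq ι h]
  generalize T.size = n at *
  generalize T.lo = x at *
  generalize T.hi = y at *
  have w : ∀ k, 1 ≤ k → k ≤ n → walk ι n x y k = intLit ι (k : ℤ) := fun k hk hk' => by
    rw [walk, if_neg (by omega), if_neg (by omega)]
  have w₀ : walk ι n x y 0 = intLit ι (-(x : ℤ)) := by simp [walk]
  have w₁ : walk ι n x y (n + 1) = intLit ι (-(y : ℤ)) := by simp [walk]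
  refine ⟨h₁, h₂, h₃, fun j k hj hj' hk hk' e => ?_, ?_, ?_, ?_⟩
  · rw [w j hj hj', w k hk hk'] at e
    exact intLit_fst_injective ι hj hk e
  · rw [w x h₁ (by omega), w₀, intLit_neg ι h₁]
  · rw [w y (by omega) h₃, w₁, intLit_neg ι (by omega)]
  · have e₁ : ∀ k, 1 ≤ k → k < n →
        ({compl (walk ι n x y k), walk ι n x y (k + 1)} : Finset (Literal V)) =
          {intLit ι (-(k : ℤ)), intLit ι ((k : ℤ) + 1)} := fun k hk hk' => by
      rw [w k hk (by omega), w (k + 1) (by omega) (by omega), intLit_neg ι hk]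
      push_cast
      rfl
    have e₂ : ({compl (walk ι n x y 0), walk ι n x y (0 + 1)} : Finset (Literal V)) =
        {intLit ι (x : ℤ), intLit ι 1} := by
      rw [w₀, intLit_neg ι h₁, compl_compl, w (0 + 1) (by omega) (by omega)]
      rfl
    have e₃ : ({compl (walk ι n x y n), walk ι n x y (n + 1)} : Finset (Literal V)) =
        {intLit ι (-(n : ℤ)), intLit ι (-(y : ℤ))} := by
      rw [w₁, w n (by omega) le_rfl, intLit_neg ι (show 1 ≤ n by omega)]
    ext C
    simp only [Finset.mem_union, chain, Finset.mem_image, Finset.mem_Icc, Finset.mem_insert,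
      Finset.mem_singleton, Finset.mem_range]
    constructor
    · rintro (⟨k, ⟨hk, hk'⟩, rfl⟩ | rfl | rfl)
      · exact ⟨k, by omega, e₁ k hk (by omega)⟩
      · exact ⟨0, by omega, e₂⟩
      · exact ⟨n, by omega, e₃⟩
    · rintro ⟨k, hk, rfl⟩
      rcases Nat.eq_zero_or_pos k with rfl | hk0
      · exact .inr (.inl e₂)
      · rcases Nat.lt_or_ge k n with hkn | hkn
        · exact .inl ⟨k, ⟨hk0, by omega⟩, (e₁ k hk0 hkn).symm⟩
        · obtain rfl : k = n := by omega
          exact .inr (.inr e₃)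

end Pattern

open Classical in
/-- The pattern that belongs to the normalised parameters of a chain form. -/
noncomputable def typeOf (F : ClauseSet V) : Pattern :=
  if h : ∃ q : ℕ × ℕ × ℕ, q.2.1 + q.2.2 ≤ q.1 + 1 ∧ ∃ φ, ChainForm F q.1 q.2.1 q.2.2 φ then
    Pattern.ofTriple h.choose.1 h.choose.2.1 h.choose.2.2
  else Pattern.U2 0

variable {F F' : ClauseSet V} {n x y n' x' y' : ℕ} {φ φ' : ℕ → Literal V}

/-- The choice in `typeOf` does not matter, since normalised parameters are unique. -/
theorem ChainForm.typeOf_eq (h : ChainForm F n x y φ) (hxy : x + y ≤ n + 1) :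
    typeOf F = Pattern.ofTriple n x y := by
  have hq : ∃ q : ℕ × ℕ × ℕ, q.2.1 + q.2.2 ≤ q.1 + 1 ∧ ∃ φ, ChainForm F q.1 q.2.1 q.2.2 φ :=
    ⟨(n, x, y), hxy, φ, h⟩
  obtain ⟨h', φ', hφ'⟩ := hq.choose_spec
  obtain ⟨e₁, e₂, e₃⟩ := h.graphForm.params_unique hφ'.graphForm hxy h'
  rw [typeOf, dif_pos hq, e₁, e₂, e₃]

theorem IsTwoMUDefOne.exists_normal (h : IsTwoMUDefOne F) :
    ∃ x y φ, x + y ≤ (vars F).card + 1 ∧ ChainForm F (vars F).card x y φ := by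
  obtain ⟨x, y, φ, hφ⟩ := h.exists_chainForm
  exact hφ.exists_normal

theorem ChainForm.iso_iff (h : ChainForm F n x y φ) (h' : ChainForm F' n' x' y' φ')
    (hxy : x + y ≤ n + 1) (hxy' : x' + y' ≤ n' + 1) :
    Iso F F' ↔ n' = n ∧ x' = x ∧ y' = y :=
  ⟨h.eq_of_iso h' hxy hxy', by rintro ⟨rfl, rfl, rfl⟩; exact h.iso h'⟩

theorem ChainForm.graphIso_iff (h : ChainForm F n x y φ) (h' : ChainForm F' n' x' y' φ')
    (hxy : x + y ≤ n + 1) (hxy' : x' + y' ≤ n' + 1) :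
    GraphIso (ig F) (ig F') ↔ n' = n ∧ x' = x ∧ y' = y :=
  ⟨h.eq_of_graphIso h' hxy hxy', by rintro ⟨rfl, rfl, rfl⟩; exact h.graphForm.graphIso h'.graphForm⟩

theorem Pattern.Valid.iso_iff (ι : ℕ+ ↪ V) {T : Pattern} (hT : T.Valid) (h : ChainForm F n x y φ)
    (hxy : x + y ≤ n + 1) : Iso F (T.clauseSet ι) ↔ T = ofTriple n x y := by
  rw [h.iso_iff (chainForm ι hT) hxy hT.bounds.2.2.2]
  obtain ⟨-, e₁, e₂, e₃⟩ := valid_ofTriple h.one_le h.le h.le_size hxy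
  constructor
  · rintro ⟨rfl, rfl, rfl⟩
    exact hT.eq_ofTriple
  · rintro rfl
    exact ⟨e₁, e₂, e₃⟩

theorem existsUnique_pattern (ι : ℕ+ ↪ V) (hF : IsTwoMUDefOne F) :
    ∃! T : Pattern, T.Valid ∧ Iso F (T.clauseSet ι) := by
  obtain ⟨x, y, φ, hxy, h⟩ := hF.exists_normal
  have hv := (Pattern.valid_ofTriple h.one_le h.le h.le_size hxy).1
  exact ⟨_, ⟨hv, (hv.iso_iff ι h hxy).2 rfl⟩, fun T hT => (hT.1.iso_iff ι h hxy).1 hT.2⟩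

theorem typeOf_spec (ι : ℕ+ ↪ V) (hF : IsTwoMUDefOne F) :
    (typeOf F).Valid ∧ Iso F ((typeOf F).clauseSet ι) ∧ (typeOf F).Applies F ∧
      (typeOf F).upper = unitCount F ∧ (typeOf F).size = (vars F).card := by
  obtain ⟨x, y, φ, hxy, h⟩ := hF.exists_normal
  rw [h.typeOf_eq hxy]
  obtain ⟨hv, e, -, -⟩ := Pattern.valid_ofTriple h.one_le h.le h.le_size hxy
  refine ⟨hv, (hv.iso_iff ι h hxy).2 rfl, ?_, ?_, e⟩
  · have h₁ := h.one_le
    have h₂ := h.le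
    have hu := h.unitCount_eq
    have hd := h.exists_litDegree_iff
    unfold Pattern.ofTriple
    split_ifs with e₁ e₂ e₂ <;> simp only [Pattern.Applies]
    · simpa [e₁, e₂] using hu
    · simpa [e₁, e₂] using hu
    · rw [if_neg e₁, if_neg (by omega)] at hu
      exact ⟨hu, (hd (by omega) (by omega)).2 e₂⟩
    · rw [if_neg e₁, if_neg (by omega)] at hu
      exact ⟨hu, fun q => e₂ ((hd (by omega) (by omega)).1 q)⟩
  · have h₁ := h.one_le
    have h₂ := h.le
    rw [h.unitCount_eq]
    unfold Pattern.ofTriple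
    split_ifs <;> simp only [Pattern.upper] <;> omega

theorem typeOf_eq_iff (hF : IsTwoMUDefOne F) (hF' : IsTwoMUDefOne F') :
    typeOf F = typeOf F' ↔ Iso F F' := by
  obtain ⟨x, y, φ, hxy, h⟩ := hF.exists_normal
  obtain ⟨x', y', φ', hxy', h'⟩ := hF'.exists_normal
  rw [h.typeOf_eq hxy, h'.typeOf_eq hxy', h.iso_iff h' hxy hxy']
  obtain ⟨-, e₁, e₂, e₃⟩ := Pattern.valid_ofTriple h.one_le h.le h.le_size hxy
  obtain ⟨-, e₁', e₂', e₃'⟩ := Pattern.valid_ofTriple h'.one_le h'.le h'.le_size hxy'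
  constructor
  · intro e
    rw [← e] at e₁' e₂' e₃'
    omega
  · rintro ⟨q₁, q₂, q₃⟩
    rw [q₁, q₂, q₃]

theorem iso_iff_graphIso (hF : IsTwoMUDefOne F) (hF' : IsTwoMUDefOne F') :
    Iso F F' ↔ GraphIso (ig F) (ig F') := by
  obtain ⟨x, y, φ, hxy, h⟩ := hF.exists_normal
  obtain ⟨x', y', φ', hxy', h'⟩ := hF'.exists_normal
  rw [h.iso_iff h' hxy hxy', h.graphIso_iff h' hxy hxy']

theorem iso_iff_ig_eq (ι : ℕ+ ↪ V) (hF : IsTwoMUDefOne F) (hF' : IsTwoMUDefOne F') :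
    Iso F F' ↔ ig ((typeOf F).clauseSet ι) = ig ((typeOf F').clauseSet ι) := by
  refine ⟨fun i => by rw [(typeOf_eq_iff hF hF').2 i], fun e => ?_⟩
  have hv := (typeOf_spec ι hF).1
  have hv' := (typeOf_spec ι hF').1
  rw [← typeOf_eq_iff hF hF', hv.eq_ofTriple, hv'.eq_ofTriple]
  have g := (Pattern.chainForm ι hv).graphForm
  rw [e] at g
  obtain ⟨e₁, e₂, e₃⟩ := g.params_unique (Pattern.chainForm ι hv').graphForm hv.bounds.2.2.2
    hv'.bounds.2.2.2
  rw [e₁, e₂, e₃]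

theorem iso_iff_clauseSet_eq (ι : ℕ+ ↪ V) (hF : IsTwoMUDefOne F) (hF' : IsTwoMUDefOne F') :
    Iso F F' ↔ (typeOf F).clauseSet ι = (typeOf F').clauseSet ι :=
  ⟨fun i => by rw [(typeOf_eq_iff hF hF').2 i], fun e =>
    (iso_iff_ig_eq ι hF hF').2 (by rw [e])⟩

end Bridge
end TwoMU

namespace TwoMU
open Computability (Γ')

/-! ### Formulas over a string -/

theorem count_congr {p q : ℕ → Prop} [DecidablePred p] [DecidablePred q] (h : ∀ k, p k ↔ q k)
    (N : ℕ) : Nat.count p N = Nat.count q N := by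
  simp only [Nat.count_eq_card_filter_range, h]

namespace Arith

variable {w : List Γ'} {ρ : ℕ → ℕ}

/-- Truth of an expression that is used as a formula. -/
def Sat (w : List Γ') (a : Arith) (ρ : ℕ → ℕ) : Prop := a.val w ρ ≠ 0

/-- Negation. -/
def not (a : Arith) : Arith := ite a (const 0) (const 1)

/-- Conjunction. -/
def and (a b : Arith) : Arith := ite a b (const 0)

/-- Disjunction. -/
def or (a b : Arith) : Arith := ite a (const 1) b

/-- Equivalence. -/
def iff (a b : Arith) : Arith := ite a b (not b)

/-- Existential quantification over the positions. -/
def ex (a : Arith) : Arith := cnt a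

/-- Universal quantification over the positions. -/
def all (a : Arith) : Arith := not (cnt (not a))

/-- The relation `<`. -/
def lt (a b : Arith) : Arith := sub b a

/-- The relation `≤`. -/
def le (a b : Arith) : Arith := not (sub a b)

/-- Equality of numbers. -/
def eq (a b : Arith) : Arith := and (le a b) (le b a)

@[simp] theorem sat_not (a : Arith) : Sat w (not a) ρ ↔ ¬ Sat w a ρ := by
  unfold Sat not
  simp only [val]
  split_ifs <;> simp_all

@[simp] theorem sat_and (a b : Arith) : Sat w (and a b) ρ ↔ Sat w a ρ ∧ Sat w b ρ := by
  unfold Sat and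
  simp only [val]
  split_ifs <;> simp_all

@[simp] theorem sat_or (a b : Arith) : Sat w (or a b) ρ ↔ Sat w a ρ ∨ Sat w b ρ := by
  unfold Sat or
  simp only [val]
  split_ifs <;> simp_all

@[simp] theorem sat_iff (a b : Arith) : Sat w (iff a b) ρ ↔ (Sat w a ρ ↔ Sat w b ρ) := by
  have hn := sat_not (w := w) (ρ := ρ) b
  unfold Sat at hn ⊢
  simp only [iff, val]
  split_ifs with h
  · simp [h]
  · rw [hn]
    simp [h]

@[simp] theorem sat_ex (a : Arith) :
    Sat w (ex a) ρ ↔ ∃ k < w.length, Sat w a (cons k ρ) := by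
  unfold Sat ex
  simp only [val, Nat.count_eq_card_filter_range, Finset.card_ne_zero, Finset.Nonempty,
    Finset.mem_filter, Finset.mem_range]

@[simp] theorem sat_all (a : Arith) :
    Sat w (all a) ρ ↔ ∀ k < w.length, Sat w a (cons k ρ) := by
  have := sat_ex (w := w) (ρ := ρ) (not a)
  unfold all
  rw [sat_not]
  change ¬ Sat w (ex (not a)) ρ ↔ _
  rw [this]
  push Not
  simp

@[simp] theorem sat_lt (a b : Arith) : Sat w (lt a b) ρ ↔ a.val w ρ < b.val w ρ := by
  unfold Sat lt
  simp only [val]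
  omega

@[simp] theorem sat_le (a b : Arith) : Sat w (le a b) ρ ↔ a.val w ρ ≤ b.val w ρ := by
  unfold le
  rw [sat_not]
  unfold Sat
  simp only [val]
  omega

@[simp] theorem sat_eq (a b : Arith) : Sat w (eq a b) ρ ↔ a.val w ρ = b.val w ρ := by
  unfold eq
  simp only [sat_and, sat_le]
  omega

@[simp] theorem sat_sym (s : Γ') (p : Arith) :
    Sat w (sym s p) ρ ↔ w[p.val w ρ]? = some s := by
  unfold Sat
  simp only [val]
  split_ifs <;> simp_all

/-! #### Parameters of a graph -/

section Params

variable {adj : ℕ → ℕ → Prop} {vert : ℕ → Prop} {A : ℕ → ℕ → Arith} {B : ℕ → Arith}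

/-- The vertex with index `i` is branching. -/
def branch (A : ℕ → ℕ → Arith) (i : ℕ) : Arith :=
  ex (ex (ex (and (A (i + 3) 2) (and (A (i + 3) 1) (and (A (i + 3) 0)
    (and (not (eq (var 2) (var 1))) (and (not (eq (var 2) (var 0)))
      (not (eq (var 1) (var 0))))))))))

theorem sat_branch (hA : ∀ i j ρ, Sat w (A i j) ρ ↔ adj (ρ i) (ρ j))
    (hw : ∀ p q, adj p q → q < w.length) (i : ℕ) : Sat w (branch A i) ρ ↔ Branch adj (ρ i) := by
  simp only [branch, sat_ex, sat_and, hA, sat_not, sat_eq, val, Branch]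
  change (∃ b < w.length, ∃ c < w.length, ∃ d < w.length, adj (ρ i) b ∧ adj (ρ i) c ∧
    adj (ρ i) d ∧ ¬ b = c ∧ ¬ b = d ∧ ¬ c = d) ↔ _
  constructor
  · rintro ⟨b, -, c, -, d, -, h⟩
    exact ⟨b, c, d, h⟩
  · rintro ⟨b, c, d, h⟩
    exact ⟨b, hw _ _ h.1, c, hw _ _ h.2.1, d, hw _ _ h.2.2.1, h⟩

/-- The vertex reached after `t` steps by the walk starting with the vertices with indices
`i`, `j`. -/
def walk (A : ℕ → ℕ → Arith) (t : Arith) (i j : ℕ) : Arith :=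
  rec2 t i j (ex (and (A 2 0) (and (not (eq (var 0) (var 3))) (lt (var 1) (var 0)))))

/-- The recursion `rec2` iterates counters only; this is why `walkStep` was phrased as a counter. -/
theorem val_walk (hA : ∀ i j ρ, Sat w (A i j) ρ ↔ adj (ρ i) (ρ j)) (t : Arith) (i j : ℕ) :
    (walk A t i j).val w ρ = TwoMU.walk adj w.length (ρ i) (ρ j) (t.val w ρ) := by
  simp only [walk, val, TwoMU.walk]
  congr 2
  funext q
  refine Prod.ext rfl ?_
  simp only [walkStep]
  classical
  apply count_congr
  intro u
  change Sat w (ex _) _ ↔ _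
  simp only [sat_ex, sat_and, hA, sat_not, sat_eq, sat_lt, val]
  rfl

/-- A branching vertex is reached after `t` steps. -/
def branchAt (A : ℕ → ℕ → Arith) (t i j : ℕ) : Arith :=
  ex (and (eq (var 0) (walk A (var (t + 1)) (i + 1) (j + 1))) (branch A 0))

/-- Adjacency formulas speak about variables, so the end of the walk is first bound to a variable by
a quantifier. Its range suffices, since branching vertices are positions of the string. -/
theorem sat_branchAt (hA : ∀ i j ρ, Sat w (A i j) ρ ↔ adj (ρ i) (ρ j))
    (hw : ∀ p q, adj p q → p < w.length ∧ q < w.length) (t i j : ℕ) : Sat w (branchAt A t i j) ρ ↔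
      Branch adj (TwoMU.walk adj w.length (ρ i) (ρ j) (ρ t)) := by
  simp only [branchAt, sat_ex, sat_and, sat_eq, val_walk hA, val,
    sat_branch hA fun p q h => (hw p q h).2, cons_zero, cons_succ]
  constructor
  · rintro ⟨k, -, rfl, h⟩
    exact h
  · exact fun h => ⟨_, (hw _ _ h.choose_spec.choose_spec.choose_spec.1).1, rfl, h⟩

/-- The first branching vertex is reached after `t` steps. -/
def firstBranch (A : ℕ → ℕ → Arith) (t i j : ℕ) : Arith :=
  and (le (const 1) (var t)) (and (branchAt A t i j)
    (all (or (not (lt (var 0) (var (t + 1)))) (or (not (le (const 1) (var 0)))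
      (not (branchAt A 0 (i + 1) (j + 1)))))))

theorem sat_firstBranch (hA : ∀ i j ρ, Sat w (A i j) ρ ↔ adj (ρ i) (ρ j))
    (hw : ∀ p q, adj p q → p < w.length ∧ q < w.length) {t : ℕ} (ht : ρ t < w.length) (i j : ℕ) :
    Sat w (firstBranch A t i j) ρ ↔ FirstBranch adj w.length (ρ i) (ρ j) (ρ t) := by
  simp only [firstBranch, sat_and, sat_le, sat_all, sat_or, sat_not, sat_lt, val,
    sat_branchAt hA hw, cons_zero, cons_succ, FirstBranch]
  refine and_congr_right fun _ => and_congr_right fun _ => forall_congr' fun k => ?_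
  constructor
  · intro h hk hk'
    have := h (by omega)
    tauto
  · intro h _
    by_cases hk : k < ρ t
    · have := h hk
      tauto
    · exact .inl hk

/-- Two walks from a branching vertex reach their first branching vertices after `t` steps. -/
def twinWalks (A : ℕ → ℕ → Arith) (t : ℕ) : Arith :=
  ex (ex (ex (and (branch A 2) (and (A 2 1) (and (A 2 0) (and (not (eq (var 1) (var 0)))
    (and (firstBranch A (t + 3) 2 1) (firstBranch A (t + 3) 2 0))))))))

theorem sat_twinWalks (hA : ∀ i j ρ, Sat w (A i j) ρ ↔ adj (ρ i) (ρ j))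
    (hw : ∀ p q, adj p q → p < w.length ∧ q < w.length) {t : ℕ} (ht : ρ t < w.length) :
    Sat w (twinWalks A t) ρ ↔ TwinWalks adj w.length (ρ t) := by
  simp only [twinWalks, sat_ex, sat_and, sat_branch hA fun p q h => (hw p q h).2, hA, sat_not,
    sat_eq, val]
  have hf : ∀ a b c i j, Sat w (firstBranch A (t + 3) i j) (cons c (cons b (cons a ρ))) ↔
      FirstBranch adj w.length (cons c (cons b (cons a ρ)) i) (cons c (cons b (cons a ρ)) j)
        (ρ t) := fun a b c i j =>
    sat_firstBranch hA hw (ρ := cons c (cons b (cons a ρ))) (t := t + 3) ht i j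
  simp only [hf]
  constructor
  · rintro ⟨a, -, b, -, c, -, h⟩
    exact ⟨a, b, c, h⟩
  · rintro ⟨a, b, c, h⟩
    exact ⟨a, (hw _ _ h.2.1).1, b, (hw _ _ h.2.1).2, c, (hw _ _ h.2.2.1).2, h⟩

/-- There is a vertex with four neighbours, or there are three branching vertices. -/
def manyBranches (A : ℕ → ℕ → Arith) : Arith :=
  or (ex (ex (ex (ex (ex (and (A 4 3) (and (A 4 2) (and (A 4 1) (and (A 4 0)
      (and (not (eq (var 3) (var 2))) (and (not (eq (var 3) (var 1)))
      (and (not (eq (var 3) (var 0))) (and (not (eq (var 2) (var 1)))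
      (and (not (eq (var 2) (var 0))) (not (eq (var 1) (var 0)))))))))))))))))
    (ex (ex (ex (and (branch A 2) (and (branch A 1) (and (branch A 0)
      (and (not (eq (var 2) (var 1))) (and (not (eq (var 2) (var 0)))
      (not (eq (var 1) (var 0)))))))))))

theorem sat_manyBranches (hA : ∀ i j ρ, Sat w (A i j) ρ ↔ adj (ρ i) (ρ j))
    (hw : ∀ p q, adj p q → p < w.length ∧ q < w.length) :
    Sat w (manyBranches A) ρ ↔ ManyBranches adj := by
  simp only [manyBranches, sat_or, sat_ex, sat_and, sat_branch hA fun p q h => (hw p q h).2, hA,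
    sat_not, sat_eq, val]
  have hb : ∀ p, Branch adj p → p < w.length := fun p h =>
    (hw _ _ h.choose_spec.choose_spec.choose_spec.1).1
  refine or_congr ⟨?_, ?_⟩ ⟨?_, ?_⟩
  · rintro ⟨a, -, b, -, c, -, d, -, e, -, h⟩
    exact ⟨a, b, c, d, e, h⟩
  · rintro ⟨a, b, c, d, e, h⟩
    exact ⟨a, (hw _ _ h.1).1, b, (hw _ _ h.1).2, c, (hw _ _ h.2.1).2, d, (hw _ _ h.2.2.1).2, e,
      (hw _ _ h.2.2.2.1).2, h⟩
  · rintro ⟨a, -, b, -, c, -, h⟩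
    exact ⟨a, b, c, h⟩
  · rintro ⟨a, b, c, h⟩
    exact ⟨a, hb _ h.1, b, hb _ h.2.1, c, hb _ h.2.2.1, h⟩

/-- The variables with indices `2`, `1`, `0` are the parameters of the graph. -/
def hasParams (A : ℕ → ℕ → Arith) (B : ℕ → Arith) : Arith :=
  and (eq (cnt (B 0)) (add (var 2) (var 2))) (and (le (const 1) (var 1)) (and (le (var 1) (var 0))
    (and (le (var 0) (var 2)) (and (le (add (var 1) (var 0)) (add (var 2) (const 1)))
    (and (all (iff (twinWalks A 0) (or (and (eq (var 0) (var 2)) (le (const 2) (var 2)))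
      (and (eq (add (var 0) (var 1)) (add (var 3) (const 1))) (lt (var 1) (var 3))))))
    (iff (manyBranches A) (le (const 2) (var 1))))))))

theorem sat_hasParams (hA : ∀ i j ρ, Sat w (A i j) ρ ↔ adj (ρ i) (ρ j))
    (hB : ∀ i ρ, Sat w (B i) ρ ↔ vert (ρ i))
    (hw : ∀ p q, adj p q → p < w.length ∧ q < w.length) (n x y : ℕ) :
    Sat w (hasParams A B) (cons y (cons x (cons n ρ))) ↔ HasParams vert adj w.length n x y := by
  classical
  simp only [hasParams, sat_and, sat_eq, sat_le, sat_all, sat_iff, sat_or, sat_lt, val,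
    sat_manyBranches hA hw, HasParams]
  have e : Nat.count (fun k => val w (B 0) (cons k (cons y (cons x (cons n ρ)))) ≠ 0) w.length =
      Nat.count vert w.length := by
    apply count_congr
    exact fun k => hB 0 _
  rw [e, two_mul]
  refine and_congr_right fun _ => and_congr_right fun _ => and_congr_right fun _ =>
    and_congr_right fun _ => and_congr_right fun _ => and_congr ?_ Iff.rfl
  refine forall_congr' fun L => forall_congr' fun hL => ?_
  rw [sat_twinWalks hA hw (ρ := cons L (cons y (cons x (cons n ρ)))) (t := 0) hL]
  rfl

end Params

end Arith

/-! ### Tokens of a string -/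

/-- The longest prefix consisting of bits. -/
def bitsPrefix : List Γ' → List Bool
  | Γ'.bit b :: l => b :: bitsPrefix l
  | _ => []

theorem getElem?_bitsPrefix (u : List Γ') (j : ℕ) (b : Bool) : (bitsPrefix u)[j]? = some b ↔
    (∀ i < j, u[i]? = some (Γ'.bit true) ∨ u[i]? = some (Γ'.bit false)) ∧
      u[j]? = some (Γ'.bit b) := by
  induction u generalizing j with
  | nil => simp [bitsPrefix]
  | cons s u ih =>
    rcases j with - | j
    · cases s <;> simp [bitsPrefix]
    · cases s with
      | bit c =>
        simp only [bitsPrefix, List.getElem?_cons_succ, ih]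
        refine and_congr ⟨fun h i hi => ?_, fun h i hi => h (i + 1) (by omega)⟩ Iff.rfl
        rcases i with - | i
        · cases c <;> simp
        · exact h i (by omega)
      | _ =>
        simp only [bitsPrefix, List.getElem?_nil, reduceCtorEq, false_iff, not_and]
        intro h
        have := h 0 (by omega)
        simp at this

/-- The bits that follow the position `p`. -/
def token (w : List Γ') (p : ℕ) : List Bool := bitsPrefix (w.drop (p + 1))

theorem token_cons {w : List Γ'} {p : ℕ} {b : Bool} {t : List Bool} (h : token w p = b :: t) :
    w[p + 1]? = some (Γ'.bit b) ∧ token w (p + 1) = t := by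
  unfold token at *
  have e : w[p + 1]? = (w.drop (p + 1))[0]? := by simp
  have e' : w.drop (p + 1 + 1) = (w.drop (p + 1)).tail := by simp
  rw [e, e']
  cases hd : w.drop (p + 1) with
  | nil => simp [hd, bitsPrefix] at h
  | cons s u =>
    rw [hd] at h
    cases s <;> simp_all [bitsPrefix]

/-- The number of closing brackets before the position `p`. -/
def blockIndex (w : List Γ') (p : ℕ) : ℕ := (w.take p).count Γ'.ket

namespace Arith

variable {w : List Γ'} {ρ : ℕ → ℕ}

/-- The bit with index `0` after position number `i` plus `o` exists and equals `b`. -/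
def tokenBit (o i : ℕ) (b : Bool) : Arith :=
  and (all (or (not (lt (var 0) (var 1)))
    (or (sym (Γ'.bit true) (add (add (var (i + 1)) (const (o + 1))) (var 0)))
      (sym (Γ'.bit false) (add (add (var (i + 1)) (const (o + 1))) (var 0))))))
    (sym (Γ'.bit b) (add (add (var i) (const (o + 1))) (var 0)))

theorem sat_tokenBit (o i : ℕ) (b : Bool) {k : ℕ} (hk : k < w.length) :
    Sat w (tokenBit o (i + 1) b) (cons k ρ) ↔ (token w (ρ i + o))[k]? = some b := by
  simp only [tokenBit, sat_and, sat_all, sat_or, sat_not, sat_lt, sat_sym, val, cons_zero,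
    cons_succ, token, getElem?_bitsPrefix, List.getElem?_drop, Nat.add_assoc]
  refine and_congr ⟨fun h j hj => ?_, fun h j hj => ?_⟩ Iff.rfl
  · have := h j (by omega)
    tauto
  · by_cases hjk : j < k
    · exact .inr (h j hjk)
    · exact .inl hjk

/-- Equality of the tokens after two positions, plus `o`. -/
def tokenEq (o i j : ℕ) : Arith :=
  all (and (iff (tokenBit o (i + 1) true) (tokenBit o (j + 1) true))
    (iff (tokenBit o (i + 1) false) (tokenBit o (j + 1) false)))

/-- Tokens are parts of the string, so comparing their bits at all indices below its length is
enough. -/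
theorem sat_tokenEq (o i j : ℕ) :
    Sat w (tokenEq o i j) ρ ↔ token w (ρ i + o) = token w (ρ j + o) := by
  simp only [tokenEq, sat_all, sat_and, sat_iff]
  have hlen : ∀ p k b, (token w p)[k]? = some b → k < w.length := by
    intro p k b h
    rw [token, getElem?_bitsPrefix, List.getElem?_drop] at h
    have := (List.getElem?_eq_some_iff.1 h.2).1
    omega
  constructor
  · intro h
    refine List.ext_getElem? fun k => Option.ext fun b => ?_
    by_cases hk : k < w.length
    · have := h k hk
      simp only [sat_tokenBit _ _ _ hk] at this
      cases b
      exacts [this.2, this.1]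
    · exact ⟨fun e => absurd (hlen _ _ _ e) hk, fun e => absurd (hlen _ _ _ e) hk⟩
  · intro h k hk
    simp only [sat_tokenBit _ _ _ hk, h]
    simp

/-- The tokens after two positions are complementary literals. -/
def tokenCompl (i j : ℕ) : Arith :=
  and (tokenEq 1 i j) (not (iff (sym (Γ'.bit true) (add (var i) (const 1)))
    (sym (Γ'.bit true) (add (var j) (const 1)))))

/-- The offset `1` skips the sign, which is the first bit of the name of a literal. -/
theorem sat_tokenCompl {i j : ℕ} {b c : Bool} {s t : List Bool} (hi : token w (ρ i) = b :: s)
    (hj : token w (ρ j) = c :: t) : Sat w (tokenCompl i j) ρ ↔ b = !c ∧ s = t := by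
  obtain ⟨hi₁, hi₂⟩ := token_cons hi
  obtain ⟨hj₁, hj₂⟩ := token_cons hj
  simp only [tokenCompl, sat_and, sat_tokenEq, sat_not, sat_iff, sat_sym, val, hi₁, hj₁, hi₂, hj₂]
  cases b <;> cases c <;> simp

/-- Two positions belong to the same block. -/
def sameBlock (i j : ℕ) : Arith :=
  eq (cnt (and (lt (var 0) (var (i + 1))) (sym Γ'.ket (var 0))))
    (cnt (and (lt (var 0) (var (j + 1))) (sym Γ'.ket (var 0))))

theorem count_ket (p : ℕ) : Nat.count (fun k => k < p ∧ w[k]? = some Γ'.ket) w.length =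
    blockIndex w p := by
  unfold blockIndex
  induction w using List.reverseRecOn generalizing p with
  | nil => simp
  | append_singleton w s ih =>
    rw [List.length_append, List.length_singleton, Nat.count_succ]
    have e : Nat.count (fun k => k < p ∧ (w ++ [s])[k]? = some Γ'.ket) w.length =
        Nat.count (fun k => k < p ∧ w[k]? = some Γ'.ket) w.length := by
      rw [Nat.count_eq_card_filter_range, Nat.count_eq_card_filter_range]
      congr 1
      refine Finset.filter_congr fun k hk => ?_
      rw [List.getElem?_append_left (Finset.mem_range.1 hk)]
    rw [e, ih, List.take_append, List.count_append]
    congr 1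
    rw [List.getElem?_append_right le_rfl, Nat.sub_self]
    rcases Nat.lt_or_ge w.length p with h | h
    · obtain ⟨m, rfl⟩ : ∃ m, p = w.length + 1 + m := ⟨p - (w.length + 1), by omega⟩
      rw [show w.length + 1 + m - w.length = m + 1 by omega]
      cases s <;> simp
      omega
    · rw [Nat.sub_eq_zero_of_le h, if_neg (by omega)]
      simp

theorem sat_sameBlock (i j : ℕ) :
    Sat w (sameBlock i j) ρ ↔ blockIndex w (ρ i) = blockIndex w (ρ j) := by
  have key : ∀ i, (cnt (and (lt (var 0) (var (i + 1))) (sym Γ'.ket (var 0)))).val w ρ =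
      blockIndex w (ρ i) := by
    intro i
    rw [← count_ket]
    refine count_congr (fun k => ?_) _
    change Sat w _ _ ↔ _
    simp [val]
  simp only [sameBlock, sat_eq, key]

/-- The first position with separator `s` and its token. -/
def firstToken (s : Γ') (i : ℕ) : Arith :=
  and (sym s (var i)) (all (or (not (lt (var 0) (var (i + 1))))
    (or (not (sym s (var 0))) (not (tokenEq 0 0 (i + 1))))))

end Arith

/-- The position is the first one with separator `s` and its token. -/
def IsFirst (w : List Γ') (s : Γ') (p : ℕ) : Prop :=
  w[p]? = some s ∧ ∀ q < p, w[q]? = some s → token w q ≠ token w p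

theorem IsFirst.lt_length {w : List Γ'} {s : Γ'} {p : ℕ} (h : IsFirst w s p) : p < w.length :=
  (List.getElem?_eq_some_iff.1 h.1).1

theorem Arith.sat_firstToken {w : List Γ'} {ρ : ℕ → ℕ} (s : Γ') (i : ℕ) :
    Sat w (firstToken s i) ρ ↔ IsFirst w s (ρ i) := by
  simp only [firstToken, sat_and, sat_all, sat_or, sat_not, sat_lt, sat_sym, sat_tokenEq, val,
    cons_zero, cons_succ, IsFirst, Nat.add_zero]
  refine and_congr_right fun hi => ⟨fun h q hq hs => ?_, fun h q _ => ?_⟩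
  · have := h q (List.getElem?_eq_some_iff.1 hs).1
    tauto
  · have := h q
    tauto

end TwoMU

namespace TwoMU
open Computability (Γ')

/-! ### Strings made of blocks of tokens -/

section Blocks

/-- The string of a list of separators that are followed by bit-strings. -/
def itemString (E : List (Γ' × List Bool)) : List Γ' := E.flatMap fun e => e.1 :: encBits e.2

/-- The string of a list of blocks, each of which is closed by a bracket. -/
def blockString (Bs : List (List (Γ' × List Bool))) : List Γ' :=
  itemString (Bs.flatMap fun B => B ++ [(Γ'.ket, [])])

theorem itemString_append (E E' : List (Γ' × List Bool)) :
    itemString (E ++ E') = itemString E ++ itemString E' := List.flatMap_append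

theorem itemString_cons (e : Γ' × List Bool) (E : List (Γ' × List Bool)) :
    itemString (e :: E) = e.1 :: (encBits e.2 ++ itemString E) := by simp [itemString]

/-- A symbol that is not a bit cannot be inside a name, so it is the separator that opens an item.
-/
theorem exists_split_of_getElem? {E : List (Γ' × List Bool)} {p : ℕ} {s : Γ'}
    (hs : ∀ b, s ≠ Γ'.bit b) (h : (itemString E)[p]? = some s) :
    ∃ E₁ t E₂, E = E₁ ++ (s, t) :: E₂ ∧ (itemString E₁).length = p := by
  induction E generalizing p with
  | nil => simp [itemString] at h
  | cons e E ih =>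
    rw [itemString_cons] at h
    rcases p with - | p
    · simp only [List.getElem?_cons_zero, Option.some.injEq] at h
      exact ⟨[], e.2, E, by rw [← h]; rfl, rfl⟩
    · rw [List.getElem?_cons_succ] at h
      rcases Nat.lt_or_ge p (encBits e.2).length with hp | hp
      · rw [List.getElem?_append_left hp] at h
        simp only [encBits, List.getElem?_map, Option.map_eq_some_iff] at h
        obtain ⟨b, -, hb⟩ := h
        exact absurd hb.symm (hs b)
      · rw [List.getElem?_append_right hp] at h
        obtain ⟨E₁, t, E₂, rfl, hl⟩ := ih h
        refine ⟨e :: E₁, t, E₂, rfl, ?_⟩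
        rw [itemString_cons, List.length_cons, List.length_append, hl]
        omega

variable {E₁ E₂ : List (Γ' × List Bool)} {s : Γ'} {t : List Bool}

theorem getElem?_itemString :
    (itemString (E₁ ++ (s, t) :: E₂))[(itemString E₁).length]? = some s := by
  rw [itemString_append, itemString_cons, List.getElem?_append_right le_rfl, Nat.sub_self]
  rfl

theorem token_itemString (h : ∀ e ∈ E₂, ∀ b, e.1 ≠ Γ'.bit b) :
    token (itemString (E₁ ++ (s, t) :: E₂)) (itemString E₁).length = t := by
  have e : (itemString (E₁ ++ (s, t) :: E₂)).drop ((itemString E₁).length + 1) =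
      encBits t ++ itemString E₂ := by
    rw [itemString_append, itemString_cons, List.drop_append]
    simp
  unfold token
  rw [e]
  induction t with
  | nil =>
    rcases E₂ with - | ⟨⟨r, u⟩, E₂⟩
    · rfl
    · have := h (r, u) (by simp)
      rw [itemString_cons]
      cases r <;> simp_all [encBits, bitsPrefix]
  | cons b t ih => exact congrArg (b :: ·) (ih (by
      rw [itemString_append, itemString_cons, List.drop_append]
      simp))

theorem blockIndex_itemString :
    blockIndex (itemString (E₁ ++ (s, t) :: E₂)) (itemString E₁).length =
      (E₁.map Prod.fst).count Γ'.ket := by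
  unfold blockIndex
  rw [itemString_append, List.take_left']
  · induction E₁ with
    | nil => rfl
    | cons e E ih =>
      have : (encBits e.2).count Γ'.ket = 0 := by
        simp [List.count_eq_zero, encBits]
      rw [itemString_cons, List.map_cons, List.count_cons, List.count_cons, List.count_append, ih,
        this, Nat.zero_add]
  · rfl

/-- The separators of the items of blocks. -/
def IsSep (s : Γ') : Prop := s = Γ'.bra ∨ s = Γ'.comma

theorem IsSep.ne_ket (h : IsSep s) : s ≠ Γ'.ket := by
  rcases h with rfl | rfl <;> simp

theorem IsSep.ne_bit (h : IsSep s) (b : Bool) : s ≠ Γ'.bit b := by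
  rcases h with rfl | rfl <;> simp

variable {Bs : List (List (Γ' × List Bool))}

theorem ne_bit_of_mem_blocks (hBs : ∀ B ∈ Bs, ∀ e ∈ B, IsSep e.1) :
    ∀ e ∈ Bs.flatMap (fun B => B ++ [(Γ'.ket, [])]), ∀ b, e.1 ≠ Γ'.bit b := by
  intro e he
  obtain ⟨B, hB, he⟩ := List.mem_flatMap.1 he
  rcases List.mem_append.1 he with he | he
  · exact (hBs B hB e he).ne_bit
  · obtain rfl := List.mem_singleton.1 he
    simp

theorem count_ket_eq_zero {B : List (Γ' × List Bool)} (h : ∀ e ∈ B, IsSep e.1) :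
    (B.map Prod.fst).count Γ'.ket = 0 := by
  rw [List.count_eq_zero]
  intro hm
  obtain ⟨e, he, q⟩ := List.mem_map.1 hm
  exact (h e he).ne_ket q

theorem getElem?_of_split (hBs : ∀ B ∈ Bs, ∀ e ∈ B, IsSep e.1) (hs : IsSep s)
    (h : Bs.flatMap (fun B => B ++ [(Γ'.ket, [])]) = E₁ ++ (s, t) :: E₂) :
    ∃ B, Bs[(E₁.map Prod.fst).count Γ'.ket]? = some B ∧ (s, t) ∈ B := by
  induction Bs generalizing E₁ with
  | nil => simp at h
  | cons B Bs ih =>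
    rw [List.flatMap_cons, List.append_assoc, List.singleton_append] at h
    have hB := hBs B (by simp)
    rcases List.append_eq_append_iff.1 h with ⟨as, rfl, h'⟩ | ⟨bs, rfl, h'⟩
    · rcases as with - | ⟨a, as⟩
      · simp only [List.nil_append, List.cons.injEq, Prod.mk.injEq] at h'
        exact absurd h'.1.1.symm hs.ne_ket
      · simp only [List.cons_append, List.cons.injEq] at h'
        obtain ⟨rfl, h'⟩ := h'
        obtain ⟨B', hB', hm⟩ := ih (fun B hB => hBs B (by simp [hB])) h'
        refine ⟨B', ?_, hm⟩
        rw [List.map_append, List.count_append, count_ket_eq_zero hB, List.map_cons,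
          List.count_cons_self, Nat.zero_add, List.getElem?_cons_succ]
        exact hB'
    · rcases bs with - | ⟨b, bs⟩
      · simp only [List.nil_append, List.cons.injEq, Prod.mk.injEq] at h'
        exact absurd h'.1.1 hs.ne_ket
      · simp only [List.cons_append, List.cons.injEq] at h'
        obtain ⟨rfl, -⟩ := h'
        refine ⟨E₁ ++ (s, t) :: bs, ?_, List.mem_append_right _ List.mem_cons_self⟩
        rw [count_ket_eq_zero fun e he => hB e (List.mem_append_left _ he)]
        rfl

/-- Together with `blockString_complete` this translates between positions of the string and items
of the listing, including the number of the block. -/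
theorem blockString_sound (hBs : ∀ B ∈ Bs, ∀ e ∈ B, IsSep e.1) (hs : IsSep s) {p : ℕ}
    (hp : (blockString Bs)[p]? = some s) :
    ∃ B, Bs[blockIndex (blockString Bs) p]? = some B ∧ (s, token (blockString Bs) p) ∈ B := by
  obtain ⟨E₁, t, E₂, e, rfl⟩ := exists_split_of_getElem? hs.ne_bit hp
  have hb := ne_bit_of_mem_blocks hBs
  unfold blockString
  rw [e] at hb ⊢
  rw [token_itemString fun e he => hb e (by simp [he]),
    blockIndex_itemString]
  exact getElem?_of_split hBs hs e

theorem blockString_complete (hBs : ∀ B ∈ Bs, ∀ e ∈ B, IsSep e.1) {b : ℕ}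
    {B : List (Γ' × List Bool)} (hB : Bs[b]? = some B) (ht : (s, t) ∈ B) :
    ∃ p < (blockString Bs).length, (blockString Bs)[p]? = some s ∧ token (blockString Bs) p = t ∧
      blockIndex (blockString Bs) p = b := by
  obtain ⟨hb, rfl⟩ := List.getElem?_eq_some_iff.1 hB
  obtain ⟨B₁, B₂, e⟩ := List.append_of_mem ht
  obtain ⟨E₂, hE⟩ : ∃ E₂, Bs.flatMap (fun B => B ++ [(Γ'.ket, [])]) =
      ((Bs.take b).flatMap (fun B => B ++ [(Γ'.ket, [])]) ++ B₁) ++ (s, t) :: E₂ := by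
    refine ⟨B₂ ++ (Γ'.ket, []) :: (Bs.drop (b + 1)).flatMap (fun B => B ++ [(Γ'.ket, [])]), ?_⟩
    conv_lhs => rw [← List.take_append_drop b Bs, List.drop_eq_getElem_cons hb]
    rw [List.flatMap_append, List.flatMap_cons, e]
    simp
  have hn := ne_bit_of_mem_blocks hBs
  have hc : ((((Bs.take b).flatMap fun B => B ++ [(Γ'.ket, [])]) ++ B₁).map Prod.fst).count Γ'.ket =
      b := by
    have h₁ : (B₁.map Prod.fst).count Γ'.ket = 0 := count_ket_eq_zero fun e' he' =>
      hBs _ (List.getElem_mem hb) e' (by rw [e]; simp [he'])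
    have h₂ : ∀ Cs : List (List (Γ' × List Bool)), (∀ B ∈ Cs, ∀ e ∈ B, IsSep e.1) →
        ((Cs.flatMap fun B => B ++ [(Γ'.ket, [])]).map Prod.fst).count Γ'.ket = Cs.length := by
      intro Cs hCs
      induction Cs with
      | nil => rfl
      | cons C Cs ih =>
        rw [List.flatMap_cons, List.map_append, List.count_append, ih fun B hB =>
          hCs B (by simp [hB]), List.map_append, List.count_append,
          count_ket_eq_zero (hCs C (by simp))]
        simp
        omega
    rw [List.map_append, List.count_append, h₁, h₂ _ fun B hB => hBs B (List.mem_of_mem_take hB)]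
    simp
    omega
  refine ⟨(itemString ((Bs.take b).flatMap (fun B => B ++ [(Γ'.ket, [])]) ++ B₁)).length, ?_, ?_,
    ?_⟩
  · unfold blockString
    rw [hE, itemString_append _ ((s, t) :: E₂), List.length_append, itemString_cons]
    simp
  · unfold blockString
    rw [hE]
    exact getElem?_itemString
  · unfold blockString
    rw [hE] at hn ⊢
    exact ⟨token_itemString fun e he => hn e (by simp [he]), 
      blockIndex_itemString.trans hc⟩

/-- The blocks of a clause-listing. -/
def clauseBlocks {V : Type} (name : V → List Bool) (P : List (List (Literal V))) :
    List (List (Γ' × List Bool)) :=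
  P.map fun C => (Γ'.bra, []) :: C.map fun x => (Γ'.comma, litName name x)

/-- The blocks of a graph-listing. -/
def graphBlocks {W : Type} (name : W → List Bool) (Q : GraphData W) :
    List (List (Γ' × List Bool)) :=
  (Q.1.map fun a => [(Γ'.bra, name a)]) ++
    Q.2.map fun e => [(Γ'.bra, name e.1), (Γ'.comma, name e.2)]

theorem encClauses_eq {V : Type} (name : V → List Bool) (P : List (List (Literal V))) :
    encClauses name P = blockString (clauseBlocks name P) := by
  simp [encClauses, blockString, clauseBlocks, itemString, List.flatMap_map, List.flatMap_assoc,
    List.flatMap_append, encBits]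

theorem encGraph_eq {W : Type} (name : W → List Bool) (Q : GraphData W) :
    encGraph name Q = blockString (graphBlocks name Q) := by
  simp [encGraph, blockString, graphBlocks, itemString, List.flatMap_map, List.flatMap_assoc,
    List.flatMap_append, encBits]

theorem isSep_clauseBlocks {V : Type} (name : V → List Bool) (P : List (List (Literal V))) :
    ∀ B ∈ clauseBlocks name P, ∀ e ∈ B, IsSep e.1 := by
  intro B hB e he
  obtain ⟨C, -, rfl⟩ := List.mem_map.1 hB
  rcases List.mem_cons.1 he with rfl | he
  · exact .inl rfl
  · obtain ⟨x, -, rfl⟩ := List.mem_map.1 he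
    exact .inr rfl

theorem isSep_graphBlocks {W : Type} (name : W → List Bool) (Q : GraphData W) :
    ∀ B ∈ graphBlocks name Q, ∀ e ∈ B, IsSep e.1 := by
  intro B hB e he
  rcases List.mem_append.1 hB with hB | hB <;> obtain ⟨c, -, rfl⟩ := List.mem_map.1 hB
  · obtain rfl := List.mem_singleton.1 he
    exact .inl rfl
  · rcases List.mem_cons.1 he with rfl | he
    · exact .inl rfl
    · obtain rfl := List.mem_singleton.1 he
      exact .inr rfl

end Blocks

/-! ### The implication graph in terms of positions -/

section Positions

/-- The graph whose vertices are represented by the first positions of their tokens. -/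
def tokenAdj {α : Type} (w : List Γ') (s : Γ') (nm : α → List Bool) (adj : α → α → Prop)
    (p q : ℕ) : Prop :=
  IsFirst w s p ∧ IsFirst w s q ∧ ∃ a b, token w p = nm a ∧ token w q = nm b ∧ adj a b

/-- A vertex may have many occurrences, and the least one represents it. Names are injective, so
numbering vertices by these positions is an isomorphism of graphs. -/
theorem GraphForm.of_tokens {α : Type} {vert : α → Prop} {adj : α → α → Prop} {n x y : ℕ}
    {φ : Bool → ℕ → α} (h : GraphForm vert adj n x y φ) {w : List Γ'} {s : Γ'} {nm : α → List Bool}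
    (hnm : Function.Injective nm)
    (h₁ : ∀ p, w[p]? = some s → ∃ a, vert a ∧ token w p = nm a)
    (h₂ : ∀ a, vert a → ∃ p, w[p]? = some s ∧ token w p = nm a) :
    ∃ ψ, GraphForm (IsFirst w s) (tokenAdj w s nm adj) n x y ψ := by
  let e : α → ℕ := fun a => sInf {p | w[p]? = some s ∧ token w p = nm a}
  have he : ∀ a, vert a → w[e a]? = some s ∧ token w (e a) = nm a := fun a ha =>
    Nat.sInf_mem (s := {p | w[p]? = some s ∧ token w p = nm a}) (h₂ a ha)
  have hf : ∀ a, vert a → IsFirst w s (e a) := fun a ha =>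
    ⟨(he a ha).1, fun q hq hqs ht => Nat.notMem_of_lt_sInf hq ⟨hqs, ht.trans (he a ha).2⟩⟩
  have hu : ∀ a p, vert a → IsFirst w s p → token w p = nm a → e a = p := by
    intro a p ha hp ht
    refine le_antisymm (Nat.sInf_le ⟨hp.1, ht⟩) (le_of_not_gt fun hlt => ?_)
    exact hp.2 _ hlt (he a ha).1 ((he a ha).2.trans ht.symm)
  refine ⟨_, h.map e ?_ ?_ ?_⟩
  · intro a b ha hb q
    refine hnm ?_
    rw [← (he a ha).2, ← (he b hb).2, q]
  · intro p
    constructor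
    · intro hp
      obtain ⟨a, ha, ht⟩ := h₁ p hp.1
      exact ⟨a, ha, hu a p ha hp ht⟩
    · rintro ⟨a, ha, rfl⟩
      exact hf a ha
  · intro p q
    constructor
    · rintro ⟨hp, hq, a, b, ha, hb, hab⟩
      exact ⟨a, b, hab, hu a p (h.vert_of_adj hab) hp ha,
        hu b q (h.vert_of_adj (h.adj_symm hab)) hq hb⟩
    · rintro ⟨a, b, hab, rfl, rfl⟩
      have ha := h.vert_of_adj hab
      have hb := h.vert_of_adj (h.adj_symm hab)
      exact ⟨hf a ha, hf b hb, a, b, (he a ha).2, (he b hb).2, hab⟩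

namespace Arith

/-- The clause with the complement of the literal with index `i` and the literal with index `j` is
present. -/
def cnfArc (i j : ℕ) : Arith :=
  -- The last quantifier ensures that the clause contains no third literal. The two positions may
  -- coincide, which covers unit-clauses.
  ex (ex (and (sym Γ'.comma (var 1)) (and (sym Γ'.comma (var 0)) (and (tokenCompl 1 (i + 2))
    (and (tokenEq 0 0 (j + 2)) (and (sameBlock 1 0) (all (or (not (sym Γ'.comma (var 0)))
      (or (not (sameBlock 0 2)) (or (tokenEq 0 0 2) (tokenEq 0 0 1)))))))))))

/-- Adjacency in the implication graph of a clause-listing. -/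
def cnfAdj (i j : ℕ) : Arith :=
  and (firstToken Γ'.comma i) (and (firstToken Γ'.comma j) (or (cnfArc i j) (cnfArc j i)))

/-- Adjacency in a listed graph. -/
def graphAdj (i j : ℕ) : Arith :=
  and (firstToken Γ'.bra i) (and (firstToken Γ'.bra j) (ex (ex (and (sym Γ'.bra (var 1))
    (and (sym Γ'.comma (var 0)) (and (sameBlock 1 0)
      (or (and (tokenEq 0 1 (i + 2)) (tokenEq 0 0 (j + 2)))
        (and (tokenEq 0 1 (j + 2)) (tokenEq 0 0 (i + 2))))))))))

end Arith

theorem litName_injective {V : Type} {name : V → List Bool} (h : Function.Injective name) :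
    Function.Injective (litName name) := by
  rintro ⟨v, b⟩ ⟨v', b'⟩ e
  simp only [litName, List.cons.injEq] at e
  rw [e.1, h e.2]

section Clauses

variable {V : Type} [DecidableEq V] {name : V → List Bool} {P : List (List (Literal V))}
  {F : ClauseSet V}

theorem IsListing.mem_iff (h : IsListing P F) (C : Finset (Literal V)) :
    C ∈ F ↔ ∃ (b : ℕ) (D : List (Literal V)), P[b]? = some D ∧ D.toFinset = C := by
  rw [← h.2.2]
  simp only [List.mem_toFinset, List.mem_map]
  constructor
  · rintro ⟨D, hD, rfl⟩
    obtain ⟨b, hb⟩ := List.mem_iff_getElem?.1 hD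
    exact ⟨b, D, hb, rfl⟩
  · rintro ⟨b, D, hb, rfl⟩
    exact ⟨D, List.mem_iff_getElem?.2 ⟨b, hb⟩, rfl⟩

omit [DecidableEq V] in
theorem clauses_sound {p : ℕ} (hp : (encClauses name P)[p]? = some Γ'.comma) :
    ∃ C x, P[blockIndex (encClauses name P) p]? = some C ∧ x ∈ C ∧
      token (encClauses name P) p = litName name x := by
  rw [encClauses_eq] at *
  obtain ⟨B, hB, hm⟩ := blockString_sound (isSep_clauseBlocks name P) (.inr rfl) hp
  conv at hB => lhs; unfold clauseBlocks
  rw [List.getElem?_map, Option.map_eq_some_iff] at hB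
  obtain ⟨C, hC, rfl⟩ := hB
  simp only [List.mem_cons, Prod.mk.injEq, reduceCtorEq, false_and, List.mem_map, true_and,
    false_or] at hm
  obtain ⟨x, hx, e⟩ := hm
  exact ⟨C, x, hC, hx, e.symm⟩

omit [DecidableEq V] in
theorem clauses_complete {b : ℕ} {C : List (Literal V)} (hC : P[b]? = some C) {x : Literal V}
    (hx : x ∈ C) : ∃ p < (encClauses name P).length, (encClauses name P)[p]? = some Γ'.comma ∧
      token (encClauses name P) p = litName name x ∧ blockIndex (encClauses name P) p = b := by
  rw [encClauses_eq]
  refine blockString_complete (isSep_clauseBlocks name P) (b := b)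
    (B := (Γ'.bra, []) :: C.map fun x => (Γ'.comma, litName name x)) ?_ ?_
  · simp [clauseBlocks, hC]
  · exact List.mem_cons_of_mem _ (List.mem_map.2 ⟨x, hx, rfl⟩)

open Arith in
theorem sat_cnfArc (hname : Function.Injective name) (h : IsListing P F) {ρ : ℕ → ℕ} {i j : ℕ}
    {a b : Literal V} (hi : token (encClauses name P) (ρ i) = litName name a)
    (hj : token (encClauses name P) (ρ j) = litName name b) :
    Sat (encClauses name P) (cnfArc i j) ρ ↔ {compl a, b} ∈ F := by
  have hlit := litName_injective hname
  have hcomp : ∀ r k, ∀ c : Literal V, token (encClauses name P) r = litName name c →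
      (Sat (encClauses name P) (tokenCompl 1 (i + 2)) (cons k (cons r ρ)) ↔ c = compl a) := by
    intro r k c hr
    rw [sat_tokenCompl (ρ := cons k (cons r ρ)) (i := 1) (j := i + 2) hr hi]
    constructor
    · rintro ⟨e₁, e₂⟩
      exact Prod.ext (hname e₂) e₁
    · rintro rfl
      exact ⟨rfl, rfl⟩
  simp only [cnfArc, sat_ex, sat_and, sat_sym, sat_tokenEq, sat_sameBlock, sat_all, sat_or,
    sat_not, val, cons_zero, cons_succ, Nat.add_zero]
  constructor
  · rintro ⟨r, -, k, -, hr, hk, hrc, hkj, hrk, hall⟩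
    obtain ⟨C, c, hC, hc, hrt⟩ := clauses_sound hr
    obtain ⟨D, d, hD, hd, hkt⟩ := clauses_sound hk
    obtain rfl := (hcomp r k c hrt).1 hrc
    obtain rfl : d = b := hlit (by rw [← hkt, hkj, hj])
    rw [← hrk, hC, Option.some.injEq] at hD
    subst hD
    rw [h.mem_iff]
    refine ⟨_, C, hC, ?_⟩
    ext u
    simp only [List.mem_toFinset, Finset.mem_insert, Finset.mem_singleton]
    constructor
    · intro hu
      obtain ⟨q, hq, hqs, hqt, hqb⟩ := clauses_complete (name := name) hC hu
      rcases hall q hq with e | e | e | e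
      · exact absurd hqs e
      · exact absurd hqb e
      · exact .inl (hlit (by rw [← hqt, e, hrt]))
      · exact .inr (hlit (by rw [← hqt, e, hkt]))
    · rintro (rfl | rfl) <;> assumption
  · intro hF
    obtain ⟨m, C, hC, e⟩ := (h.mem_iff _).1 hF
    have hm : ∀ u, u ∈ C ↔ u = compl a ∨ u = b := fun u => by
      rw [← List.mem_toFinset, e]
      simp
    obtain ⟨r, hr, hrs, hrt, hrb⟩ := clauses_complete (name := name) hC ((hm _).2 (.inl rfl))
    obtain ⟨k, hk, hks, hkt, hkb⟩ := clauses_complete (name := name) hC ((hm _).2 (.inr rfl))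
    refine ⟨r, hr, k, hk, hrs, hks, (hcomp r k _ hrt).2 rfl, hkt.trans hj.symm,
      hrb.trans hkb.symm, fun q hq => ?_⟩
    by_cases hqs : (encClauses name P)[q]? = some Γ'.comma
    · by_cases hqb : blockIndex (encClauses name P) q = blockIndex (encClauses name P) r
      · obtain ⟨D, d, hD, hd, hqt⟩ := clauses_sound hqs
        rw [hqb, hrb, hC, Option.some.injEq] at hD
        subst hD
        rcases (hm d).1 hd with rfl | rfl
        · exact .inr (.inr (.inl (hqt.trans hrt.symm)))
        · exact .inr (.inr (.inr (hqt.trans hkt.symm)))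
      · exact .inr (.inl hqb)
    · exact .inl hqs

/-- The condition `a ≠ b` is automatic, since `{compl a, a}` would be tautological. -/
theorem ig_adj_iff (hF : IsClauseSet F) (a b : Literal V) :
    (ig F).Adj a b ↔ {compl a, b} ∈ F ∨ {compl b, a} ∈ F := by
  simp only [ig, idg_adj_iff_mem]
  refine ⟨fun h => h.2, fun h => ⟨?_, h⟩⟩
  rintro rfl
  have := hF _ (h.elim id id) a (by simp)
  simp at this

open Arith in
theorem sat_cnfAdj (hname : Function.Injective name) (h : IsListing P F) (hF : IsClauseSet F)
    (i j : ℕ) (ρ : ℕ → ℕ) : Sat (encClauses name P) (cnfAdj i j) ρ ↔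
      tokenAdj (encClauses name P) Γ'.comma (litName name) (ig F).Adj (ρ i) (ρ j) := by
  simp only [cnfAdj, sat_and, sat_or, sat_firstToken, tokenAdj]
  refine and_congr_right fun hi => and_congr_right fun hj => ?_
  obtain ⟨-, a, -, -, ha⟩ := clauses_sound hi.1
  obtain ⟨-, b, -, -, hb⟩ := clauses_sound hj.1
  rw [sat_cnfArc hname h ha hb, sat_cnfArc hname h hb ha, ← ig_adj_iff hF]
  constructor
  · exact fun hab => ⟨a, b, ha, hb, hab⟩
  · rintro ⟨a', b', ha', hb', hab⟩
    rwa [litName_injective hname (ha.symm.trans ha'), litName_injective hname (hb.symm.trans hb')]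

/-- The parameters of a listed clause-set are computed by a formula. -/
theorem ChainForm.sat_hasParams (hname : Function.Injective name) (h : IsListing P F) {n x y : ℕ}
    {φ : ℕ → Literal V} (hφ : ChainForm F n x y φ) (hxy : x + y ≤ n + 1) (n' x' y' : ℕ)
    (ρ : ℕ → ℕ) : Arith.Sat (encClauses name P)
      (Arith.hasParams Arith.cnfAdj (Arith.firstToken Γ'.comma)) (cons y' (cons x' (cons n' ρ))) ↔
        n' = n ∧ x' = x ∧ y' = y := by
  -- By minimal unsatisfiability both literals of every variable really occur, so each vertex of the
  -- graph has a token in the listing.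
  have hocc : ∀ a, a ∈ lits F ↔ ∃ C ∈ F, a ∈ C := by
    intro a
    constructor
    · exact fun ha => (hφ.isMU.exists_mem (Finset.mem_product.1 ha).1)
    · rintro ⟨C, hC, ha⟩
      exact (TwoMU.mem_lits_iff F a).2 ⟨C, hC, a, ha, rfl⟩
  obtain ⟨ψ, hψ⟩ := hφ.graphForm.of_tokens (w := encClauses name P) (s := Γ'.comma)
    (nm := litName name) (litName_injective hname) (by
      intro p hp
      obtain ⟨C, a, hC, ha, ht⟩ := clauses_sound hp
      exact ⟨a, (hocc a).2 ⟨_, (h.mem_iff _).2 ⟨_, C, hC, rfl⟩, List.mem_toFinset.2 ha⟩, ht⟩) (by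
      intro a ha
      obtain ⟨C, hC, ha⟩ := (hocc a).1 ha
      obtain ⟨b, D, hD, rfl⟩ := (h.mem_iff C).1 hC
      obtain ⟨p, -, hp, ht, -⟩ := clauses_complete (name := name) hD (List.mem_toFinset.1 ha)
      exact ⟨p, hp, ht⟩)
  rw [Arith.sat_hasParams (sat_cnfAdj hname h hφ.isClauseSet)
    (fun i ρ => Arith.sat_firstToken Γ'.comma i) (fun p q hpq => ⟨hpq.1.lt_length,
      hpq.2.1.lt_length⟩)]
  exact hψ.hasParams_iff (fun p hp => hp.lt_length) hxy n' x' y'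

end Clauses

section Graphs

variable {W : Type} {name : W → List Bool} {Q : GraphData W} {G : Graph W}

/-- An opening bracket precedes a listed vertex or the first end of a listed edge, and the latter is
a vertex as well. -/
theorem graph_sound_bra {p : ℕ} (hp : (encGraph name Q)[p]? = some Γ'.bra) :
    ∃ a, token (encGraph name Q) p = name a ∧ (a ∈ Q.1 ∨ ∃ b, (a, b) ∈ Q.2) := by
  rw [encGraph_eq] at *
  obtain ⟨B, hB, hm⟩ := blockString_sound (isSep_graphBlocks name Q) (.inl rfl) hp
  rcases List.mem_append.1 (List.mem_of_getElem? hB) with hB | hB <;>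
    obtain ⟨c, hc, rfl⟩ := List.mem_map.1 hB
  · simp only [List.mem_singleton, Prod.mk.injEq, true_and] at hm
    exact ⟨c, hm, .inl hc⟩
  · simp only [List.mem_cons, Prod.mk.injEq, true_and, reduceCtorEq, false_and, List.not_mem_nil,
      or_false] at hm
    exact ⟨c.1, hm, .inr ⟨c.2, hc⟩⟩

theorem graph_sound_edge {p q : ℕ} (hp : (encGraph name Q)[p]? = some Γ'.bra)
    (hq : (encGraph name Q)[q]? = some Γ'.comma)
    (hpq : blockIndex (encGraph name Q) p = blockIndex (encGraph name Q) q) :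
    ∃ e ∈ Q.2, token (encGraph name Q) p = name e.1 ∧ token (encGraph name Q) q = name e.2 := by
  rw [encGraph_eq] at *
  obtain ⟨B, hB, hm⟩ := blockString_sound (isSep_graphBlocks name Q) (.inl rfl) hp
  obtain ⟨B', hB', hm'⟩ := blockString_sound (isSep_graphBlocks name Q) (.inr rfl) hq
  rw [← hpq, hB, Option.some.injEq] at hB'
  subst hB'
  rcases List.mem_append.1 (List.mem_of_getElem? hB) with hB | hB <;>
    obtain ⟨c, hc, rfl⟩ := List.mem_map.1 hB
  · simp at hm'
  · simp only [List.mem_cons, Prod.mk.injEq, true_and, reduceCtorEq, false_and, List.not_mem_nil,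
      or_false, false_or] at hm hm'
    exact ⟨c, hc, hm, hm'⟩

theorem graph_complete_vert {a : W} (ha : a ∈ Q.1) :
    ∃ p, (encGraph name Q)[p]? = some Γ'.bra ∧ token (encGraph name Q) p = name a := by
  rw [encGraph_eq]
  have hB : [(Γ'.bra, name a)] ∈ graphBlocks name Q :=
    List.mem_append_left _ (List.mem_map.2 ⟨a, ha, rfl⟩)
  obtain ⟨b, hb⟩ := List.mem_iff_getElem?.1 hB
  obtain ⟨p, -, hp, ht, -⟩ := blockString_complete (isSep_graphBlocks name Q) hb
    (List.mem_singleton.2 rfl)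
  exact ⟨p, hp, ht⟩

theorem graph_complete_edge {e : W × W} (he : e ∈ Q.2) :
    ∃ p < (encGraph name Q).length, ∃ q < (encGraph name Q).length,
      (encGraph name Q)[p]? = some Γ'.bra ∧ (encGraph name Q)[q]? = some Γ'.comma ∧
      token (encGraph name Q) p = name e.1 ∧ token (encGraph name Q) q = name e.2 ∧
      blockIndex (encGraph name Q) p = blockIndex (encGraph name Q) q := by
  rw [encGraph_eq]
  have hB : [(Γ'.bra, name e.1), (Γ'.comma, name e.2)] ∈ graphBlocks name Q :=
    List.mem_append_right _ (List.mem_map.2 ⟨e, he, rfl⟩)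
  obtain ⟨b, hb⟩ := List.mem_iff_getElem?.1 hB
  obtain ⟨p, hpl, hp, ht, hpb⟩ := blockString_complete (isSep_graphBlocks name Q) hb
    (s := Γ'.bra) (t := name e.1) (by simp)
  obtain ⟨q, hql, hq, ht', hqb⟩ := blockString_complete (isSep_graphBlocks name Q) hb
    (s := Γ'.comma) (t := name e.2) (by simp)
  exact ⟨p, hpl, q, hql, hp, hq, ht, ht', hpb.trans hqb.symm⟩

theorem IsGraphListing.adj_iff (h : IsGraphListing Q G) (a b : W) :
    G.Adj a b ↔ (a, b) ∈ Q.2 ∨ (b, a) ∈ Q.2 := by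
  rw [← SimpleGraph.Subgraph.mem_edgeSet, ← h.2.2.2]
  simp only [List.mem_map, Sym2.eq_iff, Prod.exists]
  constructor
  · rintro ⟨c, d, hcd, ⟨rfl, rfl⟩ | ⟨rfl, rfl⟩⟩
    exacts [.inl hcd, .inr hcd]
  · rintro (hab | hab)
    exacts [⟨a, b, hab, .inl ⟨rfl, rfl⟩⟩, ⟨b, a, hab, .inr ⟨rfl, rfl⟩⟩]

open Arith in
theorem sat_graphAdj (h : IsGraphListing Q G) (i j : ℕ) (ρ : ℕ → ℕ) :
    Sat (encGraph name Q) (graphAdj i j) ρ ↔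
      tokenAdj (encGraph name Q) Γ'.bra name G.Adj (ρ i) (ρ j) := by
  simp only [graphAdj, sat_and, sat_or, sat_ex, sat_sym, sat_tokenEq, sat_sameBlock,
    sat_firstToken, tokenAdj, val, cons_zero, cons_succ, Nat.add_zero]
  refine and_congr_right fun hi => and_congr_right fun hj => ?_
  constructor
  · rintro ⟨r, -, k, -, hr, hk, hrk, ⟨hri, hkj⟩ | ⟨hrj, hki⟩⟩
    · obtain ⟨e, he, h₁, h₂⟩ := graph_sound_edge hr hk hrk
      exact ⟨e.1, e.2, by rw [← hri, h₁], by rw [← hkj, h₂], (h.adj_iff _ _).2 (.inl he)⟩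
    · obtain ⟨e, he, h₁, h₂⟩ := graph_sound_edge hr hk hrk
      exact ⟨e.2, e.1, by rw [← hki, h₂], by rw [← hrj, h₁], (h.adj_iff _ _).2 (.inr he)⟩
  · rintro ⟨a, b, ha, hb, hab⟩
    rcases (h.adj_iff a b).1 hab with he | he <;>
      obtain ⟨p, hpl, q, hql, hp, hq, htp, htq, hpq⟩ := graph_complete_edge (name := name) he
    · exact ⟨p, hpl, q, hql, hp, hq, hpq, .inl ⟨htp.trans ha.symm, htq.trans hb.symm⟩⟩
    · exact ⟨p, hpl, q, hql, hp, hq, hpq, .inr ⟨htp.trans hb.symm, htq.trans ha.symm⟩⟩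

/-- The parameters of a listed graph are computed by a formula. -/
theorem GraphForm.sat_hasParams (hname : Function.Injective name) (h : IsGraphListing Q G)
    {n x y : ℕ} {φ : Bool → ℕ → W} (hφ : GraphForm (· ∈ G.verts) G.Adj n x y φ)
    (hxy : x + y ≤ n + 1) (n' x' y' : ℕ) (ρ : ℕ → ℕ) : Arith.Sat (encGraph name Q)
      (Arith.hasParams Arith.graphAdj (Arith.firstToken Γ'.bra)) (cons y' (cons x' (cons n' ρ))) ↔
        n' = n ∧ x' = x ∧ y' = y := by
  obtain ⟨ψ, hψ⟩ := hφ.of_tokens (w := encGraph name Q) (s := Γ'.bra) hname (by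
      intro p hp
      obtain ⟨a, ht, ha | ⟨b, hab⟩⟩ := graph_sound_bra hp
      · exact ⟨a, (h.2.1 a).1 ha, ht⟩
      · exact ⟨a, G.edge_vert ((h.adj_iff a b).2 (.inl hab)), ht⟩)
    (fun a ha => graph_complete_vert ((h.2.1 a).2 ha))
  rw [Arith.sat_hasParams (sat_graphAdj h) (fun i ρ => Arith.sat_firstToken Γ'.bra i)
    (fun p q hpq => ⟨hpq.1.lt_length, hpq.2.1.lt_length⟩)]
  exact hψ.hasParams_iff (fun p hp => hp.lt_length) hxy n' x' y'

end Graphs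

end Positions

end TwoMU

namespace TwoMU
open Computability (Γ')

/-! ### Output of binary numbers -/

section Bits

open Computability in
theorem encodeNat_eq {k : ℕ} (hk : 1 ≤ k) :
    encodeNat k = decide (k % 2 = 1) :: encodeNat (k / 2) := by
  have key : ∀ n : Num, encodeNat (n : ℕ) = encodeNum n := fun n => by
    unfold encodeNat
    rw [Num.of_to_nat]
  obtain ⟨p, rfl⟩ : ∃ p : PosNum, ((Num.pos p : Num) : ℕ) = k := by
    have h := Num.to_of_nat k
    cases hn : (k : Num) with
    | zero =>
      rw [hn] at h
      have : ((Num.zero : Num) : ℕ) = 0 := rfl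
      omega
    | pos p =>
      rw [hn] at h
      exact ⟨p, h⟩
  cases p with
  | one => rfl
  | bit0 p =>
    have e : ((Num.pos p.bit0 : Num) : ℕ) = 2 * ((Num.pos p : Num) : ℕ) := by
      simp [PosNum.cast_bit0, two_mul]
    rw [key, e, Nat.mul_mod_right, Nat.mul_div_cancel_left _ (by omega), key]
    rfl
  | bit1 p =>
    have e : ((Num.pos p.bit1 : Num) : ℕ) = 2 * ((Num.pos p : Num) : ℕ) + 1 := by
      simp [PosNum.cast_bit1, two_mul]
    rw [key, e, show (2 * ((Num.pos p : Num) : ℕ) + 1) % 2 = 1 by omega,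
      show (2 * ((Num.pos p : Num) : ℕ) + 1) / 2 = ((Num.pos p : Num) : ℕ) by omega, key]
    rfl

theorem encodeNat_zero : Computability.encodeNat 0 = [] := rfl

/-- There is one round for each position of the input. Since `k / 2 ^ j = 0` for `j ≥ k`, any `N ≥
k` provides enough rounds for all binary digits. -/
theorem flatMap_bits (N k : ℕ) (hk : k ≤ N) : ((List.range N).flatMap fun j =>
    if k / 2 ^ j ≠ 0 then [Γ'.bit (decide (k / 2 ^ j % 2 = 1))] else []) =
      encBits (Computability.encodeNat k) := by
  induction N generalizing k with
  | zero =>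
    obtain rfl : k = 0 := by omega
    rfl
  | succ N ih =>
    rcases Nat.eq_zero_or_pos k with rfl | hk0
    · simp [encodeNat_zero, encBits]
    · have h := ih (k / 2) (by omega)
      rw [List.range_succ_eq_map, List.flatMap_cons, List.flatMap_map, encodeNat_eq hk0]
      simp only [Nat.pow_succ', ← Nat.div_div_eq_div_mul, pow_zero, Nat.div_one]
      rw [h, if_pos (by omega)]
      rfl

namespace Arith

variable {w : List Γ'} {ρ : ℕ → ℕ}

/-- The sequence with the number of index `i` as its first two members, where every further member
is half of the previous one. -/
def half (t : Arith) (i : ℕ) : Arith :=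
  rec2 t i i (le (add (add (var 0) (var 0)) (const 2)) (var 1))

/-- There are `m / 2` numbers `k` with `2k + 2 ≤ m`, and `m ≤ |w|` ensures that all of them are
positions. Both initial members equal `ρ i`, so the member `j + 1` has been halved `j` times. -/
theorem val_half {i j : ℕ} {t : Arith} (hi : ρ i ≤ w.length) (ht : t.val w ρ = j + 1) :
    (half t i).val w ρ = ρ i / 2 ^ j := by
  simp only [half, val, ht]
  have step : ∀ m ≤ w.length, Nat.count (fun k => val w (le (add (add (var 0) (var 0)) (const 2))
      (var 1)) (cons k (cons m (cons (ρ i) ρ))) ≠ 0) w.length = m / 2 := by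
    intro m hm
    rw [Nat.count_eq_card_filter_range]
    have : (Finset.range w.length).filter (fun k => val w (le (add (add (var 0) (var 0)) (const 2))
        (var 1)) (cons k (cons m (cons (ρ i) ρ))) ≠ 0) = Finset.range (m / 2) := by
      ext k
      have := sat_le (w := w) (ρ := cons k (cons m (cons (ρ i) ρ)))
        (add (add (var 0) (var 0)) (const 2)) (var 1)
      unfold Sat at this
      rw [Finset.mem_filter, this]
      simp only [Finset.mem_range, val, cons_zero, cons_succ]
      omega
    rw [this, Finset.card_range]
  have key : ∀ j, ((fun q : ℕ × ℕ => (q.2, Nat.count (fun k => val w (le (add (add (var 0) (var 0))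
      (const 2)) (var 1)) (cons k (cons q.2 (cons q.1 ρ))) ≠ 0) w.length))^[j]
        (ρ i, ρ i)).2 = ρ i / 2 ^ j := by
    intro j
    induction j with
    | zero => simp
    | succ j ih =>
      rw [Function.iterate_succ_apply']
      simp only [ih]
      rw [Nat.pow_succ, ← Nat.div_div_eq_div_mul]
      exact step _ ((Nat.div_le_self _ _).trans hi)
  rw [Function.iterate_succ_apply']
  exact key j

end Arith

namespace Printer

variable {w : List Γ'} {ρ : ℕ → ℕ}

/-- Output of the variable with index `i` in binary. -/
def bits (i : ℕ) : Printer :=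
  each (ite (.half (.add (.var 0) (.const 1)) (i + 1))
    (ite (.eq (.half (.add (.var 0) (.const 1)) (i + 1))
      (.add (.half (.add (.var 0) (.const 2)) (i + 1)) (.half (.add (.var 0) (.const 2)) (i + 1))))
      (emit (Γ'.bit false)) (emit (Γ'.bit true))) nil)

theorem out_bits {i : ℕ} (hi : ρ i ≤ w.length) :
    (bits i).out w ρ = encBits (Computability.encodeNat (ρ i)) := by
  rw [← flatMap_bits _ _ hi]
  simp only [bits, out]
  congr 1
  funext j
  have h₁ := Arith.val_half (w := w) (ρ := cons j ρ) (i := i + 1) (j := j)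
    (t := .add (.var 0) (.const 1)) hi rfl
  have h₂ := Arith.val_half (w := w) (ρ := cons j ρ) (i := i + 1) (j := j + 1)
    (t := .add (.var 0) (.const 2)) hi rfl
  have h₃ := Arith.sat_eq (w := w) (ρ := cons j ρ)
    (.half (.add (.var 0) (.const 1)) (i + 1))
    (.add (.half (.add (.var 0) (.const 2)) (i + 1)) (.half (.add (.var 0) (.const 2)) (i + 1)))
  unfold Arith.Sat at h₃
  simp only [h₃, Arith.val, h₁, h₂, cons_succ]
  rw [Nat.pow_succ, ← Nat.div_div_eq_div_mul]
  generalize ρ i / 2 ^ j = m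
  by_cases hm : m = 0
  · simp [hm]
  · rw [if_pos hm, if_pos hm]
    split_ifs with h
    · rw [decide_eq_false (by omega)]
    · rw [decide_eq_true (by omega)]

/-- Output of `body` for all `k ≤ n`, where `i` is the index of `n` inside the loop. -/
def upTo (i : ℕ) (body : Printer) : Printer := each (ite (.le (.var 0) (.var i)) body nil)

theorem flatMap_range_le {α : Type} (f : ℕ → List α) {n N : ℕ} (h : n < N) :
    ((List.range N).flatMap fun k => if k ≤ n then f k else []) =
      (List.range (n + 1)).flatMap f := by
  obtain ⟨m, rfl⟩ : ∃ m, N = n + 1 + m := ⟨N - (n + 1), by omega⟩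
  rw [List.range_add, List.flatMap_append, List.flatMap_map]
  have h₁ : ((List.range (n + 1)).flatMap fun k => if k ≤ n then f k else []) =
      (List.range (n + 1)).flatMap f := by
    simp only [List.flatMap]
    congr 1
    refine List.map_congr_left fun k hk => if_pos ?_
    have := List.mem_range.1 hk
    omega
  have h₂ : ((List.range m).flatMap fun k => if n + 1 + k ≤ n then f (n + 1 + k) else []) = [] := by
    rw [List.flatMap_eq_nil_iff]
    exact fun k _ => if_neg (by omega)
  rw [h₁, h₂, List.append_nil]

theorem out_ite (c : Arith) (o o' : Printer) [Decidable (c.Sat w ρ)] :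
    (ite c o o').out w ρ = if c.Sat w ρ then o.out w ρ else o'.out w ρ := by
  simp only [out]
  by_cases h : c.Sat w ρ
  · rw [if_pos h, if_pos (show c.val w ρ ≠ 0 from h)]
  · rw [if_neg h, if_neg (show ¬ c.val w ρ ≠ 0 from h)]

theorem out_upTo {i : ℕ} {body : Printer} (hi : ρ i < w.length) :
    (upTo (i + 1) body).out w ρ =
      (List.range (ρ i + 1)).flatMap fun k => body.out w (cons k ρ) := by
  classical
  rw [← flatMap_range_le _ hi]
  simp only [upTo, out.eq_5]
  congr 1
  funext k
  rw [out_ite]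
  simp only [Arith.sat_le, Arith.val, cons_zero, cons_succ, out]

/-- Output of `body` with the value of `e` as an additional variable. -/
def bind (e : Arith) (body : Printer) : Printer := each (ite (.eq (.var 0) e) body nil)

theorem flatMap_range_unique {α : Type} {f : ℕ → List α} {N a : ℕ} (ha : a < N)
    (h : ∀ k, k ≠ a → f k = []) : (List.range N).flatMap f = f a := by
  obtain ⟨m, rfl⟩ : ∃ m, N = a + (1 + m) := ⟨N - (a + 1), by omega⟩
  rw [List.range_add, List.flatMap_append, List.flatMap_map, List.range_add, List.flatMap_append,
    List.flatMap_map]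
  have h₁ : (List.range a).flatMap f = [] := by
    rw [List.flatMap_eq_nil_iff]
    intro k hk
    have := List.mem_range.1 hk
    exact h k (by omega)
  have h₂ : ((List.range m).flatMap fun k => f (a + (1 + k))) = [] := by
    rw [List.flatMap_eq_nil_iff]
    exact fun k _ => h _ (by omega)
  rw [h₁, h₂]
  simp

theorem out_bind {e : Arith} {body : Printer} {v : ℕ} (hv : v < w.length)
    (he : ∀ k, e.val w (cons k ρ) = v) : (bind e body).out w ρ = body.out w (cons v ρ) := by
  classical
  have key : ∀ k, (ite (.eq (.var 0) e) body nil).out w (cons k ρ) =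
      if k = v then body.out w (cons k ρ) else [] := fun k => by
    rw [out_ite]
    simp only [Arith.sat_eq, Arith.val, cons_zero, he, out]
  simp only [bind, out.eq_5, key]
  rw [flatMap_range_unique hv fun k hk => if_neg hk, if_pos rfl]

/-- Output of `body` for the three numbers described by `c`. -/
def withParams (c : Arith) (body : Printer) : Printer := each (each (each (ite c body nil)))

/-- The printer tries all triples of positions. Exactly one satisfies `c`, and the others print
nothing. -/
theorem out_withParams {c : Arith} {body : Printer} {n x y : ℕ} (hn : n < w.length) (hx : x ≤ n)
    (hy : y ≤ n) (hc : ∀ n' x' y', c.Sat w (cons y' (cons x' (cons n' ρ))) ↔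
      n' = n ∧ x' = x ∧ y' = y) :
    (withParams c body).out w ρ = body.out w (cons y (cons x (cons n ρ))) := by
  classical
  have key : ∀ n' x' y', (ite c body nil).out w (cons y' (cons x' (cons n' ρ))) =
      if n' = n ∧ x' = x ∧ y' = y then body.out w (cons y' (cons x' (cons n' ρ))) else [] :=
    fun n' x' y' => by
      rw [out_ite]
      simp only [hc, out]
  simp only [withParams, out.eq_5, key]
  rw [flatMap_range_unique hn, flatMap_range_unique (hx.trans_lt hn),
    flatMap_range_unique (hy.trans_lt hn), if_pos ⟨rfl, rfl, rfl⟩]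
  · exact fun k hk => if_neg fun h => hk h.2.2
  · exact fun k hk => List.flatMap_eq_nil_iff.2 fun _ _ => if_neg fun h => hk h.2.1
  · exact fun k hk => List.flatMap_eq_nil_iff.2 fun _ _ => List.flatMap_eq_nil_iff.2 fun _ _ =>
      if_neg fun h => hk h.1

end Printer

end Bits

/-! ### Output of patterns -/

namespace Printer

variable {w : List Γ'} {ρ : ℕ → ℕ}

/-- Output of the pattern whose parameters have the indices `2`, `1`, `0`. -/
def pattern : Printer :=
  ite (.eq (.var 1) (.const 1))
    (ite (.eq (.var 0) (.var 2))
      -- With the least significant bit first, the upper indices `2`, `1`, `0` have the codes `01`,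
      -- `1` and the empty string.
      (seq (emit Γ'.comma) (seq (emit (Γ'.bit false)) (seq (emit (Γ'.bit true))
        (seq (emit Γ'.comma) (bits 2)))))
      (seq (emit Γ'.comma) (seq (emit (Γ'.bit true))
        (seq (emit Γ'.comma) (seq (bits 2) (seq (emit Γ'.comma) (bits 0)))))))
    (seq (emit Γ'.comma) (seq (emit Γ'.comma) (seq (bits 2) (seq (emit Γ'.comma) (seq (bits 1)
      (ite (.eq (.var 1) (.var 0)) nil (seq (emit Γ'.comma) (bits 0))))))))

theorem out_pattern {n x y : ℕ} (hn : n < w.length) (hx : x ≤ n) (hy : y ≤ n) :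
    pattern.out w (cons y (cons x (cons n ρ))) = encPattern (Pattern.ofTriple n x y) := by
  classical
  have e₀ : (bits 0).out w (cons y (cons x (cons n ρ))) = encBits (Computability.encodeNat y) :=
    out_bits (i := 0) (by simp only [cons_zero]; omega)
  have e₁ : (bits 1).out w (cons y (cons x (cons n ρ))) = encBits (Computability.encodeNat x) :=
    out_bits (i := 1) (show x ≤ w.length by omega)
  have e₂ : (bits 2).out w (cons y (cons x (cons n ρ))) = encBits (Computability.encodeNat n) :=
    out_bits (i := 2) (show n ≤ w.length by omega)
  have c₁ : Computability.encodeNat 1 = [true] := rfl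
  have c₂ : Computability.encodeNat 2 = [false, true] := rfl
  simp only [pattern, out_ite, Arith.sat_eq, Arith.val, out.eq_1, out.eq_2, out.eq_3, e₀, e₁, e₂]
  unfold Pattern.ofTriple
  change (if x = 1 then if y = n then _ else _ else _ ++ (_ ++ (_ ++ (_ ++ (_ ++
    if x = y then _ else _))))) = _
  split_ifs <;> simp [encPattern, Pattern.upper, Pattern.size, Pattern.params, c₁, c₂,
    encodeNat_zero, encBits]

end Printer

end TwoMU

namespace TwoMU
open Computability (Γ')

/-! ### Listings of the canonical clause-sets and graphs -/

section Listings

namespace GraphForm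

variable {W : Type} {n x y : ℕ} {φ : Bool → ℕ → W}

/-- A listing of the vertices and the edges. -/
def listing (n x y : ℕ) (φ : Bool → ℕ → W) : GraphData W :=
  ((List.range (n + 1)).flatMap fun k => if k = 0 then [] else [φ true k, φ false k],
    (List.range (n + 1)).flatMap fun k =>
      -- At an end with a unit-clause the two chains share the edge, which is listed once. For `n =
      -- 1` even the two ends share their only edge.
      if k = 0 ∧ x = 1 then [(φ true k, φ true (k + 1))]
      else if k = n ∧ y = n then if n = 1 then [] else [(φ true k, φ true (k + 1))]
      else [(φ true k, φ true (k + 1)), (φ false k, φ false (k + 1))])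

variable {vert : W → Prop} {adj : W → W → Prop}

/-- With `edge_self_eq` this shows that `listing` has no repetitions: coinciding edges come from an
end of the two chains or from `n = 1`. -/
theorem edge_eq (h : GraphForm vert adj n x y φ) {s t : Bool} {j k : ℕ} (hjk : j < k) (hk : k ≤ n)
    (e : s(φ s j, φ s (j + 1)) = s(φ t k, φ t (k + 1))) : n = 1 := by
  have h₁ := h.one_le
  have h₂ := h.le
  have h₃ := h.le_size
  by_contra hn
  rcases Sym2.eq_iff.1 e with ⟨e₁, e₂⟩ | ⟨e₁, e₂⟩
  · rcases Nat.eq_zero_or_pos j with rfl | hj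
    · rw [h.first] at e₁
      have := (h.inj _ _ _ _ h₁ (by omega) (by omega) hk e₁).2
      rcases Nat.lt_or_ge k n with hkn | hkn
      · have := (h.inj _ _ _ _ (by omega) (by omega) (by omega) hkn e₂).2
        omega
      · obtain rfl : k = n := by omega
        rw [h.last] at e₂
        have := (h.inj _ _ _ _ (by omega) (by omega) (by omega) h₃ e₂).2
        omega
    · have := (h.inj _ _ _ _ hj (by omega) (by omega) hk e₁).2
      omega
  · obtain ⟨rfl, rfl⟩ := h.inj _ _ _ _ (by omega) (by omega) (by omega) hk e₂
    exact h.pred_ne_succ (s := s) (j := j + 1) (by omega) (by omega) hk e₁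

theorem edge_self_eq (h : GraphForm vert adj n x y φ) {k : ℕ} (hk : k ≤ n)
    (e : s(φ true k, φ true (k + 1)) = s(φ false k, φ false (k + 1))) :
    (k = 0 ∧ x = 1) ∨ (k = n ∧ y = n) := by
  have h₁ := h.one_le
  have h₂ := h.le
  have h₃ := h.le_size
  rcases Sym2.eq_iff.1 e with ⟨e₁, e₂⟩ | ⟨e₁, e₂⟩
  · rcases Nat.eq_zero_or_pos k with rfl | hk0
    · have := (h.inj _ _ _ _ (by omega) (by omega) (by omega) (by omega) e₂).1
      simp at this
    · have := (h.inj _ _ _ _ hk0 hk hk0 hk e₁).1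
      simp at this
  · rcases Nat.eq_zero_or_pos k with rfl | hk0
    · rw [h.first] at e₁
      have := (h.inj _ _ _ _ h₁ (by omega) (by omega) (by omega) e₁).2
      omega
    · rcases Nat.lt_or_ge k n with hkn | hkn
      · have := (h.inj _ _ _ _ hk0 hk (by omega) hkn e₁).2
        omega
      · obtain rfl : k = n := by omega
        rw [h.last] at e₁
        have := (h.inj _ _ _ _ hk0 hk (by omega) h₃ e₁).2
        omega

theorem isGraphListing {G : Graph W} (h : GraphForm (· ∈ G.verts) G.Adj n x y φ) :
    IsGraphListing (listing n x y φ) G := by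
  have h₁ := h.one_le
  have h₂ := h.le
  have h₃ := h.le_size
  refine ⟨?_, fun a => ?_, ?_, fun e => ?_⟩
  · simp only [listing]
    rw [List.nodup_flatMap]
    refine ⟨fun k hk => ?_, (List.nodup_range (n := n + 1)).pairwise_of_forall_ne
      fun j hj k hk hjk a ha hb => ?_⟩
    · split_ifs with hk0
      · simp
      · have hk := List.mem_range.1 hk
        rw [List.nodup_cons, List.mem_singleton, h.inj_iff (by omega) (by omega) (by omega)
          (by omega)]
        simp
    · have hj := List.mem_range.1 hj
      have hk := List.mem_range.1 hk
      beta_reduce at ha hb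
      split_ifs at ha hb with hj0 hk0 hk0
      · simp at ha
      · simp at ha
      · simp at hb
      · have ha' : ∃ s, a = φ s j := by
          simp only [List.mem_cons, List.not_mem_nil, or_false] at ha
          exact ha.elim (fun e => ⟨_, e⟩) fun e => ⟨_, e⟩
        have hb' : ∃ s, a = φ s k := by
          simp only [List.mem_cons, List.not_mem_nil, or_false] at hb
          exact hb.elim (fun e => ⟨_, e⟩) fun e => ⟨_, e⟩
        obtain ⟨s, rfl⟩ := ha'
        obtain ⟨t, e⟩ := hb'
        exact hjk (h.inj _ _ _ _ (by omega) (by omega) (by omega) (by omega) e).2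
  · rw [h.vert_iff]
    simp only [listing, List.mem_flatMap, List.mem_range]
    constructor
    · rintro ⟨k, hk, ha⟩
      split_ifs at ha with hk0
      · simp at ha
      · simp only [List.mem_cons, List.not_mem_nil, or_false] at ha
        rcases ha with rfl | rfl
        exacts [⟨true, k, by omega, by omega, rfl⟩, ⟨false, k, by omega, by omega, rfl⟩]
    · rintro ⟨s, k, hk, hk', rfl⟩
      refine ⟨k, by omega, ?_⟩
      rw [if_neg (by omega)]
      cases s <;> simp
  · simp only [listing]
    rw [List.map_flatMap, List.nodup_flatMap]
    refine ⟨fun k hk => ?_, (List.nodup_range (n := n + 1)).pairwise_of_forall_ne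
      fun j hj k hk hjk e ha hb => ?_⟩
    · have hk := List.mem_range.1 hk
      split_ifs with c₁ c₂ c₃
      · simp
      · simp
      · simp
      · rw [List.map_cons, List.map_singleton, List.nodup_cons, List.mem_singleton]
        refine ⟨fun e => ?_, List.nodup_singleton _⟩
        rcases h.edge_self_eq (by omega) e with c | c
        exacts [c₁ c, c₂ c]
    · have hj := List.mem_range.1 hj
      have hk := List.mem_range.1 hk
      have hn : n = 1 := by
        have key : ∀ k, e ∈ List.map (fun e : W × W => s(e.1, e.2))
            (if k = 0 ∧ x = 1 then [(φ true k, φ true (k + 1))]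
              else if k = n ∧ y = n then if n = 1 then [] else [(φ true k, φ true (k + 1))]
              else [(φ true k, φ true (k + 1)), (φ false k, φ false (k + 1))]) →
            ∃ s, s(φ s k, φ s (k + 1)) = e := by
          intro k hk
          split_ifs at hk <;> simp only [List.map_cons, List.map_nil, List.mem_cons,
            List.not_mem_nil, or_false] at hk
          · exact ⟨_, hk.symm⟩
          · exact ⟨_, hk.symm⟩
          · exact hk.elim (fun e => ⟨_, e.symm⟩) fun e => ⟨_, e.symm⟩
        obtain ⟨s, es⟩ := key j ha
        obtain ⟨t, et⟩ := key k hb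
        rcases Nat.lt_or_gt_of_ne hjk with hlt | hlt
        · exact h.edge_eq hlt (by omega) (es.trans et.symm)
        · exact h.edge_eq hlt (by omega) (et.trans es.symm)
      subst hn
      obtain rfl : x = 1 := by omega
      obtain rfl : y = 1 := by omega
      have : j = 1 ∨ k = 1 := by omega
      rcases this with rfl | rfl
      · simp at ha
      · simp at hb
  · have hadj : e ∈ G.edgeSet ↔ ∃ s k, k ≤ n ∧ s(φ s k, φ s (k + 1)) = e := by
      induction e with
      | _ a b =>
        rw [SimpleGraph.Subgraph.mem_edgeSet, h.adj_iff]
        simp only [Sym2.eq_iff]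
    rw [hadj]
    simp only [listing, List.map_flatMap, List.mem_flatMap, List.mem_range]
    constructor
    · rintro ⟨k, hk, he⟩
      split_ifs at he <;> simp only [List.map_cons, List.map_nil, List.mem_cons,
        List.not_mem_nil, or_false] at he
      · exact ⟨_, k, by omega, he.symm⟩
      · exact ⟨_, k, by omega, he.symm⟩
      · exact he.elim (fun e => ⟨_, k, by omega, e.symm⟩) fun e => ⟨_, k, by omega, e.symm⟩
    · rintro ⟨s, k, hk, rfl⟩
      by_cases c₁ : k = 0 ∧ x = 1
      · refine ⟨k, by omega, ?_⟩
        obtain ⟨rfl, rfl⟩ := c₁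
        have e₁ := h.first true
        have e₂ := h.first false
        cases s
        · simp [e₁, e₂, Sym2.eq_swap]
        · simp
      by_cases c₂ : k = n ∧ y = n
      · obtain ⟨e₄, e₅⟩ := c₂
        subst k
        subst y
        have e₁ := h.last true
        have e₂ := h.last false
        have hs : s(φ s n, φ s (n + 1)) = s(φ true n, φ true (n + 1)) := by
          cases s
          · rw [e₁, e₂, Sym2.eq_swap]
            rfl
          · rfl
        rw [hs]
        by_cases hn : n = 1
        · subst hn
          obtain rfl : x = 1 := by omega
          refine ⟨0, by omega, ?_⟩
          have e₃ := h.first true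
          rw [e₁, e₃]
          simp [Sym2.eq_swap]
        · refine ⟨n, by omega, ?_⟩
          rw [if_neg c₁, if_pos ⟨rfl, rfl⟩, if_neg hn]
          simp
      · refine ⟨k, by omega, ?_⟩
        rw [if_neg c₁, if_neg c₂]
        cases s <;> simp

end GraphForm

namespace ChainForm

variable {V : Type} [DecidableEq V] {F : ClauseSet V} {n x y : ℕ} {φ : ℕ → Literal V}

/-- A listing of the clauses. -/
def listing (n x y : ℕ) (φ : Bool → ℕ → Literal V) : List (List (Literal V)) :=
  (List.range (n + 1)).map fun k =>
    if (k = 0 ∧ x = 1) ∨ (k = n ∧ y = n) then [φ true (k + 1)] else [φ false k, φ true (k + 1)]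

theorem isListing (h : ChainForm F n x y φ) :
    IsListing (listing n x y fun s k => bif s then φ k else compl (φ k)) F := by
  have e : ∀ k ≤ n, List.toFinset (if (k = 0 ∧ x = 1) ∨ (k = n ∧ y = n) then [φ (k + 1)]
      else [compl (φ k), φ (k + 1)]) = {compl (φ k), φ (k + 1)} := by
    intro k hk
    split_ifs with c
    · rw [(h.compl_eq_succ_iff hk).2 c]
      simp
    · simp
  have hmap : (listing n x y fun s k => bif s then φ k else compl (φ k)).map List.toFinset =
      (List.range (n + 1)).map fun k => {compl (φ k), φ (k + 1)} := by
    rw [listing, List.map_map]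
    refine List.map_congr_left fun k hk => ?_
    have hk := List.mem_range.1 hk
    exact e k (by omega)
  refine ⟨?_, ?_, ?_⟩
  · rw [hmap]
    refine List.Nodup.map_on (fun j hj k hk q => ?_) List.nodup_range
    have hj := List.mem_range.1 hj
    have hk := List.mem_range.1 hk
    exact h.clause_injective (by omega) (by omega) q
  · intro C hC
    obtain ⟨k, hk, rfl⟩ := List.mem_map.1 hC
    have hk := List.mem_range.1 hk
    dsimp only
    split_ifs with c
    · simp
    · rw [← h.compl_eq_succ_iff (by omega)] at c
      simpa using c
  · rw [hmap]
    ext C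
    rw [h.mem_iff]
    simp

end ChainForm

end Listings

/-! ### Printers for the canonical clause-sets and graphs -/

section Output

variable {V : Type} [DecidableEq V]

namespace Pattern

/-- The literals of a pattern in the order of the walk, and their complements. -/
def literal (ι : ℕ+ ↪ V) (n x y : ℕ) (s : Bool) (k : ℕ) : Literal V :=
  bif s then walk ι n x y k else compl (walk ι n x y k)

/-- A listing of the clauses of a pattern. -/
def clauseListing (ι : ℕ+ ↪ V) (T : Pattern) : List (List (Literal V)) :=
  ChainForm.listing T.size T.lo T.hi (literal ι T.size T.lo T.hi)

/-- A listing of the implication graph of a pattern. -/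
def graphListing (ι : ℕ+ ↪ V) (T : Pattern) : GraphData (Literal V) :=
  GraphForm.listing T.size T.lo T.hi (literal ι T.size T.lo T.hi)

variable {ι : ℕ+ ↪ V}

theorem Valid.isListing {T : Pattern} (h : T.Valid) :
    IsListing (T.clauseListing ι) (T.clauseSet ι) := (chainForm ι h).isListing

theorem Valid.isGraphListing {T : Pattern} (h : T.Valid) :
    IsGraphListing (T.graphListing ι) (ig (T.clauseSet ι)) :=
  (chainForm ι h).graphForm.isGraphListing

variable {name : V → List Bool}

omit [DecidableEq V] in
theorem litName_literal (hι : ∀ k : ℕ+, name (ι k) = Computability.encodeNat (k : ℕ)) {n x y : ℕ}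
    (hx : 1 ≤ x) (hy : 1 ≤ y) (s : Bool) (k : ℕ) : litName name (literal ι n x y s k) =
      if k = 0 then (!s) :: Computability.encodeNat x
      else if k = n + 1 then (!s) :: Computability.encodeNat y
      else s :: Computability.encodeNat k := by
  have key : ∀ k : ℕ, 1 ≤ k → intLit ι (k : ℤ) = (ι k.toPNat', true) := fun k hk => by
    have : (0 : ℤ) < k := by omega
    simp [intLit]
    omega
  have hn : ∀ k, 1 ≤ k → name (ι k.toPNat') = Computability.encodeNat k := fun k hk => by
    rw [hι, Nat.toPNat'_coe, if_pos (by omega)]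
  unfold literal walk
  split_ifs with h₁ h₂
  · rw [intLit_neg ι hx, key x hx]
    cases s <;> simp [litName, compl, hn x hx]
  · rw [intLit_neg ι hy, key y hy]
    cases s <;> simp [litName, compl, hn y hy]
  · rw [key k (by omega)]
    cases s <;> simp [litName, compl, hn k (by omega)]

end Pattern

namespace Printer

variable {w : List Γ'} {ρ : ℕ → ℕ} {ι : ℕ+ ↪ V} {name : V → List Bool}

/-- Output of a literal of the walk; the indices of its position and the parameters are
`0`, `3`, `2`, `1`. -/
def literal (s : Bool) : Printer :=
  ite (.eq (.var 0) (.const 0)) (seq (emit (Γ'.bit !s)) (bits 2)) (seq (emit (Γ'.bit s)) (bits 0))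

/-- Output of the next literal of the walk. -/
def nextLiteral (s : Bool) : Printer :=
  ite (.eq (.var 0) (.var 3)) (seq (emit (Γ'.bit !s)) (bits 1))
    -- `bits` prints variables only, so `k + 1` is bound to one; it is at most `n` here, and thus a
    -- position.
    (seq (emit (Γ'.bit s)) (bind (.add (.var 1) (.const 1)) (bits 0)))

variable (hι : ∀ k : ℕ+, name (ι k) = Computability.encodeNat (k : ℕ)) {n x y k : ℕ}
  (hn : n < w.length) (hx : 1 ≤ x) (hxy : x ≤ y) (hy : y ≤ n) (hk : k ≤ n)

omit [DecidableEq V]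

include hι hn hx hxy hy hk

theorem out_literal (s : Bool) : (literal s).out w (cons k (cons y (cons x (cons n ρ)))) =
    encBits (litName name (Pattern.literal ι n x y s k)) := by
  classical
  have e₀ : (bits 0).out w (cons k (cons y (cons x (cons n ρ)))) =
      encBits (Computability.encodeNat k) := out_bits (i := 0) (show k ≤ w.length by omega)
  have e₂ : (bits 2).out w (cons k (cons y (cons x (cons n ρ)))) =
      encBits (Computability.encodeNat x) := out_bits (i := 2) (show x ≤ w.length by omega)
  rw [Pattern.litName_literal hι hx (by omega)]
  simp only [literal, out_ite, Arith.sat_eq, Arith.val, out.eq_2, out.eq_3, e₀, e₂, cons_zero]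
  have : k ≠ n + 1 := by omega
  split_ifs <;> rfl

theorem out_nextLiteral (s : Bool) : (nextLiteral s).out w (cons k (cons y (cons x (cons n ρ)))) =
    encBits (litName name (Pattern.literal ι n x y s (k + 1))) := by
  classical
  have e₁ : (bits 1).out w (cons k (cons y (cons x (cons n ρ)))) =
      encBits (Computability.encodeNat y) := out_bits (i := 1) (show y ≤ w.length by omega)
  rw [Pattern.litName_literal hι hx (by omega)]
  simp only [nextLiteral, out_ite, Arith.sat_eq, Arith.val, out.eq_2, out.eq_3, e₁, cons_zero]
  change (if k = n then _ else _) = _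
  rw [if_neg (show ¬ k + 1 = 0 by omega)]
  by_cases h : k = n
  · rw [if_pos h, if_pos (by omega)]
    rfl
  · rw [if_neg h, if_neg (by omega), out_bind (v := k + 1) (by omega) (fun _ => rfl),
      out_bits (i := 0) (show k + 1 ≤ w.length by omega)]
    rfl

omit hι hn hx hxy hy hk in
/-- Output of the clauses of the pattern whose parameters have the indices `2`, `1`, `0`. -/
def clauses : Printer :=
  upTo 3 (seq (emit Γ'.bra) (seq
    (ite (.or (.and (.eq (.var 0) (.const 0)) (.eq (.var 2) (.const 1)))
        (.and (.eq (.var 0) (.var 3)) (.eq (.var 1) (.var 3))))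
      (seq (emit Γ'.comma) (nextLiteral true))
      (seq (emit Γ'.comma) (seq (literal false) (seq (emit Γ'.comma) (nextLiteral true)))))
    (emit Γ'.ket)))

omit hk in
theorem out_clauses : clauses.out w (cons y (cons x (cons n ρ))) =
    encClauses name (ChainForm.listing n x y (Pattern.literal ι n x y)) := by
  classical
  have := fun body => out_upTo (w := w) (ρ := cons y (cons x (cons n ρ))) (i := 2) (body := body)
  unfold clauses
  rw [this _ hn, encClauses, ChainForm.listing, List.flatMap_map]
  simp only [List.flatMap]
  congr 1
  refine List.map_congr_left fun k hk => ?_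
  have hk : k ≤ n := by
    have : k < n + 1 := List.mem_range.1 hk
    omega
  simp only [out_ite, Arith.sat_or, Arith.sat_and, Arith.sat_eq, Arith.val, out.eq_2, out.eq_3,
    out_literal hι hn hx hxy hy hk, out_nextLiteral hι hn hx hxy hy hk]
  change _ ++ ((if (k = 0 ∧ x = 1) ∨ (k = n ∧ y = n) then _ else _) ++ _) = _
  split_ifs <;> simp

omit hι hn hx hxy hy hk in
/-- Output of an edge of the implication graph. -/
def edge (s : Bool) : Printer :=
  seq (emit Γ'.bra) (seq (literal s) (seq (emit Γ'.comma) (seq (nextLiteral s) (emit Γ'.ket))))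

omit hι hn hx hxy hy hk in
/-- Output of the implication graph of the pattern whose parameters have the indices
`2`, `1`, `0`. -/
def graph : Printer :=
  seq (upTo 3 (ite (.eq (.var 0) (.const 0)) nil
      (seq (emit Γ'.bra) (seq (literal true) (seq (emit Γ'.ket)
        (seq (emit Γ'.bra) (seq (literal false) (emit Γ'.ket))))))))
    (upTo 3 (ite (.and (.eq (.var 0) (.const 0)) (.eq (.var 2) (.const 1))) (edge true)
      (ite (.and (.eq (.var 0) (.var 3)) (.eq (.var 1) (.var 3)))
        (ite (.eq (.var 3) (.const 1)) nil (edge true)) (seq (edge true) (edge false)))))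

omit hk in
theorem out_graph : graph.out w (cons y (cons x (cons n ρ))) =
    encGraph (litName name) (GraphForm.listing n x y (Pattern.literal ι n x y)) := by
  classical
  have := fun body => out_upTo (w := w) (ρ := cons y (cons x (cons n ρ))) (i := 2) (body := body)
  unfold graph
  rw [out.eq_3, this _ hn, this _ hn, encGraph, GraphForm.listing, List.flatMap_assoc,
    List.flatMap_assoc]
  congr 1
  · simp only [List.flatMap]
    congr 1
    refine List.map_congr_left fun k hk => ?_
    have hk : k ≤ n := by
      have : k < n + 1 := List.mem_range.1 hk
      omega
    simp only [out_ite, Arith.sat_eq, Arith.val, out.eq_1, out.eq_2, out.eq_3, cons_zero,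
      out_literal hι hn hx hxy hy hk]
    split_ifs <;> simp
  · simp only [List.flatMap]
    congr 1
    refine List.map_congr_left fun k hk => ?_
    have hk : k ≤ n := by
      have : k < n + 1 := List.mem_range.1 hk
      omega
    simp only [edge, out_ite, Arith.sat_and, Arith.sat_eq, Arith.val, out.eq_1, out.eq_2, out.eq_3,
      out_literal hι hn hx hxy hy hk, out_nextLiteral hι hn hx hxy hy hk]
    change (if k = 0 ∧ x = 1 then _ else if k = n ∧ y = n then if n = 1 then _ else _ else _) = _
    split_ifs <;> simp

end Printer

end Output

end TwoMU

namespace TwoMU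
open Computability (Γ')

/-! ### Polynomial time -/

section PolynomialTime

variable {V : Type} [DecidableEq V]

/-- The number `2n` counts positions of the string, and `n ≥ 1`; hence `n < |w|`, and the search
over positions reaches all parameters. -/
theorem Arith.bounds_of_sat_hasParams {w : List Γ'} {ρ : ℕ → ℕ} {A : ℕ → ℕ → Arith} {B : ℕ → Arith}
    {n x y : ℕ} (h : (hasParams A B).Sat w (cons y (cons x (cons n ρ)))) :
    1 ≤ x ∧ x ≤ y ∧ y ≤ n ∧ x + y ≤ n + 1 ∧ n < w.length := by
  simp only [hasParams, sat_and, sat_eq, sat_le] at h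
  obtain ⟨h₀, h₁, h₂, h₃, h₄, -⟩ := h
  simp only [val, cons_zero, cons_succ] at h₁ h₂ h₃ h₄
  have h₅ : Nat.count (fun k => (B 0).val w (cons k (cons y (cons x (cons n ρ)))) ≠ 0) w.length =
      n + n := h₀
  have h₆ := Nat.count_le (fun k => (B 0).val w (cons k (cons y (cons x (cons n ρ)))) ≠ 0)
    (n := w.length)
  have h₁' : 1 ≤ x := h₁
  have h₂' : x ≤ y := h₂
  have h₃' : y ≤ n := h₃
  have h₄' : x + y ≤ n + 1 := h₄
  omega

theorem Printer.out_withParams_hasParams {w : List Γ'} {ρ : ℕ → ℕ} {A : ℕ → ℕ → Arith}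
    {B : ℕ → Arith} {n x y : ℕ} (h : ∀ n' x' y',
      (Arith.hasParams A B).Sat w (cons y' (cons x' (cons n' ρ))) ↔ n' = n ∧ x' = x ∧ y' = y)
    (body : Printer) : (withParams (Arith.hasParams A B) body).out w ρ =
      body.out w (cons y (cons x (cons n ρ))) := by
  have hb := Arith.bounds_of_sat_hasParams ((h n x y).2 ⟨rfl, rfl, rfl⟩)
  exact out_withParams hb.2.2.2.2 (by omega) (by omega) h

variable {name : V → List Bool}

/-- Functions of the type of a listed clause-set are computable in polynomial time if they can be
printed, given the parameters. -/
theorem polyTime_clauses (hname : Function.Injective name) {β : Type} {eb : β → List Γ'}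
    {g : Pattern → β} (body : Printer) (hbody : ∀ (w : List Γ') (ρ : ℕ → ℕ) (n x y : ℕ),
      n < w.length → 1 ≤ x → x ≤ y → y ≤ n → x + y ≤ n + 1 →
      body.out w (cons y (cons x (cons n ρ))) = eb (g (Pattern.ofTriple n x y))) :
    PolyTime (fun P : CnfInput V => encClauses name P.1) eb fun P => g (typeOf P.toClauseSet) := by
  refine polyTime_of_printer (.withParams
    (Arith.hasParams Arith.cnfAdj (Arith.firstToken Γ'.comma)) body) fun P => ?_
  obtain ⟨F, hF, hL⟩ := P.2
  have e : P.toClauseSet = F := hL.2.2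
  obtain ⟨x, y, φ, hxy, hφ⟩ := hF.exists_normal
  have hs := fun n' x' y' => hφ.sat_hasParams hname hL hxy n' x' y' fun _ => 0
  have hb := Arith.bounds_of_sat_hasParams ((hs _ _ _).2 ⟨rfl, rfl, rfl⟩)
  rw [Printer.out_withParams_hasParams hs, hbody _ _ _ _ _ hb.2.2.2.2 hb.1 hb.2.1 hb.2.2.1 hxy, e,
    hφ.typeOf_eq hxy]

/-- A clause-set whose implication graph is isomorphic to the listed graph. -/
noncomputable def GraphInput.toClauseSet {W : Type} (Q : GraphInput V W) : ClauseSet V := Q.2.choose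

theorem GraphInput.toClauseSet_spec {W : Type} (Q : GraphInput V W) :
    IsTwoMUDefOne Q.toClauseSet ∧
      ∃ G : Graph W, IsGraphListing Q.1 G ∧ GraphIso G (ig Q.toClauseSet) := Q.2.choose_spec

/-- Functions of the type of a clause-set are computable in polynomial time from a listed copy of
its implication graph if they can be printed, given the parameters. -/
theorem polyTime_graph {W : Type} {nameW : W → List Bool} (hname : Function.Injective nameW)
    {β : Type} {eb : β → List Γ'} {g : Pattern → β} (body : Printer)
    (hbody : ∀ (w : List Γ') (ρ : ℕ → ℕ) (n x y : ℕ),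
      n < w.length → 1 ≤ x → x ≤ y → y ≤ n → x + y ≤ n + 1 →
      body.out w (cons y (cons x (cons n ρ))) = eb (g (Pattern.ofTriple n x y))) :
    PolyTime (fun Q : GraphInput V W => encGraph nameW Q.1) eb
      fun Q => g (typeOf Q.toClauseSet) := by
  refine polyTime_of_printer (.withParams
    (Arith.hasParams Arith.graphAdj (Arith.firstToken Γ'.bra)) body) fun Q => ?_
  obtain ⟨hF, G, hL, hG⟩ := Q.toClauseSet_spec
  obtain ⟨x, y, φ, hxy, hφ⟩ := hF.exists_normal
  obtain ⟨i⟩ := hG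
  obtain ⟨ψ, hψ⟩ := hφ.graphForm.of_graphIso ⟨i.symm⟩
  have hs := fun n' x' y' => hψ.sat_hasParams hname hL hxy n' x' y' fun _ => 0
  have hb := Arith.bounds_of_sat_hasParams ((hs _ _ _).2 ⟨rfl, rfl, rfl⟩)
  rw [Printer.out_withParams_hasParams hs, hbody _ _ _ _ _ hb.2.2.2.2 hb.1 hb.2.1 hb.2.2.1 hxy,
    hφ.typeOf_eq hxy]

/-- Two clause-sets whose implication graphs are isomorphic to listed graphs with the same listing
are isomorphic. -/
theorem iso_of_isGraphListing {W : Type} {Q : GraphData W} {G G' : Graph W} {F F' : ClauseSet V}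
    (h : IsGraphListing Q G) (h' : IsGraphListing Q G') (hF : IsTwoMUDefOne F)
    (hF' : IsTwoMUDefOne F') (i : GraphIso G (ig F)) (i' : GraphIso G' (ig F')) : Iso F F' := by
  have e : G = G' := by
    refine SimpleGraph.Subgraph.ext (Set.ext fun a => (h.2.1 a).symm.trans (h'.2.1 a)) ?_
    funext a b
    exact propext ((h.adj_iff a b).trans (h'.adj_iff a b).symm)
  subst e
  obtain ⟨i⟩ := i
  obtain ⟨i'⟩ := i'
  exact (iso_iff_graphIso hF hF').2 ⟨i.symm.trans i'⟩

variable {ι : ℕ+ ↪ V}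

omit [DecidableEq V] in
theorem Printer.out_clauses_ofTriple
    (hι : ∀ k : ℕ+, name (ι k) = Computability.encodeNat (k : ℕ)) (w : List Γ') (ρ : ℕ → ℕ)
    (n x y : ℕ) (hn : n < w.length) (h₁ : 1 ≤ x) (h₂ : x ≤ y) (h₃ : y ≤ n) (h₄ : x + y ≤ n + 1) :
    clauses.out w (cons y (cons x (cons n ρ))) =
      encClauses name ((Pattern.ofTriple n x y).clauseListing ι) := by
  obtain ⟨-, e₁, e₂, e₃⟩ := Pattern.valid_ofTriple h₁ h₂ h₃ h₄
  rw [out_clauses hι hn h₁ h₂ h₃, Pattern.clauseListing, e₁, e₂, e₃]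

omit [DecidableEq V] in
theorem Printer.out_graph_ofTriple
    (hι : ∀ k : ℕ+, name (ι k) = Computability.encodeNat (k : ℕ)) (w : List Γ') (ρ : ℕ → ℕ)
    (n x y : ℕ) (hn : n < w.length) (h₁ : 1 ≤ x) (h₂ : x ≤ y) (h₃ : y ≤ n) (h₄ : x + y ≤ n + 1) :
    graph.out w (cons y (cons x (cons n ρ))) =
      encGraph (litName name) ((Pattern.ofTriple n x y).graphListing ι) := by
  obtain ⟨-, e₁, e₂, e₃⟩ := Pattern.valid_ofTriple h₁ h₂ h₃ h₄
  rw [out_graph hι hn h₁ h₂ h₃, Pattern.graphListing, e₁, e₂, e₃]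

end PolynomialTime

end TwoMU

open TwoMU in
theorem mainTheorem4 (VA : Type) [DecidableEq VA] (ι : ℕ+ ↪ VA) :
    -- the four families consist of 2-MUs of deficiency one
    (∀ T : Pattern, T.Valid → IsTwoMUDefOne (T.clauseSet ι)) ∧
    -- exactly one case applies, with uniquely determined parameters
    (∀ F : ClauseSet VA, IsTwoMUDefOne F → ∃! T : Pattern, T.Valid ∧ Iso F (T.clauseSet ι)) ∧
    ∃ typ : ClauseSet VA → Pattern,
      (∀ F : ClauseSet VA, IsTwoMUDefOne F →
        (typ F).Valid ∧ Iso F ((typ F).clauseSet ι) ∧ (typ F).Applies F ∧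
        (typ F).upper = unitCount F ∧ (typ F).size = (vars F).card) ∧
      -- canonisation by clause-sets
      (∀ F F' : ClauseSet VA, IsTwoMUDefOne F → IsTwoMUDefOne F' →
        (Iso F F' ↔ (typ F).clauseSet ι = (typ F').clauseSet ι)) ∧
      -- canonisation by implication graphs
      (∀ F F' : ClauseSet VA, IsTwoMUDefOne F → IsTwoMUDefOne F' →
        (Iso F F' ↔ ig ((typ F).clauseSet ι) = ig ((typ F').clauseSet ι))) ∧
      -- the implication graph determines the clause-set up to isomorphism
      (∀ F F' : ClauseSet VA, IsTwoMUDefOne F → IsTwoMUDefOne F' →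
        (Iso F F' ↔ GraphIso (ig F) (ig F'))) ∧
      -- polynomial time, for variables named by bit-strings, natural numbers in binary
      ∀ name : VA → List Bool, Function.Injective name →
        (∀ k : ℕ+, name (ι k) = Computability.encodeNat (k : ℕ)) →
        -- the case and the parameters
        PolyTime (fun P : CnfInput VA => encClauses name P.1) encPattern
          (fun P => typ P.toClauseSet) ∧
        -- the canonical clause-set
        (∃ out : Pattern → List (List (Literal VA)),
          (∀ T : Pattern, T.Valid → IsListing (out T) (T.clauseSet ι)) ∧
          PolyTime (fun P : CnfInput VA => encClauses name P.1) (encClauses name)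
            (fun P => out (typ P.toClauseSet))) ∧
        -- its implication graph
        (∃ out : Pattern → GraphData (Literal VA),
          (∀ T : Pattern, T.Valid → IsGraphListing (out T) (ig (T.clauseSet ι))) ∧
          PolyTime (fun P : CnfInput VA => encClauses name P.1) (encGraph (litName name))
            (fun P => out (typ P.toClauseSet))) ∧
        -- reconstruction from any copy of the implication graph
        ∀ (W : Type) (nameW : W → List Bool), Function.Injective nameW →
          ∃ rec : GraphInput VA W → List (List (Literal VA)),
            (∀ (Q : GraphInput VA W) (F : ClauseSet VA) (G : Graph W), IsTwoMUDefOne F →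
              IsGraphListing Q.1 G → GraphIso G (ig F) →
              ∃ H : ClauseSet VA, IsListing (rec Q) H ∧ Iso F H) ∧
            PolyTime (fun Q : GraphInput VA W => encGraph nameW Q.1) (encClauses name) rec := by
  refine ⟨fun T hT => (Pattern.chainForm ι hT).isTwoMUDefOne,
    fun F hF => existsUnique_pattern ι hF, typeOf, fun F hF => typeOf_spec ι hF,
    fun F F' hF hF' => iso_iff_clauseSet_eq ι hF hF', fun F F' hF hF' => iso_iff_ig_eq ι hF hF',
    fun F F' hF hF' => iso_iff_graphIso hF hF', fun name hname hι => ⟨?_, ?_, ?_, ?_⟩⟩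
  · exact polyTime_clauses hname (g := id) .pattern fun w ρ n x y hn _ h₂ h₃ _ =>
      Printer.out_pattern hn (h₂.trans h₃) h₃
  · exact ⟨Pattern.clauseListing ι, fun T hT => hT.isListing,
      polyTime_clauses hname .clauses (Printer.out_clauses_ofTriple hι)⟩
  · exact ⟨Pattern.graphListing ι, fun T hT => hT.isGraphListing,
      polyTime_clauses hname .graph (Printer.out_graph_ofTriple hι)⟩
  · intro W nameW hnameW
    refine ⟨fun Q => (typeOf Q.toClauseSet).clauseListing ι, fun Q F G hF hL hG => ?_,
      polyTime_graph hnameW .clauses (Printer.out_clauses_ofTriple hι)⟩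
    -- The clause-set chosen for `Q` need not be `F`. Both fit the same listing, so they are
    -- isomorphic and have the same canonical form.
    obtain ⟨hF', G', hL', hG'⟩ := Q.toClauseSet_spec
    have hs := typeOf_spec ι hF
    refine ⟨(typeOf F).clauseSet ι, ?_, hs.2.1⟩
    beta_reduce
    rw [(typeOf_eq_iff hF' hF).2 (iso_of_isGraphListing hL' hL hF' hF hG' hG)]
    exact hs.1.isListing
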